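/- Let $\mathbb F$ be a field of characteristic zero (e.g. $\mathbb Q$), let $n>2$, and let $M$ be a connected, orientable $n$-manifold (without boundary), with a chosen $\mathbb F$-orientation (for instance the one induced by an ordinary orientation). Let $H_c^*(M)$ be compactly supported singular cohomology with coefficients in $\mathbb F$, let $\mathcal L(v)$ be the free graded Lie algebra on one generator $v$ of degree $n-1$ and weight $1$ (so $\mathcal L(v)$ has basis $v$ if $n$ is odd, and basis $v,[v,v]$ if $n$ is even), and let $$\mathfrak g_M=H_c^{-*}(M)\otimes\mathcal L(v),\qquad [\alpha\otimes v,\beta\otimes v]=(-1)^{|v||\beta|}(\alpha\smile\beta)\otimes[v,v],$$ graded by (homological) degree and weight. Let $\mathrm{CE}(\mathfrak g_M)=(\mathrm{Sym}(\mathfrak g_M[1]),d)$ be its Chevalley–Eilenberg complex, where $\mathfrak g_M[1]$ is the homological suspension (elements of degree $i$ in $\mathfrak g_M$ have degree $i+1$ in $\mathfrak g_M[1]$) and $d$ is the coderivation $$d(x_1\cdots x_r)=\sum_{i<j}(-1)^{|x_i|}\,\epsilon_{ij}\,[x_i,x_j]\,x_1\cdots\hat x_i\cdots\hat x_j\cdots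 x_r,$$ with $\epsilon_{ij}$ the Koszul sign of moving $x_i,x_j$ to the front. Let $\mathrm{CE}(\mathfrak g_M)_k$ be its summand of weight $k$, and let $\Delta$ be the shuffle coproduct on $\mathrm{Sym}(\mathfrak g_M[1])$, for which the elements of $\mathfrak g_M[1]$ are primitive. There is a unique class $x\in H^n_c(M)$ which is Poincaré dual to the class of a point in $H_0(M)$. Regard $x=x\otimes v$ as an element of degree $0$ and weight $1$ of $\mathfrak g_M[1]\subseteq\mathrm{CE}(\mathfrak g_M)$. There is a unique linear functional $\lambda$ on $\mathrm{CE}(\mathfrak g_M)$ dual to $x$, i.e. with $\lambda(x)=1$ and with $\lambda$ vanishing on all elements of bidegree (degree, weight) other than $(0,1)$. The cap product $\lambda\frown c=\sum_i\langle\lambda,c_i\rangle c_i'$, where $\Delta(c)=\sum_i c_i\otimes c_i'$, has the following properties. 1. It acts as $d/dx$: $\lambda\frown(x^r y)=r\,x^{r-1}y$ for all $r\ge 0$ and all $y$ in the subalgebra of $\mathrm{Sym}(\mathfrak g_M[1])$ generated by the homogeneous elements of $\mathfrak g_M[1]$ of bidegree other than $(0,1)$. 2. For every $k\ge 0$ it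 restricts to a chain map $\mathrm{CE}(\mathfrak g_M)_{k+1}\to\mathrm{CE}(\mathfrak g_M)_k$, which is surjective in every degree and bijective in every degree $i\le k$. 3. For every $k\ge0$ and every $i\le k$, this chain map induces an isomorphism $$H_i(\mathrm{CE}(\mathfrak g_M)_{k+1})\xrightarrow{\ \cong\ }H_i(\mathrm{CE}(\mathfrak g_M)_k).$$ -/

import Mathlib

noncomputable section

namespace ConfLie

universe u v

/-! ### Cochains on ordered tuples -/

section Tuples

variable {S : Type*} {F : Type*} [Field F]

/-- The coboundary of a function of `m + 1` vertices. -/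
def tupleD {m : ℕ} (φ : (Fin (m + 1) → S) → F) : (Fin (m + 2) → S) → F :=
  fun a => ∑ i : Fin (m + 2), (-1 : F) ^ (i : ℕ) * φ (a ∘ i.succAbove)

/-- The first `p + 1` of `m + 1` vertices, where `p + q = m`. -/
def frontMap {p q m : ℕ} (h : p + q = m) (i : Fin (p + 1)) : Fin (m + 1) := ⟨i, by omega⟩

/-- The last `q + 1` of `m + 1` vertices, where `p + q = m`. -/
def backMap {p q m : ℕ} (h : p + q = m) (i : Fin (q + 1)) : Fin (m + 1) := ⟨p + i, by omega⟩

def tupleCup {p q m : ℕ} (h : p + q = m) (φ : (Fin (p + 1) → S) → F)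
    (ψ : (Fin (q + 1) → S) → F) : (Fin (m + 1) → S) → F :=
  fun a => φ (a ∘ frontMap h) * ψ (a ∘ backMap h)

/-- The function with its first vertex fixed. -/
def tupleCone {m : ℕ} (s : S) (φ : (Fin (m + 2) → S) → F) : (Fin (m + 1) → S) → F :=
  fun b => φ (Fin.cons s b)

/-- The sign of the reversal of `m + 1` vertices. -/
def revSign (F : Type*) [Field F] (m : ℕ) : F := (-1) ^ (m * (m + 1) / 2)

def tupleRev {m : ℕ} (φ : (Fin (m + 1) → S) → F) : (Fin (m + 1) → S) → F :=
  fun a => revSign F m * φ (a ∘ Fin.rev)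

/-- The chain homotopy between reversal of vertices and the identity. -/
def tuplePrism : (m : ℕ) → ((Fin (m + 2) → S) → F) → (Fin (m + 1) → S) → F
  | 0, _ => 0
  | m + 1, φ => fun a =>
      tupleRev (tupleCone (a 0) φ) a - tupleCone (a 0) φ a
        - tupleD (tuplePrism m (tupleCone (a 0) φ)) a

lemma tupleD_cons {m : ℕ} (φ : (Fin (m + 2) → S) → F) (s : S) (b : Fin (m + 2) → S) :
    tupleD φ (Fin.cons s b : Fin (m + 3) → S) = φ b - tupleD (tupleCone s φ) b := by
  unfold tupleD tupleCone
  rw [Fin.sum_univ_succ, sub_eq_add_neg, ← Finset.sum_neg_distrib]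
  congr 1
  · simp only [Fin.val_zero, pow_zero, one_mul]
    congr 1
  · refine Finset.sum_congr rfl fun i _ => ?_
    have : (Fin.cons s b : Fin (m + 3) → S) ∘ i.succ.succAbove
        = (Fin.cons s (b ∘ i.succAbove) : Fin (m + 2) → S) := by
      funext j
      refine Fin.cases ?_ (fun j => ?_) j <;> simp
    rw [this, Fin.val_succ, pow_succ]
    ring

lemma tupleD_add {m : ℕ} (φ ψ : (Fin (m + 1) → S) → F) :
    tupleD (φ + ψ) = tupleD φ + tupleD ψ := by
  funext a
  simp [tupleD, mul_add, Finset.sum_add_distrib]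

lemma tupleD_sub {m : ℕ} (φ ψ : (Fin (m + 1) → S) → F) :
    tupleD (φ - ψ) = tupleD φ - tupleD ψ := by
  funext a
  simp [tupleD, mul_sub, Finset.sum_sub_distrib]

lemma tupleD_tupleD {m : ℕ} (φ : (Fin (m + 1) → S) → F) : tupleD (tupleD φ) = 0 := by
  induction m with
  | zero =>
    funext a
    simp only [tupleD, Fin.sum_univ_succ]
    have h1 : ∀ i j : Fin 1 → Fin 3, (∀ k, i k = j k) → a ∘ i = a ∘ j := by
      intro i j h; rw [funext h]
    simp
    rw [Function.comp_assoc, Function.comp_assoc, Function.comp_assoc, Function.comp_assoc,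
      Function.comp_assoc, Function.comp_assoc]
    rw [h1 (Fin.succ ∘ Fin.succ) (Fin.succAbove 1 ∘ Fin.succ) (by decide),
      h1 (Fin.succ ∘ Fin.succAbove 1) (Fin.succAbove 2 ∘ Fin.succ) (by decide),
      h1 (Fin.succAbove 1 ∘ Fin.succAbove 1) (Fin.succAbove 2 ∘ Fin.succAbove 1) (by decide)]
    ring
  | succ m ih =>
    funext a
    obtain ⟨s, b, rfl⟩ : ∃ s b, a = Fin.cons s b := ⟨a 0, Fin.tail a, (Fin.cons_self_tail a).symm⟩
    rw [tupleD_cons]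
    have : tupleCone s (tupleD φ) = φ - tupleD (tupleCone s φ) := by
      funext b; exact tupleD_cons φ s b
    rw [this, tupleD_sub, ih]
    simp

lemma revSign_succ (m : ℕ) : revSign F (m + 1) = revSign F m * (-1) ^ (m + 1) := by
  unfold revSign
  rw [← pow_add]
  congr 1
  rw [show (m + 1) * (m + 1 + 1) = m * (m + 1) + (m + 1) * 2 by ring,
    Nat.add_mul_div_right _ _ (by norm_num)]

lemma revSign_mul_self (m : ℕ) : revSign F m * revSign F m = 1 := by
  unfold revSign
  rw [← mul_pow]; simp

lemma revSign_add (p q : ℕ) :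
    revSign F (p + q) = revSign F p * revSign F q * (-1) ^ (p * q) := by
  induction q with
  | zero => simp [revSign]
  | succ q ih =>
    rw [← add_assoc, revSign_succ, ih, revSign_succ, mul_add, pow_add, pow_add, pow_add]
    ring

lemma tupleD_tupleRev {m : ℕ} (φ : (Fin (m + 1) → S) → F) :
    tupleD (tupleRev φ) = tupleRev (tupleD φ) := by
  funext a
  simp only [tupleD, tupleRev]
  rw [← Equiv.sum_comp Fin.revPerm, Finset.mul_sum]
  refine Finset.sum_congr rfl fun i _ => ?_
  have h : (a ∘ Fin.rev) ∘ i.succAbove = (a ∘ (Fin.revPerm i).succAbove) ∘ Fin.rev := by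
    funext j
    simp [Fin.succAbove_rev_right]
  rw [h, revSign_succ]
  have h2 : ((-1 : F)) ^ ((Fin.revPerm i : Fin (m + 2)) : ℕ) = (-1) ^ (m + 1) * (-1) ^ (i : ℕ) := by
    have : ((Fin.revPerm i : Fin (m + 2)) : ℕ) + i = m + 1 := by
      simp [Fin.val_rev]; omega
    rw [← this, pow_add, mul_assoc, ← mul_pow]; simp
  rw [h2]
  ring

lemma tupleRev_sub {m : ℕ} (φ ψ : (Fin (m + 1) → S) → F) :
    tupleRev (φ - ψ) = tupleRev φ - tupleRev ψ := by
  funext a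
  simp [tupleRev, mul_sub]

lemma tuplePrism_sub (m : ℕ) (φ ψ : (Fin (m + 2) → S) → F) :
    tuplePrism m (φ - ψ) = tuplePrism m φ - tuplePrism m ψ := by
  induction m with
  | zero => simp [tuplePrism]
  | succ m ih =>
    funext a
    have : tupleCone (a 0) (φ - ψ) = tupleCone (a 0) φ - tupleCone (a 0) ψ := rfl
    simp only [tuplePrism, this, ih, tupleD_sub, tupleRev_sub, Pi.sub_apply]
    ring

lemma tuplePrism_tupleD_zero (φ : (Fin 1 → S) → F) : tupleRev φ - φ = 0 := by
  funext a
  have : a ∘ Fin.rev = a := by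
    funext i
    exact congrArg a (Subsingleton.elim (α := Fin 1) _ _)
  simp [tupleRev, revSign, this]

lemma tuplePrism_tupleD (m : ℕ) (φ : (Fin (m + 2) → S) → F) :
    tuplePrism (m + 1) (tupleD φ) = tupleRev φ - φ - tupleD (tuplePrism m φ) := by
  induction m with
  | zero =>
    funext a
    have hc : tupleCone (a 0) (tupleD φ) = φ - tupleD (tupleCone (a 0) φ) := by
      funext b; exact tupleD_cons φ _ b
    have h0 := tuplePrism_tupleD_zero (tupleCone (a 0) φ)
    have h1 : tupleRev (tupleD (tupleCone (a 0) φ)) - tupleD (tupleCone (a 0) φ) = 0 := by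
      rw [← tupleD_tupleRev, ← tupleD_sub, h0]; funext b; simp [tupleD]
    have h2 := congrFun h1 a
    simp only [tuplePrism, hc, tupleRev_sub, Pi.sub_apply, Pi.zero_apply] at h2 ⊢
    linear_combination -h2
  | succ m ih =>
    funext a
    have hc : tupleCone (a 0) (tupleD φ) = φ - tupleD (tupleCone (a 0) φ) := by
      funext b; exact tupleD_cons φ _ b
    change tupleRev (tupleCone (a 0) (tupleD φ)) a - tupleCone (a 0) (tupleD φ) a -
      tupleD (tuplePrism (m + 1) (tupleCone (a 0) (tupleD φ))) a = _
    rw [hc, tuplePrism_sub, ih, tupleD_sub, tupleD_sub, tupleD_sub, tupleRev_sub,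
      tupleD_tupleD, tupleD_tupleRev]
    simp only [Pi.sub_apply, Pi.zero_apply]
    ring

lemma tuplePrism_comp {T : Type*} (s : S → T) (m : ℕ) (φ : (Fin (m + 2) → T) → F)
    (a : Fin (m + 1) → S) :
    tuplePrism m (fun b => φ (s ∘ b)) a = tuplePrism m φ (s ∘ a) := by
  induction m with
  | zero => rfl
  | succ m ih =>
    have hc : ∀ b : Fin (m + 2) → S, s ∘ (Fin.cons (a 0) b : Fin (m + 3) → S)
        = Fin.cons (s (a 0)) (s ∘ b) := by
      intro b; funext j; refine Fin.cases ?_ (fun j => ?_) j <;> simp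
    have hcone : tupleCone (a 0) (fun b : Fin (m + 3) → S => φ (s ∘ b))
        = fun b => tupleCone (s (a 0)) φ (s ∘ b) := by
      funext b; simp only [tupleCone, hc]
    simp only [tuplePrism, hcone, tupleRev, tupleD, ih]
    rfl

lemma tuplePrism_zero (m : ℕ) : tuplePrism m (0 : (Fin (m + 2) → S) → F) = 0 := by
  have := tuplePrism_sub m (0 : (Fin (m + 2) → S) → F) 0
  simpa using this

lemma tupleCup_rev {p q m : ℕ} (h : p + q = m) (h' : q + p = m) (φ : (Fin (p + 1) → S) → F)
    (ψ : (Fin (q + 1) → S) → F) :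
    tupleRev (tupleCup h φ ψ)
      = (-1 : F) ^ (p * q) • tupleCup h' (tupleRev ψ) (tupleRev φ) := by
  funext a
  simp only [tupleRev, tupleCup, Pi.smul_apply, smul_eq_mul]
  have h1 : (a ∘ Fin.rev) ∘ frontMap h = (a ∘ backMap h') ∘ Fin.rev := by
    funext i
    simp only [Function.comp, frontMap, backMap]
    congr 1
    ext; simp [Fin.val_rev]; omega
  have h2 : (a ∘ Fin.rev) ∘ backMap h = (a ∘ frontMap h') ∘ Fin.rev := by
    funext i
    simp only [Function.comp, frontMap, backMap]
    congr 1
    ext; simp [Fin.val_rev]; omega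
  have h3 : revSign F m = revSign F p * revSign F q * (-1) ^ (p * q) := by
    rw [← h, revSign_add]
  rw [h1, h2, h3]
  ring

/-- The Leibniz rule. -/
lemma tupleD_tupleCup {p q m : ℕ} (h : p + q = m) (φ : (Fin (p + 1) → S) → F)
    (ψ : (Fin (q + 1) → S) → F) :
    tupleD (tupleCup h φ ψ)
      = tupleCup (show (p + 1) + q = m + 1 by omega) (tupleD φ) ψ
        + (-1 : F) ^ p • tupleCup (show p + (q + 1) = m + 1 by omega) φ (tupleD ψ) := by
  induction p generalizing m with
  | zero =>
    obtain rfl : q = m := by omega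
    funext a
    obtain ⟨s, b, rfl⟩ : ∃ s b, a = Fin.cons s b := ⟨a 0, Fin.tail a, (Fin.cons_self_tail a).symm⟩
    have hfm : ∀ c : Fin (q + 1) → S, c ∘ frontMap h = fun _ => c 0 := by
      intro c; funext i; simp only [Function.comp]; congr 1; ext; simp [frontMap]
    have hbm : ∀ c : Fin (q + 1) → S, c ∘ backMap h = c := by
      intro c; funext i; simp only [Function.comp]; congr 1; ext; simp [backMap]
    have e1 : tupleD (tupleCup h φ ψ) (Fin.cons s b : Fin (q + 2) → S) =
        φ (fun _ => b 0) * ψ b + φ (fun _ => s) *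
          (tupleD ψ (Fin.cons s b : Fin (q + 2) → S) - ψ b) := by
      have : ∀ χ : (Fin (q + 1) → S) → F, tupleD χ (Fin.cons s b : Fin (q + 2) → S)
          = χ b + ∑ i : Fin (q + 1), (-1 : F) ^ ((i : ℕ) + 1) *
            χ ((Fin.cons s b : Fin (q + 2) → S) ∘ i.succ.succAbove) := by
        intro χ
        unfold tupleD
        rw [Fin.sum_univ_succ]
        congr 1
        simp only [Fin.val_zero, pow_zero, one_mul]
        congr 1
      rw [this, this, tupleCup, hfm, hbm, add_sub_cancel_left, Finset.mul_sum]
      congr 1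
      refine Finset.sum_congr rfl fun i _ => ?_
      rw [tupleCup, hfm, hbm]
      simp only [Function.comp, Fin.succ_succAbove_zero, Fin.cons_zero]
      ring
    have f1 : (Fin.cons s b : Fin (q + 2) → S) ∘ frontMap (show 0 + (q + 1) = q + 1 by omega)
        = fun _ => s := by
      funext i
      exact congrArg (Fin.cons s b : Fin (q + 2) → S) (show _ = (0 : Fin (q + 2)) from
        Fin.ext (by have := i.2; simp [frontMap]))
    have f2 : (Fin.cons s b : Fin (q + 2) → S) ∘ backMap (show 0 + (q + 1) = q + 1 by omega)
        = Fin.cons s b := by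
      funext i; simp only [Function.comp]; congr 1; ext; simp [backMap]
    have f3 : (Fin.cons s b : Fin (q + 2) → S) ∘ backMap (show (0 + 1) + q = q + 1 by omega)
        = b := by
      funext i; simp only [Function.comp]
      rw [show backMap (show (0 + 1) + q = q + 1 by omega) i = i.succ by
        ext; simp [backMap]; omega]
      simp
    have f4 : tupleD φ ((Fin.cons s b : Fin (q + 2) → S) ∘
        frontMap (show (0 + 1) + q = q + 1 by omega)) = φ (fun _ => b 0) - φ (fun _ => s) := by
      unfold tupleD
      rw [Fin.sum_univ_two]
      simp only [Fin.val_zero, pow_zero, one_mul, Fin.val_one, pow_one, neg_mul,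
        ← sub_eq_add_neg]
      have g1 : ((Fin.cons s b : Fin (q + 2) → S) ∘
          frontMap (show (0 + 1) + q = q + 1 by omega)) ∘ (0 : Fin 2).succAbove
            = fun _ => b 0 := by
        funext i
        obtain rfl : i = 0 := Subsingleton.elim (α := Fin 1) i 0
        rfl
      have g2 : ((Fin.cons s b : Fin (q + 2) → S) ∘
          frontMap (show (0 + 1) + q = q + 1 by omega)) ∘ (1 : Fin 2).succAbove
            = fun _ => s := by
        funext i
        obtain rfl : i = 0 := Subsingleton.elim (α := Fin 1) i 0
        rfl
      rw [g1, g2]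
    rw [e1]
    simp only [Pi.add_apply, tupleCup, f1, f2, f3, f4, pow_zero, one_smul]
    ring
  | succ p ih =>
    obtain ⟨m, rfl⟩ : ∃ k, m = k + 1 := ⟨m - 1, by omega⟩
    funext a
    obtain ⟨s, b, rfl⟩ : ∃ s b, a = Fin.cons s b := ⟨a 0, Fin.tail a, (Fin.cons_self_tail a).symm⟩
    have hf : ∀ {p q m : ℕ} (h : (p + 1) + q = m + 1) (h' : p + q = m) (b : Fin (m + 1) → S),
        (Fin.cons s b : Fin (m + 2) → S) ∘ frontMap h = Fin.cons s (b ∘ frontMap h') := by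
      intro p q m h h' b
      funext i; refine Fin.cases rfl (fun i => ?_) i; rfl
    have hb : ∀ {p q m : ℕ} (h : (p + 1) + q = m + 1) (h' : p + q = m) (b : Fin (m + 1) → S),
        (Fin.cons s b : Fin (m + 2) → S) ∘ backMap h = b ∘ backMap h' := by
      intro p q m h h' b
      funext i; simp only [Function.comp]
      rw [show backMap h i = (backMap h' i).succ by ext; simp [backMap]; omega]
      simp
    have hcone : tupleCone s (tupleCup h φ ψ)
        = tupleCup (show p + q = m by omega) (tupleCone s φ) ψ := by
      funext c
      simp only [tupleCone, tupleCup]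
      rw [hf h (by omega), hb h (by omega)]
    rw [tupleD_cons, hcone, ih]
    simp only [Pi.add_apply, Pi.smul_apply, smul_eq_mul, tupleCup]
    rw [hf _ (show p + 1 + q = m + 1 by omega), hb _ (show p + 1 + q = m + 1 by omega), tupleD_cons,
      hf _ (show p + (q + 1) = m + 1 by omega), hb _ (show p + (q + 1) = m + 1 by omega)]
    simp only [tupleCone]
    ring

end Tuples

/-! ### Singular simplices, chains and cochains -/

section Singular

variable {X : Type u} [TopologicalSpace X] {F : Type v} [Field F]

/-- Singular `q`-simplices of `X`. -/
abbrev Simplex (X : Type u) [TopologicalSpace X] (q : ℕ) : Type u :=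
  C(stdSimplex ℝ (Fin (q + 1)), X)

/-- Precomposition of a singular simplex with the affine map given by a map of vertices. -/
def Simplex.pull {p q : ℕ} (σ : Simplex X q) (a : Fin (p + 1) → Fin (q + 1)) : Simplex X p :=
  σ.comp ⟨stdSimplex.map a, stdSimplex.continuous_map a⟩

/-- The `i`-th face. -/
def Simplex.face {q : ℕ} (σ : Simplex X (q + 1)) (i : Fin (q + 2)) : Simplex X q :=
  σ.pull i.succAbove

lemma Simplex.pull_pull {p q r : ℕ} (σ : Simplex X r) (a : Fin (q + 1) → Fin (r + 1))
    (b : Fin (p + 1) → Fin (q + 1)) : (σ.pull a).pull b = σ.pull (a ∘ b) := by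
  ext x
  simp [Simplex.pull, stdSimplex.map_comp_apply]

lemma Simplex.pull_id {q : ℕ} (σ : Simplex X q) : σ.pull id = σ := by
  ext x
  simp [Simplex.pull]

lemma Simplex.range_pull {p q : ℕ} (σ : Simplex X q) (a : Fin (p + 1) → Fin (q + 1)) :
    Set.range (σ.pull a) ⊆ Set.range σ := by
  rintro _ ⟨x, rfl⟩
  exact ⟨_, rfl⟩

/-- Singular `q`-chains with coefficients in `F`. -/
abbrev Chain (F : Type v) [Field F] (X : Type u) [TopologicalSpace X] (q : ℕ) : Type (max u v) :=
  Simplex X q →₀ F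

/-- The boundary of singular chains. -/
def boundary (F : Type v) [Field F] (X : Type u) [TopologicalSpace X] (q : ℕ) :
    Chain F X (q + 1) →ₗ[F] Chain F X q :=
  Finsupp.linearCombination F fun σ : Simplex X (q + 1) =>
    ∑ i : Fin (q + 2), Finsupp.single (σ.face i) ((-1 : F) ^ (i : ℕ))

/-- Singular `q`-cochains with coefficients in `F`. -/
abbrev Cochain (F : Type v) (X : Type u) [TopologicalSpace X] (q : ℕ) : Type (max u v) :=
  Simplex X q → F

/-- The coboundary of singular cochains. -/
def coboundary (F : Type v) [Field F] (X : Type u) [TopologicalSpace X] (q : ℕ) :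
    Cochain F X q →ₗ[F] Cochain F X (q + 1) where
  toFun f σ := ∑ i : Fin (q + 2), (-1 : F) ^ (i : ℕ) * f (σ.face i)
  map_add' f g := by funext σ; simp [mul_add, Finset.sum_add_distrib]
  map_smul' c f := by
    funext σ
    simp only [Pi.smul_apply, smul_eq_mul, RingHom.id_apply, Finset.mul_sum]
    exact Finset.sum_congr rfl fun i _ => by ring

/-- `f` vanishes on all simplices in the complement of `K`. -/
def VanishesOff {q : ℕ} (f : Cochain F X q) (K : Set X) : Prop :=
  ∀ σ : Simplex X q, Set.range σ ⊆ Kᶜ → f σ = 0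

/-- Compactly supported cochains: those which vanish on all simplices in the complement of some
compact set. -/
def compactCochains (F : Type v) [Field F] (X : Type u) [TopologicalSpace X] (q : ℕ) :
    Submodule F (Cochain F X q) where
  carrier := {f | ∃ K : Set X, IsCompact K ∧ VanishesOff f K}
  zero_mem' := ⟨∅, isCompact_empty, fun _ _ => rfl⟩
  add_mem' := by
    rintro f g ⟨K, hK, hf⟩ ⟨L, hL, hg⟩
    refine ⟨K ∪ L, hK.union hL, fun σ hσ => ?_⟩
    rw [Set.compl_union] at hσ
    simp [hf σ (hσ.trans Set.inter_subset_left), hg σ (hσ.trans Set.inter_subset_right)]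
  smul_mem' := by
    rintro c f ⟨K, hK, hf⟩
    exact ⟨K, hK, fun σ hσ => by simp [hf σ hσ]⟩

/-- Compactly supported cocycles. -/
def cocycles (F : Type v) [Field F] (X : Type u) [TopologicalSpace X] (q : ℕ) :
    Submodule F (Cochain F X q) :=
  compactCochains F X q ⊓ LinearMap.ker (coboundary F X q)

/-- Coboundaries of compactly supported cochains. -/
def coboundaries (F : Type v) [Field F] (X : Type u) [TopologicalSpace X] :
    (q : ℕ) → Submodule F (Cochain F X q)
  | 0 => ⊥
  | q + 1 => (compactCochains F X q).map (coboundary F X q)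

/-- Compactly supported singular cohomology `H_c^q(X; F)`. -/
abbrev Hc (F : Type v) [Field F] (X : Type u) [TopologicalSpace X] (q : ℕ) : Type (max u v) :=
  cocycles F X q ⧸ (coboundaries F X q).submoduleOf (cocycles F X q)

/-- The class of a compactly supported cocycle. -/
def Hc.mk (F : Type v) [Field F] (X : Type u) [TopologicalSpace X] (q : ℕ) : cocycles F X q →ₗ[F] Hc F X q :=
  ((coboundaries F X q).submoduleOf (cocycles F X q)).mkQ

/-- The cup product of cochains: `f` on the front face times `g` on the back face. -/
def cupCochain {p q m : ℕ} (h : p + q = m) :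
    Cochain F X p →ₗ[F] Cochain F X q →ₗ[F] Cochain F X m :=
  LinearMap.mk₂ F (fun f g σ => f (σ.pull (frontMap h)) * g (σ.pull (backMap h)))
    (fun f f' g => by funext σ; simp [add_mul])
    (fun c f g => by funext σ; simp [mul_assoc])
    (fun f g g' => by funext σ; simp [mul_add])
    (fun c f g => by funext σ; simp [mul_left_comm])

/-- The restriction of a cochain to the simplices spanned by vertices of `σ`. -/
def onTuples {q N : ℕ} (f : Cochain F X q) (σ : Simplex X N) : (Fin (q + 1) → Fin (N + 1)) → F :=
  fun a => f (σ.pull a)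

lemma apply_eq_onTuples {q : ℕ} (f : Cochain F X q) (σ : Simplex X q) :
    f σ = onTuples f σ id := by
  rw [onTuples, Simplex.pull_id]

lemma onTuples_coboundary {q N : ℕ} (f : Cochain F X q) (σ : Simplex X N) :
    onTuples (coboundary F X q f) σ = tupleD (onTuples f σ) := by
  funext a
  simp [onTuples, coboundary, tupleD, Simplex.face, Simplex.pull_pull]

lemma onTuples_cup {p q m N : ℕ} (h : p + q = m) (f : Cochain F X p) (g : Cochain F X q)
    (σ : Simplex X N) :
    onTuples (cupCochain h f g) σ = tupleCup h (onTuples f σ) (onTuples g σ) := by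
  funext a
  simp [onTuples, cupCochain, tupleCup, Simplex.pull_pull]

lemma coboundary_cup {p q m : ℕ} (h : p + q = m) (f : Cochain F X p) (g : Cochain F X q) :
    coboundary F X m (cupCochain h f g)
      = cupCochain (show (p + 1) + q = m + 1 by omega) (coboundary F X p f) g
        + (-1 : F) ^ p • cupCochain (show p + (q + 1) = m + 1 by omega) f
            (coboundary F X q g) := by
  funext σ
  rw [apply_eq_onTuples (coboundary F X m (cupCochain h f g)), onTuples_coboundary, onTuples_cup,
    tupleD_tupleCup]
  simp only [Pi.add_apply, Pi.smul_apply]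
  rw [apply_eq_onTuples (cupCochain _ _ g), apply_eq_onTuples (cupCochain _ f _), onTuples_cup,
    onTuples_cup, onTuples_coboundary, onTuples_coboundary]

lemma cup_mem_compactCochains {p q m : ℕ} (h : p + q = m) {f : Cochain F X p} {g : Cochain F X q}
    (hf : f ∈ compactCochains F X p) : cupCochain h f g ∈ compactCochains F X m := by
  obtain ⟨K, hK, hf⟩ := hf
  refine ⟨K, hK, fun σ hσ => ?_⟩
  simp [cupCochain, hf _ ((σ.range_pull _).trans hσ)]

lemma cup_mem_cocycles {p q m : ℕ} (h : p + q = m) {f : Cochain F X p} {g : Cochain F X q}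
    (hf : f ∈ cocycles F X p) (hg : g ∈ cocycles F X q) : cupCochain h f g ∈ cocycles F X m := by
  refine ⟨cup_mem_compactCochains h hf.1, ?_⟩
  change coboundary F X m (cupCochain h f g) = 0
  rw [coboundary_cup, LinearMap.mem_ker.1 hf.2, LinearMap.mem_ker.1 hg.2]
  simp

lemma coboundary_mem_coboundaries {q : ℕ} {f : Cochain F X q} (hf : f ∈ compactCochains F X q) :
    coboundary F X q f ∈ coboundaries F X (q + 1) :=
  ⟨f, hf, rfl⟩

lemma cup_mem_coboundaries_left {p q m : ℕ} (h : p + q = m) {f : Cochain F X p}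
    {g : Cochain F X q} (hf : f ∈ coboundaries F X p) (hg : g ∈ cocycles F X q) :
    cupCochain h f g ∈ coboundaries F X m := by
  cases p with
  | zero =>
    have : f = 0 := hf
    rw [this]; simp
  | succ p =>
    obtain ⟨m, rfl⟩ : ∃ k, m = k + 1 := ⟨m - 1, by omega⟩
    obtain ⟨e, he, rfl⟩ := hf
    have := coboundary_mem_coboundaries (cup_mem_compactCochains (g := g)
      (show p + q = m by omega) he)
    rw [coboundary_cup, LinearMap.mem_ker.1 hg.2] at this
    simpa using this

lemma cup_mem_coboundaries_right {p q m : ℕ} (h : p + q = m) {f : Cochain F X p}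
    {g : Cochain F X q} (hf : f ∈ cocycles F X p) (hg : g ∈ coboundaries F X q) :
    cupCochain h f g ∈ coboundaries F X m := by
  cases q with
  | zero =>
    have : g = 0 := hg
    rw [this]; simp
  | succ q =>
    obtain ⟨m, rfl⟩ : ∃ k, m = k + 1 := ⟨m - 1, by omega⟩
    obtain ⟨e, he, rfl⟩ := hg
    have := coboundary_mem_coboundaries (cup_mem_compactCochains (g := e)
      (show p + q = m by omega) hf.1)
    rw [coboundary_cup, LinearMap.mem_ker.1 hf.2] at this
    have h2 := Submodule.smul_mem _ ((-1 : F) ^ p) this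
    rw [map_zero, LinearMap.zero_apply, zero_add, smul_smul, ← mul_pow] at h2
    simpa using h2

/-- The cup product of cocycles, with values in cohomology. -/
def cupCocycle {p q m : ℕ} (h : p + q = m) :
    cocycles F X p →ₗ[F] cocycles F X q →ₗ[F] Hc F X m :=
  LinearMap.mk₂ F (fun f g => Hc.mk F X m
      ⟨cupCochain h f.1 g.1, cup_mem_cocycles h f.2 g.2⟩)
    (fun f f' g => by rw [← map_add]; congr 1; ext1; simp)
    (fun c f g => by rw [← map_smul]; congr 1; ext1; simp)
    (fun f g g' => by rw [← map_add]; congr 1; ext1; simp)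
    (fun c f g => by rw [← map_smul]; congr 1; ext1; simp)

lemma Hc.mk_eq_zero {q : ℕ} {f : cocycles F X q} (hf : f.1 ∈ coboundaries F X q) :
    Hc.mk F X q f = 0 :=
  (Submodule.Quotient.mk_eq_zero _).2 hf

lemma Hc.mk_surjective {q : ℕ} : Function.Surjective (Hc.mk F X q) :=
  Submodule.mkQ_surjective _

/-- The cup product on compactly supported cohomology. -/
def Hc.cup (F : Type v) [Field F] (X : Type u) [TopologicalSpace X] {p q m : ℕ} (h : p + q = m) : Hc F X p →ₗ[F] Hc F X q →ₗ[F] Hc F X m :=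
  Submodule.liftQ _
    { toFun := fun f => Submodule.liftQ _ (cupCocycle h f)
        (fun g hg => Hc.mk_eq_zero (f := ⟨_, cup_mem_cocycles h f.2 g.2⟩)
          (cup_mem_coboundaries_right h f.2 hg))
      map_add' := fun f f' => by ext g; simp; rfl
      map_smul' := fun c f => by ext g; simp; rfl }
    (fun f hf => by
      rw [LinearMap.mem_ker]
      ext g
      exact Hc.mk_eq_zero (f := ⟨_, cup_mem_cocycles h f.2 g.2⟩)
        (cup_mem_coboundaries_left h hf g.2))

lemma Hc.cup_mk {p q m : ℕ} (h : p + q = m) (f : cocycles F X p) (g : cocycles F X q) :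
    Hc.cup F X h (Hc.mk F X p f) (Hc.mk F X q g)
      = Hc.mk F X m ⟨cupCochain h f.1 g.1, cup_mem_cocycles h f.2 g.2⟩ :=
  rfl

/-- Reversal of the vertices, with its sign. -/
def revCochain {q : ℕ} (f : Cochain F X q) : Cochain F X q :=
  fun σ => tupleRev (onTuples f σ) id

lemma onTuples_revCochain {q N : ℕ} (f : Cochain F X q) (σ : Simplex X N) :
    onTuples (revCochain f) σ = tupleRev (onTuples f σ) := by
  funext a
  simp [onTuples, revCochain, tupleRev, Simplex.pull_pull]

lemma revCochain_mem_cocycles {q : ℕ} {f : Cochain F X q} (hf : f ∈ cocycles F X q) :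
    revCochain f ∈ cocycles F X q := by
  obtain ⟨⟨K, hK, hfK⟩, hd⟩ := hf
  refine ⟨⟨K, hK, fun σ hσ => ?_⟩, ?_⟩
  · simp [revCochain, tupleRev, onTuples, hfK _ ((σ.range_pull _).trans hσ)]
  · change coboundary F X q (revCochain f) = 0
    funext σ
    rw [apply_eq_onTuples (coboundary F X q _), onTuples_coboundary, onTuples_revCochain,
      tupleD_tupleRev, ← onTuples_coboundary, LinearMap.mem_ker.1 hd]
    simp [tupleRev, onTuples]

lemma revCochain_sub_mem {q : ℕ} {f : Cochain F X q} (hf : f ∈ cocycles F X q) :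
    revCochain f - f ∈ coboundaries F X q := by
  obtain ⟨⟨K, hK, hfK⟩, hd⟩ := hf
  cases q with
  | zero =>
    have : revCochain f - f = 0 := by
      funext σ
      have := congrFun (tuplePrism_tupleD_zero (onTuples f σ)) id
      rw [Pi.sub_apply, apply_eq_onTuples f σ]
      exact this
    rw [this]; exact Submodule.zero_mem _
  | succ m =>
    refine ⟨fun σ => tuplePrism m (onTuples f σ) id, ⟨K, hK, fun σ hσ => ?_⟩, ?_⟩
    · have : onTuples f σ = 0 := by
        funext a
        exact hfK _ ((σ.range_pull _).trans hσ)
      simp [this, tuplePrism_zero]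
    · funext σ
      have h0 := congrFun (tuplePrism_tupleD m (onTuples f σ)) id
      rw [← onTuples_coboundary, LinearMap.mem_ker.1 hd,
        show onTuples (0 : Cochain F X (m + 1 + 1)) σ = 0 from rfl, tuplePrism_zero] at h0
      have h1 : coboundary F X m (fun σ => tuplePrism m (onTuples f σ) id) σ
          = tupleD (tuplePrism m (onTuples f σ)) id := by
        simp only [coboundary, LinearMap.coe_mk, AddHom.coe_mk, tupleD]
        refine Finset.sum_congr rfl fun i _ => ?_
        have := tuplePrism_comp (i.succAbove) m (onTuples f σ) id
        rw [Function.id_comp, ← Function.comp_id i.succAbove, ← this]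
        congr 2
        funext b
        simp [onTuples, Simplex.face, Simplex.pull_pull]
      rw [h1, Pi.sub_apply, apply_eq_onTuples f σ]
      simp only [Pi.sub_apply, Pi.zero_apply] at h0
      exact (sub_eq_zero.1 h0.symm).symm

lemma Hc.mk_revCochain {q : ℕ} (f : cocycles F X q) :
    Hc.mk F X q ⟨revCochain f.1, revCochain_mem_cocycles f.2⟩ = Hc.mk F X q f := by
  rw [← sub_eq_zero, ← map_sub]
  exact Hc.mk_eq_zero (revCochain_sub_mem f.2)

/-- The cup product on compactly supported cohomology is graded commutative. -/
theorem Hc.cup_comm {p q m : ℕ} (h : p + q = m) (h' : q + p = m) (x : Hc F X p) (y : Hc F X q) :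
    Hc.cup F X h x y = (-1 : F) ^ (p * q) • Hc.cup F X h' y x := by
  obtain ⟨f, rfl⟩ := Hc.mk_surjective x
  obtain ⟨g, rfl⟩ := Hc.mk_surjective y
  rw [Hc.cup_mk, ← Hc.mk_revCochain, ← Hc.mk_revCochain f, ← Hc.mk_revCochain g, Hc.cup_mk,
    ← map_smul]
  congr 1
  ext1
  funext σ
  change tupleRev (onTuples (cupCochain h f.1 g.1) σ) id
    = (-1 : F) ^ (p * q) • cupCochain h' (revCochain g.1) (revCochain f.1) σ
  rw [apply_eq_onTuples (cupCochain _ _ _) σ, onTuples_cup, onTuples_cup, tupleCup_rev h h',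
    onTuples_revCochain, onTuples_revCochain]
  rfl

end Singular

/-! ### Graded Lie algebras and the Chevalley--Eilenberg complex -/

section Sign

variable (F : Type*) [Field F]

/-- The sign `(-1)^i`. -/
def sgn (i : ℤ) : F := ((i.negOnePow : ℤ) : F)

variable {F}

lemma sgn_add (i j : ℤ) : sgn F (i + j) = sgn F i * sgn F j := by
  simp [sgn, Int.negOnePow_add]

lemma sgn_one : sgn F 1 = -1 := by simp [sgn]

lemma sgn_zero : sgn F 0 = 1 := by simp [sgn]

lemma sgn_even {i : ℤ} (h : Even i) : sgn F i = 1 := by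
  simp [sgn, Int.negOnePow_even i h]

lemma sgn_mul_self (i : ℤ) : sgn F i * sgn F i = 1 := by
  rw [← sgn_add]; exact sgn_even ⟨i, rfl⟩

lemma sgn_eq (i : ℤ) : sgn F i = if Even i then 1 else -1 := by
  split_ifs with h
  · exact sgn_even h
  · simp [sgn, Int.negOnePow_odd i (Int.not_even_iff_odd.1 h)]

end Sign

/-- A graded Lie algebra over `F` with an additional grading by weight: `obj i u` is the part of
degree `i` and weight `u`. Signs depend on degrees only. -/
structure BigradedLieAlgebra (F : Type v) [Field F] where
  obj : ℤ → ℕ → Type u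
  [addCommGroup : ∀ i u, AddCommGroup (obj i u)]
  [module : ∀ i u, Module F (obj i u)]
  bracket : ∀ {i j k : ℤ} {u v w : ℕ}, i + j = k → u + v = w →
    obj i u →ₗ[F] obj j v →ₗ[F] obj k w
  antisymm : ∀ {i j k : ℤ} {u v w : ℕ} (h : i + j = k) (h' : j + i = k) (e : u + v = w)
    (e' : v + u = w) (x : obj i u) (y : obj j v),
    bracket h e x y = sgn F (i * j + 1) • bracket h' e' y x
  jacobi : ∀ {i j k ij jk ki t : ℤ} {a b c ab bc ca w : ℕ}
    (hij : i + j = ij) (hjk : j + k = jk) (hki : k + i = ki)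
    (hab : a + b = ab) (hbc : b + c = bc) (hca : c + a = ca)
    (h₁ : i + jk = t) (h₂ : k + ij = t) (h₃ : j + ki = t)
    (e₁ : a + bc = w) (e₂ : c + ab = w) (e₃ : b + ca = w)
    (x : obj i a) (y : obj j b) (z : obj k c),
    sgn F (i * k) • bracket h₁ e₁ x (bracket hjk hbc y z)
      + sgn F (k * j) • bracket h₂ e₂ z (bracket hij hab x y)
      + sgn F (j * i) • bracket h₃ e₃ y (bracket hki hca z x) = 0

attribute [instance] BigradedLieAlgebra.addCommGroup BigradedLieAlgebra.module

namespace BigradedLieAlgebra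

open scoped TensorProduct

variable {F : Type v} [Field F] (g : BigradedLieAlgebra.{u, v} F)

/-- The total vector space. -/
abbrev Total : Type u := DirectSum (ℤ × ℕ) fun iu => g.obj iu.1 iu.2

/-- The Koszul sign rule for the shifted vector space `g[1]`, in which an element of `g` of
degree `i` has degree `i + 1`. -/
inductive Rel : TensorAlgebra F g.Total → TensorAlgebra F g.Total → Prop
  | swap {i j : ℤ} {u v : ℕ} (x : g.obj i u) (y : g.obj j v) :
      Rel (TensorAlgebra.ι F (DirectSum.lof F (ℤ × ℕ) (fun iu => g.obj iu.1 iu.2) (i, u) x) *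
          TensorAlgebra.ι F (DirectSum.lof F (ℤ × ℕ) (fun iu => g.obj iu.1 iu.2) (j, v) y))
        (sgn F ((i + 1) * (j + 1)) •
          (TensorAlgebra.ι F (DirectSum.lof F (ℤ × ℕ) (fun iu => g.obj iu.1 iu.2) (j, v) y) *
          TensorAlgebra.ι F (DirectSum.lof F (ℤ × ℕ) (fun iu => g.obj iu.1 iu.2) (i, u) x)))

/-- The free graded commutative algebra `Sym(g[1])`. -/
def Sym : Type (max u v) := RingQuot g.Rel

instance : Ring g.Sym := inferInstanceAs (Ring (RingQuot g.Rel))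

instance : Algebra F g.Sym := inferInstanceAs (Algebra F (RingQuot g.Rel))

/-- The quotient map from the tensor algebra. -/
def quot : TensorAlgebra F g.Total →ₐ[F] g.Sym := RingQuot.mkAlgHom F g.Rel

/-- The inclusion `g[1] → Sym(g[1])`. -/
def gen (i : ℤ) (u : ℕ) : g.obj i u →ₗ[F] g.Sym :=
  g.quot.toLinearMap ∘ₗ TensorAlgebra.ι F ∘ₗ
    DirectSum.lof F (ℤ × ℕ) (fun iu => g.obj iu.1 iu.2) (i, u)

lemma gen_mul_gen {i j : ℤ} {u v : ℕ} (x : g.obj i u) (y : g.obj j v) :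
    g.gen i u x * g.gen j v y
      = sgn F ((i + 1) * (j + 1)) • (g.gen j v y * g.gen i u x) := by
  have := RingQuot.mkAlgHom_rel F (Rel.swap (g := g) x y)
  rw [map_mul, map_smul, map_mul] at this
  exact this

/-- The universal property of `Sym(g[1])`. -/
def lift {A : Type*} [Ring A] [Algebra F A] (φ : ∀ i u, g.obj i u →ₗ[F] A)
    (hφ : ∀ {i j : ℤ} {u v : ℕ} (x : g.obj i u) (y : g.obj j v),
      φ i u x * φ j v y = sgn F ((i + 1) * (j + 1)) • (φ j v y * φ i u x)) : g.Sym →ₐ[F] A :=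
  RingQuot.liftAlgHom F ⟨TensorAlgebra.lift F
    (DirectSum.toModule F (ℤ × ℕ) A fun iu => φ iu.1 iu.2), by
      rintro _ _ ⟨x, y⟩
      simp only [map_mul, map_smul, TensorAlgebra.lift_ι_apply, DirectSum.toModule_lof]
      exact hφ x y⟩

lemma lift_gen {A : Type*} [Ring A] [Algebra F A] (φ : ∀ i u, g.obj i u →ₗ[F] A)
    (hφ : ∀ {i j : ℤ} {u v : ℕ} (x : g.obj i u) (y : g.obj j v),
      φ i u x * φ j v y = sgn F ((i + 1) * (j + 1)) • (φ j v y * φ i u x))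
    (i : ℤ) (u : ℕ) (x : g.obj i u) : g.lift φ hφ (g.gen i u x) = φ i u x := by
  simp only [lift, gen]
  erw [RingQuot.liftAlgHom_mkAlgHom_apply]
  simp [TensorAlgebra.lift_ι_apply, DirectSum.toModule_lof]

variable {g} in
lemma sym_induction {P : g.Sym → Prop} (one : P 1) (add : ∀ a b, P a → P b → P (a + b))
    (smul : ∀ (c : F) a, P a → P (c • a))
    (mul : ∀ (i : ℤ) (u : ℕ) (x : g.obj i u) a, P a → P (g.gen i u x * a)) (a : g.Sym) : P a := by
  obtain ⟨t, rfl⟩ : ∃ t, g.quot t = a := RingQuot.mkAlgHom_surjective F g.Rel a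
  have key : ∀ b : g.Sym, P b → P (g.quot t * b) := by
    induction t using TensorAlgebra.induction with
    | algebraMap r =>
      intro b hb
      rw [AlgHom.commutes, ← Algebra.smul_def]
      exact smul r b hb
    | ι x =>
      intro b hb
      induction x using DirectSum.induction_on with
      | zero =>
        rw [map_zero, map_zero, zero_mul, ← zero_smul F b]
        exact smul 0 b hb
      | of iu x => exact mul iu.1 iu.2 x b hb
      | add x y hx hy =>
        rw [map_add, map_add, add_mul]
        exact add _ _ hx hy
    | mul s t hs ht =>
      intro b hb
      rw [map_mul, mul_assoc]
      exact hs _ (ht b hb)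
    | add s t hs ht =>
      intro b hb
      rw [map_add, add_mul]
      exact add _ _ (hs b hb) (ht b hb)
  have := key 1 one
  rwa [mul_one] at this

/-- `IsMonomial i k a`: `a` is a product of homogeneous elements of `g[1]`, of total degree `i`
and total weight `k`. -/
inductive IsMonomial : ℤ → ℕ → g.Sym → Prop
  | one : IsMonomial 0 0 1
  | mul {i j k : ℤ} {u v w : ℕ} (h : i + 1 + j = k) (e : u + v = w) (x : g.obj i u)
      {a : g.Sym} (ha : IsMonomial j v a) : IsMonomial k w (g.gen i u x * a)

/-- The part of `Sym(g[1])` of degree `i` and weight `k`. -/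
def piece (i : ℤ) (k : ℕ) : Submodule F g.Sym := Submodule.span F {a | g.IsMonomial i k a}

variable {g} in
lemma gen_mul_mem_piece {i j k : ℤ} {u v w : ℕ} (h : i + 1 + j = k) (e : u + v = w)
    (x : g.obj i u) {a : g.Sym} (ha : a ∈ g.piece j v) : g.gen i u x * a ∈ g.piece k w := by
  induction ha using Submodule.span_induction with
  | mem a ha => exact Submodule.subset_span (IsMonomial.mul h e x ha)
  | zero => rw [mul_zero]; exact Submodule.zero_mem _
  | add a b _ _ ha hb => rw [mul_add]; exact Submodule.add_mem _ ha hb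
  | smul c a _ ha => rw [mul_smul_comm]; exact Submodule.smul_mem _ c ha

/-! #### The shuffle coproduct -/

lemma twist_rel (s : ℤ) {i j : ℤ} {u v : ℕ} (x : g.obj i u) (y : g.obj j v) :
    (sgn F (s * (i + 1)) • g.gen i u) x * (sgn F (s * (j + 1)) • g.gen j v) y
      = sgn F ((i + 1) * (j + 1)) •
        ((sgn F (s * (j + 1)) • g.gen j v) y * (sgn F (s * (i + 1)) • g.gen i u) x) := by
  simp only [LinearMap.smul_apply, smul_mul_smul_comm]
  rw [gen_mul_gen, smul_comm, mul_comm (sgn F (s * (i + 1)))]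

/-- The algebra automorphism which acts on elements of degree `r` by `(-1)^(s r)`. -/
def twist (s : ℤ) : g.Sym →ₐ[F] g.Sym :=
  g.lift (fun i u => sgn F (s * (i + 1)) • g.gen i u) (g.twist_rel s)

lemma twist_gen (s i : ℤ) (u : ℕ) (x : g.obj i u) :
    g.twist s (g.gen i u x) = sgn F (s * (i + 1)) • g.gen i u x :=
  g.lift_gen _ (g.twist_rel s) i u x

lemma twist_twist (s t : ℤ) (a : g.Sym) : g.twist s (g.twist t a) = g.twist (s + t) a := by
  induction a using sym_induction with
  | one => simp
  | add a b ha hb => simp [ha, hb]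
  | smul c a ha => simp [ha]
  | mul i u x a ha =>
    simp only [map_mul, twist_gen, map_smul, ha, smul_smul, add_mul, sgn_add]
    rw [mul_comm]

/-- Left multiplication by `x ⊗ 1 + 1 ⊗ x` in the graded tensor product
`Sym(g[1]) ⊗ Sym(g[1])`, so `a ⊗ b ↦ x a ⊗ b + (-1)^(|x| |a|) a ⊗ x b`. -/
def primMul (i : ℤ) (u : ℕ) : g.obj i u →ₗ[F] Module.End F (g.Sym ⊗[F] g.Sym) where
  toFun x := TensorProduct.map (LinearMap.mulLeft F (g.gen i u x)) LinearMap.id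
    + TensorProduct.map (g.twist (i + 1)).toLinearMap (LinearMap.mulLeft F (g.gen i u x))
  map_add' x y := by
    ext a b
    simp [add_mul, TensorProduct.add_tmul, TensorProduct.tmul_add]
    abel
  map_smul' c x := by
    ext a b
    simp [TensorProduct.smul_tmul']

lemma primMul_comm {i j : ℤ} {u v : ℕ} (x : g.obj i u) (y : g.obj j v) :
    g.primMul i u x * g.primMul j v y
      = sgn F ((i + 1) * (j + 1)) • (g.primMul j v y * g.primMul i u x) := by
  ext a b
  have hxy := g.gen_mul_gen x y
  have h1 : (g.twist (i + 1)) (g.gen j v y * a)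
      = sgn F ((i + 1) * (j + 1)) • (g.gen j v y * g.twist (i + 1) a) := by
    rw [map_mul, twist_gen, smul_mul_assoc]
  have h2 : (g.twist (j + 1)) (g.gen i u x * a)
      = sgn F ((i + 1) * (j + 1)) • (g.gen i u x * g.twist (j + 1) a) := by
    rw [map_mul, twist_gen, smul_mul_assoc, mul_comm (j + 1)]
  simp only [primMul, LinearMap.coe_mk, AddHom.coe_mk, Module.End.mul_apply,
    LinearMap.add_apply, TensorProduct.map_tmul, LinearMap.mulLeft_apply, LinearMap.id_apply,
    AlgHom.toLinearMap_apply, map_add, LinearMap.smul_apply, smul_add,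
    TensorProduct.AlgebraTensorModule.curry_apply, TensorProduct.curry_apply,
    LinearMap.restrictScalars_self, h1, h2,
    ← mul_assoc, hxy, twist_twist, add_comm (i + 1), smul_mul_assoc,
    TensorProduct.smul_tmul', TensorProduct.tmul_smul, smul_smul, sgn_mul_self, one_smul]
  abel

/-- The shuffle coproduct: the map of algebras `Sym(g[1]) → Sym(g[1]) ⊗ Sym(g[1])` for which the
elements of `g[1]` are primitive. -/
def comul : g.Sym →ₗ[F] g.Sym ⊗[F] g.Sym :=
  LinearMap.applyₗ ((1 : g.Sym) ⊗ₜ[F] (1 : g.Sym)) ∘ₗ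
    (g.lift g.primMul g.primMul_comm).toLinearMap

lemma comul_one : g.comul 1 = 1 ⊗ₜ[F] 1 := by
  simp [comul]

lemma comul_gen_mul {i : ℤ} {u : ℕ} (x : g.obj i u) (a : g.Sym) :
    g.comul (g.gen i u x * a) = g.primMul i u x (g.comul a) := by
  change g.lift g.primMul g.primMul_comm (g.gen i u x * a) (1 ⊗ₜ[F] 1) = _
  rw [map_mul, lift_gen]
  rfl

/-- Cap product with a linear functional of degree zero: if `Δ c = ∑ c_i ⊗ c_i'`, then
`cap l c = ∑ ⟨l, c_i⟩ c_i'`. -/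
def cap (l : g.Sym →ₗ[F] F) : g.Sym →ₗ[F] g.Sym :=
  (TensorProduct.lid F g.Sym).toLinearMap ∘ₗ TensorProduct.map l LinearMap.id ∘ₗ g.comul

/-! #### The differential -/

/-- The graded symmetric bilinear map `b(x, y) = (-1)^|x| [x, y]` on `g[1]`, where `|x| = i + 1` is
the degree in `g[1]`. -/
def symBracket {i j : ℤ} {u v : ℕ} (x : g.obj i u) (y : g.obj j v) : g.Sym :=
  sgn F (i + 1) • g.gen (i + j) (u + v) (g.bracket rfl rfl x y)

lemma gen_bracket_eq {i j k : ℤ} {u v w : ℕ} (h : i + j = k) (e : u + v = w) (x : g.obj i u)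
    (y : g.obj j v) : g.gen k w (g.bracket h e x y) = sgn F (i + 1) • g.symBracket x y := by
  subst h e
  rw [symBracket, smul_smul, sgn_mul_self, one_smul]

lemma symBracket_symm {i j : ℤ} {u v : ℕ} (x : g.obj i u) (y : g.obj j v) :
    g.symBracket x y = sgn F ((i + 1) * (j + 1)) • g.symBracket y x := by
  conv_lhs => rw [symBracket, g.antisymm rfl (add_comm j i) rfl (add_comm v u) x y, map_smul,
    gen_bracket_eq]
  simp only [sgn_eq, Int.even_add, Int.even_mul, Int.not_even_one]
  by_cases hi : Even i <;> by_cases hj : Even j <;> simp [hi, hj]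

lemma symBracket_mul_gen {i j r : ℤ} {u v w : ℕ} (x : g.obj i u) (y : g.obj j v)
    (z : g.obj r w) :
    g.symBracket x y * g.gen r w z
      = sgn F ((i + j + 1) * (r + 1)) • (g.gen r w z * g.symBracket x y) := by
  simp only [symBracket, smul_mul_assoc, mul_smul_comm]
  rw [gen_mul_gen, smul_comm]

/-- `y ↦ ((a, c) ↦ (y a, b(x, y) a + (-1)^((|x| - 1) |y|) y c))`. -/
def adMul {i : ℤ} {u : ℕ} (x : g.obj i u) (j : ℤ) (v : ℕ) :
    g.obj j v →ₗ[F] Module.End F (g.Sym × g.Sym) where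
  toFun y := LinearMap.prod (LinearMap.mulLeft F (g.gen j v y) ∘ₗ LinearMap.fst F _ _)
    (LinearMap.mulLeft F (g.symBracket x y) ∘ₗ LinearMap.fst F _ _ +
      sgn F (i * (j + 1)) • LinearMap.mulLeft F (g.gen j v y) ∘ₗ LinearMap.snd F _ _)
  map_add' y z := by
    refine LinearMap.ext fun p => Prod.ext ?_ ?_
    · simp [add_mul]
    · simp [symBracket, add_mul]
      abel
  map_smul' c y := by
    refine LinearMap.ext fun p => Prod.ext ?_ ?_
    · simp
    · change g.symBracket x (c • y) * p.1 + sgn F (i * (j + 1)) • (g.gen j v (c • y) * p.2)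
        = c • (g.symBracket x y * p.1 + sgn F (i * (j + 1)) • (g.gen j v y * p.2))
      simp only [symBracket, map_smul, smul_mul_assoc, smul_add]
      rw [smul_comm c, smul_comm c]

lemma adMul_apply {i j : ℤ} {u v : ℕ} (x : g.obj i u) (y : g.obj j v) (a c : g.Sym) :
    g.adMul x j v y (a, c) = (g.gen j v y * a,
      g.symBracket x y * a + sgn F (i * (j + 1)) • (g.gen j v y * c)) := rfl

lemma adMul_comm {i j r : ℤ} {u v w : ℕ} (x : g.obj i u) (y : g.obj j v) (z : g.obj r w) :
    g.adMul x j v y * g.adMul x r w z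
      = sgn F ((j + 1) * (r + 1)) • (g.adMul x r w z * g.adMul x j v y) := by
  refine LinearMap.ext fun p => ?_
  obtain ⟨a, c⟩ := p
  rw [LinearMap.smul_apply, Module.End.mul_apply, Module.End.mul_apply, adMul_apply, adMul_apply,
    adMul_apply, adMul_apply, Prod.smul_mk]
  have hyz := g.gen_mul_gen y z
  have h1 := g.symBracket_mul_gen x y z
  have h2 : g.gen j v y * g.symBracket x z
      = sgn F ((i + r + 1) * (j + 1)) • (g.symBracket x z * g.gen j v y) := by
    rw [symBracket_mul_gen, smul_smul, sgn_mul_self, one_smul]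
  ext1
  · dsimp only
    rw [← mul_assoc, hyz, smul_mul_assoc, mul_assoc]
  · dsimp only
    simp only [mul_add (g.gen j v y), mul_add (g.gen r w z), smul_add, mul_smul_comm,
      ← mul_assoc, h1, h2, hyz, smul_mul_assoc]
    simp only [sgn_eq, Int.even_add, Int.even_mul, Int.not_even_one]
    by_cases hi : Even i <;> by_cases hj : Even j <;> by_cases hr : Even r <;>
      simp [hi, hj, hr] <;> abel

/-- `D_x`: the derivation of `Sym(g[1])`, of degree `|x| - 1`, which extends `b(x, -)`. -/
def ad {i : ℤ} {u : ℕ} (x : g.obj i u) : g.Sym →ₗ[F] g.Sym :=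
  LinearMap.snd F _ _ ∘ₗ LinearMap.applyₗ ((1 : g.Sym), (0 : g.Sym)) ∘ₗ
    (g.lift (g.adMul x) (fun y z => g.adMul_comm x y z)).toLinearMap

lemma lift_adMul {i : ℤ} {u : ℕ} (x : g.obj i u) (a : g.Sym) :
    g.lift (g.adMul x) (fun y z => g.adMul_comm x y z) a (1, 0) = (a, g.ad x a) := by
  refine Prod.ext ?_ rfl
  induction a using sym_induction with
  | one => simp
  | add a b ha hb => simp [ha, hb]
  | smul c a ha => simp [ha]
  | mul j v y a ha =>
    rw [map_mul, lift_gen, Module.End.mul_apply]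
    exact congrArg (g.gen j v y * ·) ha

lemma ad_one {i : ℤ} {u : ℕ} (x : g.obj i u) : g.ad x 1 = 0 := by
  have := congrArg Prod.snd (g.lift_adMul x 1)
  rw [map_one] at this
  exact this.symm

lemma ad_gen_mul {i j : ℤ} {u v : ℕ} (x : g.obj i u) (y : g.obj j v) (a : g.Sym) :
    g.ad x (g.gen j v y * a)
      = g.symBracket x y * a + sgn F (i * (j + 1)) • (g.gen j v y * g.ad x a) := by
  have := congrArg Prod.snd (g.lift_adMul x (g.gen j v y * a))
  rw [map_mul, lift_gen, Module.End.mul_apply, lift_adMul, adMul_apply] at this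
  exact this.symm

lemma ad_add {i : ℤ} {u : ℕ} (x y : g.obj i u) (a : g.Sym) :
    g.ad (x + y) a = g.ad x a + g.ad y a := by
  induction a using sym_induction with
  | one => simp [ad_one]
  | add a b ha hb => simp only [map_add, ha, hb]; abel
  | smul c a ha => simp [ha]
  | mul j v z a ha =>
    simp only [ad_gen_mul, ha, symBracket, map_add, LinearMap.add_apply, smul_add, add_mul,
      mul_add]
    abel

lemma ad_smul {i : ℤ} {u : ℕ} (c : F) (x : g.obj i u) (a : g.Sym) :
    g.ad (c • x) a = c • g.ad x a := by
  induction a using sym_induction with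
  | one => simp [ad_one]
  | add a b ha hb => simp [ha, hb]
  | smul e a ha => simp only [map_smul, ha]; rw [smul_comm]
  | mul j v z a ha =>
    simp only [ad_gen_mul, ha, symBracket, map_smul, LinearMap.smul_apply, smul_add,
      smul_mul_assoc, mul_smul_comm]
    rw [smul_comm c, smul_comm c]

/-- `x ↦ ((a, c) ↦ (x a, (-1)^|x| x c + D_x a))`. -/
def dMul (i : ℤ) (u : ℕ) : g.obj i u →ₗ[F] Module.End F (g.Sym × g.Sym) where
  toFun x := LinearMap.prod (LinearMap.mulLeft F (g.gen i u x) ∘ₗ LinearMap.fst F _ _)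
    (sgn F (i + 1) • LinearMap.mulLeft F (g.gen i u x) ∘ₗ LinearMap.snd F _ _ +
      g.ad x ∘ₗ LinearMap.fst F _ _)
  map_add' x y := by
    refine LinearMap.ext fun p => Prod.ext ?_ ?_
    · simp [add_mul]
    · simp [add_mul, ad_add]
      abel
  map_smul' c x := by
    refine LinearMap.ext fun p => Prod.ext ?_ ?_
    · simp
    · simp [ad_smul, smul_comm c]

lemma dMul_apply {i : ℤ} {u : ℕ} (x : g.obj i u) (a c : g.Sym) :
    g.dMul i u x (a, c) = (g.gen i u x * a,
      sgn F (i + 1) • (g.gen i u x * c) + g.ad x a) := rfl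

lemma dMul_comm {i j : ℤ} {u v : ℕ} (x : g.obj i u) (y : g.obj j v) :
    g.dMul i u x * g.dMul j v y
      = sgn F ((i + 1) * (j + 1)) • (g.dMul j v y * g.dMul i u x) := by
  refine LinearMap.ext fun p => ?_
  obtain ⟨a, c⟩ := p
  rw [LinearMap.smul_apply, Module.End.mul_apply, Module.End.mul_apply, dMul_apply, dMul_apply,
    dMul_apply, dMul_apply, Prod.smul_mk]
  have hxy := g.gen_mul_gen x y
  ext1
  · dsimp only
    rw [← mul_assoc, hxy, smul_mul_assoc, mul_assoc]
  · dsimp only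
    rw [ad_gen_mul, ad_gen_mul, g.symBracket_symm x y]
    simp only [mul_add (g.gen i u x), mul_add (g.gen j v y), smul_add, mul_smul_comm,
      ← mul_assoc, hxy, smul_mul_assoc]
    simp only [sgn_eq, Int.even_add, Int.even_mul, Int.not_even_one]
    by_cases hi : Even i <;> by_cases hj : Even j <;> simp [hi, hj] <;> abel

/-- The differential on `Sym(g[1])`, the coderivation determined by the bracket. It is given by
`d 1 = 0` and `d (x a) = (-1)^|x| x (d a) + D_x a`, so that `d (x₁ ⋯ x_r)` is the sum of the terms
`± (-1)^|x_i| [x_i, x_j] x₁ ⋯ x̂_i ⋯ x̂_j ⋯ x_r` over `i < j`, where `±` is the Koszul sign of moving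
`x_i` and `x_j` to the front. -/
def d : g.Sym →ₗ[F] g.Sym :=
  LinearMap.snd F _ _ ∘ₗ LinearMap.applyₗ ((1 : g.Sym), (0 : g.Sym)) ∘ₗ
    (g.lift g.dMul g.dMul_comm).toLinearMap

lemma lift_dMul (a : g.Sym) : g.lift g.dMul g.dMul_comm a (1, 0) = (a, g.d a) := by
  refine Prod.ext ?_ rfl
  induction a using sym_induction with
  | one => simp
  | add a b ha hb => simp [ha, hb]
  | smul c a ha => simp [ha]
  | mul j v y a ha =>
    rw [map_mul, lift_gen, Module.End.mul_apply]
    exact congrArg (g.gen j v y * ·) ha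

lemma d_one : g.d 1 = 0 := by
  have := congrArg Prod.snd (g.lift_dMul 1)
  rw [map_one] at this
  exact this.symm

lemma d_gen_mul {i : ℤ} {u : ℕ} (x : g.obj i u) (a : g.Sym) :
    g.d (g.gen i u x * a) = sgn F (i + 1) • (g.gen i u x * g.d a) + g.ad x a := by
  have := congrArg Prod.snd (g.lift_dMul (g.gen i u x * a))
  rw [map_mul, lift_gen, Module.End.mul_apply, lift_dMul, dMul_apply] at this
  exact this.symm

lemma symBracket_eq {i j k : ℤ} {u v w : ℕ} (h : i + j = k) (e : u + v = w) (x : g.obj i u)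
    (y : g.obj j v) : g.symBracket x y = sgn F (i + 1) • g.gen k w (g.bracket h e x y) := by
  subst h e
  rfl

/-- The Jacobi identity, for `b`. -/
lemma symBracket_jacobi {i j r : ℤ} {u v w : ℕ} (x : g.obj i u) (y : g.obj j v)
    (z : g.obj r w) :
    sgn F (i + 1) • g.symBracket (g.bracket (k := i + j) (w := u + v) rfl rfl x y) z
      + sgn F (i * (j + 1)) • sgn F (i + 1) •
          g.symBracket y (g.bracket (k := i + r) (w := u + w) rfl rfl x z)
      + sgn F (i + 1) • sgn F (j + 1) •
          g.symBracket x (g.bracket (k := j + r) (w := v + w) rfl rfl y z) = 0 := by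
  have J := g.jacobi (t := i + j + r) (w := u + v + w) (ij := i + j) (jk := j + r) (ki := i + r)
    (ab := u + v) (bc := v + w) (ca := u + w) rfl rfl (by ring) rfl rfl (by ring)
    (by ring) (by ring) (by ring) (by ring) (by ring) (by ring) x y z
  rw [g.antisymm (show r + (i + j) = i + j + r by ring) (show i + j + r = i + j + r by ring)
      (show w + (u + v) = u + v + w by ring) (show u + v + w = u + v + w by ring) z,
    g.antisymm (show r + i = i + r by ring) rfl (show w + u = u + w by ring) rfl z x] at J
  have J' := congrArg (g.gen (i + j + r) (u + v + w)) J
  rw [g.symBracket_eq (show i + j + r = i + j + r by ring)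
      (show u + v + w = u + v + w by ring) _ z,
    g.symBracket_eq (show j + (i + r) = i + j + r by ring)
      (show v + (u + w) = u + v + w by ring) y,
    g.symBracket_eq (show i + (j + r) = i + j + r by ring)
      (show u + (v + w) = u + v + w by ring) x]
  simp only [map_add, map_smul, map_zero] at J'
  generalize g.gen (i + j + r) (u + v + w) (g.bracket _ _ x (g.bracket _ _ y z)) = X at J' ⊢
  generalize g.gen (i + j + r) (u + v + w) (g.bracket _ _ y (g.bracket _ _ x z)) = Y at J' ⊢
  generalize g.gen (i + j + r) (u + v + w) (g.bracket _ _ (g.bracket _ _ x y) z) = Z at J' ⊢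
  simp only [sgn_eq, Int.even_add, Int.even_mul, Int.not_even_one] at J' ⊢
  by_cases hi : Even i <;> by_cases hj : Even j <;> by_cases hr : Even r <;>
    simp [hi, hj, hr] at J' ⊢ <;> first
      | linear_combination (norm := module) (1 : F) • J'
      | linear_combination (norm := module) (-1 : F) • J'

lemma ad_symBracket_mul {i j r : ℤ} {u v w : ℕ} (x : g.obj i u) (y : g.obj j v)
    (z : g.obj r w) (a : g.Sym) :
    g.ad y (g.symBracket x z * a)
      = sgn F (i + 1) • (g.symBracket y (g.bracket (k := i + r) (w := u + w) rfl rfl x z) * a)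
        + sgn F (j * (i + r + 1)) • (g.symBracket x z * g.ad y a) := by
  rw [g.symBracket_eq (i := i) rfl rfl, smul_mul_assoc, map_smul, ad_gen_mul, smul_add,
    smul_comm, smul_mul_assoc]

lemma d_symBracket_mul {i j : ℤ} {u v : ℕ} (x : g.obj i u) (y : g.obj j v) (a : g.Sym) :
    g.d (g.symBracket x y * a)
      = sgn F (i + j + 1) • (g.symBracket x y * g.d a)
        + sgn F (i + 1) • g.ad (g.bracket (k := i + j) (w := u + v) rfl rfl x y) a := by
  rw [g.symBracket_eq rfl rfl, smul_mul_assoc, map_smul, d_gen_mul, smul_add,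
    smul_comm, smul_mul_assoc]

/-- The Jacobi identity, for the operators `D_x`. -/
lemma ad_bracket {i j : ℤ} {u v : ℕ} (x : g.obj i u) (y : g.obj j v) (a : g.Sym) :
    sgn F (i + 1) • g.ad (g.bracket (k := i + j) (w := u + v) rfl rfl x y) a
      + sgn F (i * (j + 1)) • g.ad y (g.ad x a) + sgn F (i + 1) • g.ad x (g.ad y a) = 0 := by
  induction a using sym_induction with
  | one => simp [ad_one]
  | add a b ha hb =>
    simp only [map_add, smul_add]
    have h := congrArg₂ (· + ·) ha hb
    rw [add_zero] at h
    rw [← h]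
    abel
  | smul c a ha =>
    simp only [map_smul]
    rw [smul_comm _ c, smul_comm _ c, smul_comm _ c, ← smul_add, ← smul_add, ha, smul_zero]
  | mul r w z a ha =>
    have J := congrArg (· * a) (g.symBracket_jacobi x y z)
    simp only [add_mul, smul_mul_assoc, zero_mul] at J
    simp only [ad_gen_mul, map_add, map_smul, ad_symBracket_mul, smul_add]
    have ha' := congrArg (g.gen r w z * ·) ha
    simp only [mul_add, mul_smul_comm, mul_zero] at ha'
    generalize g.symBracket (g.bracket _ _ x y) z * a = A₁ at J ⊢
    generalize g.symBracket y (g.bracket _ _ x z) * a = A₂ at J ⊢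
    generalize g.symBracket x (g.bracket _ _ y z) * a = A₃ at J ⊢
    generalize g.gen r w z * g.ad (g.bracket _ _ x y) a = B₁ at ha' ⊢
    generalize g.gen r w z * g.ad y (g.ad x a) = B₂ at ha' ⊢
    generalize g.gen r w z * g.ad x (g.ad y a) = B₃ at ha' ⊢
    simp only [sgn_eq, Int.even_add, Int.even_mul, Int.not_even_one] at J ha' ⊢
    by_cases hi : Even i <;> by_cases hj : Even j <;> by_cases hr : Even r <;>
      simp [hi, hj, hr] at J ha' ⊢ <;> first
        | linear_combination (norm := module) (1 : F) • J + (1 : F) • ha'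
        | linear_combination (norm := module) (1 : F) • J + (-1 : F) • ha'

lemma d_ad {i : ℤ} {u : ℕ} (x : g.obj i u) (a : g.Sym) :
    g.d (g.ad x a) + sgn F (i + 1) • g.ad x (g.d a) = 0 := by
  induction a using sym_induction with
  | one => simp [ad_one, d_one]
  | add a b ha hb =>
    simp only [map_add, smul_add]
    have h := congrArg₂ (· + ·) ha hb
    rw [add_zero] at h
    rw [← h]
    abel
  | smul c a ha =>
    simp only [map_smul]
    rw [smul_comm _ c, ← smul_add, ha, smul_zero]
  | mul j v y a ha =>
    have ha' := congrArg (g.gen j v y * ·) ha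
    simp only [mul_add, mul_smul_comm, mul_zero] at ha'
    have J := g.ad_bracket x y a
    simp only [ad_gen_mul, d_gen_mul, map_add, map_smul, d_symBracket_mul, smul_add]
    generalize g.ad (g.bracket _ _ x y) a = A₁ at J ⊢
    generalize g.ad y (g.ad x a) = A₂ at J ⊢
    generalize g.ad x (g.ad y a) = A₃ at J ⊢
    generalize g.gen j v y * g.d (g.ad x a) = B₁ at ha' ⊢
    generalize g.gen j v y * g.ad x (g.d a) = B₂ at ha' ⊢
    simp only [sgn_eq, Int.even_add, Int.even_mul, Int.not_even_one] at J ha' ⊢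
    by_cases hi : Even i <;> by_cases hj : Even j <;>
      simp [hi, hj] at J ha' ⊢ <;> first
        | linear_combination (norm := module) (1 : F) • J + (1 : F) • ha'
        | linear_combination (norm := module) (1 : F) • J + (-1 : F) • ha'

lemma d_d (a : g.Sym) : g.d (g.d a) = 0 := by
  induction a using sym_induction with
  | one => simp [d_one]
  | add a b ha hb => simp [ha, hb]
  | smul c a ha => simp [ha]
  | mul i u x a ha =>
    have := g.d_ad x a
    simp only [d_gen_mul, map_add, map_smul, ha, mul_zero, smul_zero, zero_add]
    rw [← this]
    abel

/-! #### The Chevalley--Eilenberg complex -/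

variable {g} in
lemma isMonomial_mem {i : ℤ} {k : ℕ} {a : g.Sym} (ha : g.IsMonomial i k a) : a ∈ g.piece i k :=
  Submodule.subset_span ha

variable {g} in
lemma symBracket_mul_mem_piece {i j k l : ℤ} {u v w s : ℕ} (h : i + j + 1 + k = l)
    (e : u + v + w = s) (x : g.obj i u) (y : g.obj j v) {a : g.Sym} (ha : a ∈ g.piece k w) :
    g.symBracket x y * a ∈ g.piece l s := by
  rw [symBracket, smul_mul_assoc]
  exact Submodule.smul_mem _ _ (gen_mul_mem_piece h e _ ha)

variable {g} in
lemma ad_mem_piece {i j k : ℤ} {u v w : ℕ} (h : i + j = k) (e : u + v = w) (x : g.obj i u)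
    {a : g.Sym} (ha : a ∈ g.piece j v) : g.ad x a ∈ g.piece k w := by
  induction ha using Submodule.span_induction with
  | mem a ha =>
    induction ha generalizing k w with
    | one => rw [ad_one]; exact Submodule.zero_mem _
    | mul h' e' y ha ih =>
      rw [ad_gen_mul]
      refine Submodule.add_mem _ (symBracket_mul_mem_piece (by omega) (by omega) x y
        (isMonomial_mem ha)) (Submodule.smul_mem _ _ ?_)
      exact gen_mul_mem_piece (by omega) (by omega) y (ih rfl rfl)
  | zero => rw [map_zero]; exact Submodule.zero_mem _
  | add a b _ _ ha hb => rw [map_add]; exact Submodule.add_mem _ ha hb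
  | smul c a _ ha => rw [map_smul]; exact Submodule.smul_mem _ c ha

variable {g} in
lemma d_mem_piece {i j : ℤ} {k : ℕ} (h : j + 1 = i) {a : g.Sym} (ha : a ∈ g.piece i k) :
    g.d a ∈ g.piece j k := by
  induction ha using Submodule.span_induction with
  | mem a ha =>
    induction ha generalizing j with
    | one => rw [d_one]; exact Submodule.zero_mem _
    | mul h' e' y ha ih =>
      rw [d_gen_mul]
      refine Submodule.add_mem _ (Submodule.smul_mem _ _ ?_)
        (ad_mem_piece (by omega) e' y (isMonomial_mem ha))
      exact gen_mul_mem_piece (by omega) e' y (ih (sub_add_cancel _ 1))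
  | zero => rw [map_zero]; exact Submodule.zero_mem _
  | add a b _ _ ha hb => rw [map_add]; exact Submodule.add_mem _ ha hb
  | smul c a _ ha => rw [map_smul]; exact Submodule.smul_mem _ c ha

/-- The differential `CE(g)_k` in degrees `i + 1 → i`. -/
def dPiece (k : ℕ) (i : ℤ) : g.piece (i + 1) k →ₗ[F] g.piece i k :=
  g.d.restrict fun _ ha => d_mem_piece rfl ha

/-- The weight `k` summand `CE(g)_k` of the Chevalley--Eilenberg complex of `g`. -/
def CE (k : ℕ) : ChainComplex (ModuleCat.{max u v} F) ℤ :=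
  ChainComplex.of (fun i => ModuleCat.of F (g.piece i k)) (fun i => ModuleCat.ofHom (g.dPiece k i))
    (fun _ => ModuleCat.hom_ext (LinearMap.ext fun a => Subtype.ext (g.d_d a.1)))

/-- The inclusion of `CE(g)_k`, in degree `i`, into `Sym(g[1])`. -/
def CE.incl (k : ℕ) (i : ℤ) : (g.CE k).X i →ₗ[F] g.Sym := (g.piece i k).subtype

/-- `l` is the functional on `CE(g)` dual to the element `x` of degree zero and weight one in
`g[1]`: it takes the value `1` on `x` and vanishes in all other bidegrees. -/
def IsDualFunctional (x : g.obj (-1) 1) (l : g.Sym →ₗ[F] F) : Prop :=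
  l (g.gen (-1) 1 x) = 1 ∧
    ∀ (i : ℤ) (k : ℕ), (i, k) ≠ (0, 1) → ∀ a ∈ g.piece i k, l a = 0

/-- The subalgebra of `Sym(g[1])` generated by the homogeneous elements of `g[1]` which are not of
degree zero and weight one. -/
def restAlgebra : Subalgebra F g.Sym :=
  Algebra.adjoin F {a | ∃ (i : ℤ) (u : ℕ) (y : g.obj i u), (i, u) ≠ (-1, 1) ∧ g.gen i u y = a}

end BigradedLieAlgebra

/-! ### The Lie algebra of a manifold -/

section LieAlgebraOfManifold

variable (F : Type v) [Field F] (X : Type u) [TopologicalSpace X] (n : ℕ)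

/-- The cohomological degrees `t` for which `H_c^t` contributes to degree `i` and weight `u`. -/
def IsIndex (i : ℤ) (u : ℕ) (t : ℕ) : Prop :=
  i = u * ((n : ℤ) - 1) - t ∧ (u = 1 ∨ u = 2 ∧ Even n)

/-- The part of degree `i` and weight `u` of `H_c^{-*}(X) ⊗ L(v)`, where `v` has degree `n - 1` and
weight `1`. The free graded Lie algebra `L(v)` has basis `v` if `n` is odd and `v`, `[v, v]` if `n`
is even, where `[v, v]` has degree `2 (n - 1)` and weight `2`. So this is `H_c^t(X)` if
`i = u (n - 1) - t` with `u = 1`, or `u = 2` and `n` even, and zero otherwise. (It is written as a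
product over a set with at most one element.) -/
def LieObj (i : ℤ) (u : ℕ) : Type (max u v) := ∀ t : {t : ℕ // IsIndex n i u t}, Hc F X t.1

instance LieObj.addCommGroup (i : ℤ) (u : ℕ) : AddCommGroup (LieObj F X n i u) :=
  inferInstanceAs (AddCommGroup (∀ t : {t : ℕ // IsIndex n i u t}, Hc F X t.1))

instance LieObj.module (i : ℤ) (u : ℕ) : Module F (LieObj F X n i u) :=
  inferInstanceAs (Module F (∀ t : {t : ℕ // IsIndex n i u t}, Hc F X t.1))

variable {n} in
/-- The component in `H_c^t(X)`. -/
def LieObj.comp {i : ℤ} {u : ℕ} (t : ℕ) (h : IsIndex n i u t) :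
    LieObj F X n i u →ₗ[F] Hc F X t where
  toFun x := x ⟨t, h⟩
  map_add' _ _ := rfl
  map_smul' _ _ := rfl

variable {F X n} in
lemma LieObj.ext {i : ℤ} {u : ℕ} {x y : LieObj F X n i u}
    (h : ∀ (t : ℕ) (ht : IsIndex n i u t), comp F X t ht x = comp F X t ht y) : x = y :=
  funext fun t => h t.1 t.2

variable {n} in
lemma IsIndex.weights {i j k : ℤ} {u v w p q t : ℕ} (hw : u + v = w) (hp : IsIndex n i u p)
    (hq : IsIndex n j v q) (ht : IsIndex n k w t) : u = 1 ∧ v = 1 ∧ Even n := by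
  obtain ⟨-, hp⟩ := hp
  obtain ⟨-, hq⟩ := hq
  obtain ⟨-, ht⟩ := ht
  rcases hp with hp | ⟨hp, -⟩ <;> rcases hq with hq | ⟨hq, -⟩ <;> rcases ht with ht | ⟨ht, hn⟩ <;>
    first | omega | exact ⟨hp, hq, hn⟩

/-- The cohomological degree which contributes to degree `i` and weight `u`, if there is one. -/
def cohDegree (i : ℤ) (u : ℕ) : ℕ := (u * ((n : ℤ) - 1) - i).toNat

variable {n} in
lemma IsIndex.eq_cohDegree {i : ℤ} {u t : ℕ} (h : IsIndex n i u t) : t = cohDegree n i u := by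
  obtain ⟨h, -⟩ := h
  unfold cohDegree
  omega

open Classical in
/-- The component of the bracket with values in `H_c^t(X)`. -/
def lieBracketComp (i j : ℤ) (u v t : ℕ) :
    LieObj F X n i u →ₗ[F] LieObj F X n j v →ₗ[F] Hc F X t :=
  if h : IsIndex n i u (cohDegree n i u) ∧ IsIndex n j v (cohDegree n j v) ∧
      cohDegree n i u + cohDegree n j v = t then
    sgn F (cohDegree n j v) • (Hc.cup F X h.2.2).compl₁₂ (LieObj.comp F X _ h.1)
      (LieObj.comp F X _ h.2.1)
  else 0

/-- The bracket of `H_c^{-*}(X) ⊗ L(v)`: for `α ∈ H_c^p` and `β ∈ H_c^q`,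
`[α ⊗ v, β ⊗ v] = (-1)^(|v| |β|) (α ∪ β) ⊗ [v, v] = (-1)^q (α ∪ β) ⊗ [v, v]` if `n` is even, and all
other brackets are zero. -/
def lieBracket {i j k : ℤ} {u v w : ℕ} :
    LieObj F X n i u →ₗ[F] LieObj F X n j v →ₗ[F] LieObj F X n k w :=
  LinearMap.mk₂ F (fun x y t => lieBracketComp F X n i j u v t.1 x y)
    (fun x x' y => funext fun t => by
      change lieBracketComp F X n i j u v t.1 (x + x') y
        = lieBracketComp F X n i j u v t.1 x y + lieBracketComp F X n i j u v t.1 x' y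
      rw [map_add, LinearMap.add_apply])
    (fun c x y => funext fun t => by
      change lieBracketComp F X n i j u v t.1 (c • x) y = c • lieBracketComp F X n i j u v t.1 x y
      rw [map_smul, LinearMap.smul_apply])
    (fun x y y' => funext fun t => map_add (lieBracketComp F X n i j u v t.1 x) y y')
    (fun c x y => funext fun t => map_smul (lieBracketComp F X n i j u v t.1 x) c y)

variable {F X n}

open LieObj

lemma comp_lieBracket {i j k : ℤ} {u v w p q t : ℕ} (x : LieObj F X n i u)
    (y : LieObj F X n j v) (ht : IsIndex n k w t) (hp : IsIndex n i u p)
    (hq : IsIndex n j v q) (h : p + q = t) :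
    comp F X t ht (lieBracket F X n x y)
      = sgn F q • Hc.cup F X h (comp F X p hp x) (comp F X q hq y) := by
  obtain rfl := hp.eq_cohDegree
  obtain rfl := hq.eq_cohDegree
  change lieBracketComp F X n i j u v t x y = _
  rw [lieBracketComp, dif_pos ⟨hp, hq, h⟩]
  rfl

lemma comp_lieBracket_eq_zero {i j k : ℤ} {u v w t : ℕ} (x : LieObj F X n i u)
    (y : LieObj F X n j v) (ht : IsIndex n k w t)
    (h : ¬ (IsIndex n i u (cohDegree n i u) ∧ IsIndex n j v (cohDegree n j v))) :
    comp F X t ht (lieBracket F X n x y) = 0 := by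
  change lieBracketComp F X n i j u v t x y = _
  rw [lieBracketComp, dif_neg fun h' => h ⟨h'.1, h'.2.1⟩]
  rfl

lemma lieBracket_lieBracket {i j k jk t : ℤ} {a b c bc w : ℕ} (e : a + bc = w) (e' : b + c = bc)
    (x : LieObj F X n i a) (y : LieObj F X n j b) (z : LieObj F X n k c) :
    (lieBracket F X n x (lieBracket F X n y z : LieObj F X n jk bc) : LieObj F X n t w) = 0 := by
  by_cases hbc : bc = 2
  · refine LieObj.ext fun r hr => ?_
    rw [map_zero]
    refine comp_lieBracket_eq_zero _ _ _ fun h => ?_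
    have := IsIndex.weights e h.1 h.2 hr
    omega
  · have h0 : (lieBracket F X n y z : LieObj F X n jk bc) = 0 := by
      refine LieObj.ext fun r hr => ?_
      rw [map_zero]
      refine comp_lieBracket_eq_zero _ _ _ fun h => hbc ?_
      have := IsIndex.weights e' h.1 h.2 hr
      omega
    rw [h0, map_zero]

lemma neg_one_pow_eq_sgn (m : ℕ) : (-1 : F) ^ m = sgn F m := by
  induction m with
  | zero => simp [sgn_zero]
  | succ m ih => rw [pow_succ, ih, Nat.cast_succ, sgn_add, sgn_one]

variable (F X n)

/-- The graded Lie algebra `H_c^{-*}(X; F) ⊗ L(v)`, with `v` of degree `n - 1` and weight `1`. -/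
def manifoldLieAlgebra : BigradedLieAlgebra.{max u v, v} F where
  obj i u := LieObj F X n i u
  addCommGroup i u := LieObj.addCommGroup F X n i u
  module i u := LieObj.module F X n i u
  bracket _ _ := lieBracket F X n
  antisymm := by
    intro i j k u v w h h' e e' x y
    refine LieObj.ext fun t ht => ?_
    rw [map_smul]
    by_cases hv : IsIndex n i u (cohDegree n i u) ∧ IsIndex n j v (cohDegree n j v)
    · obtain ⟨hp, hq⟩ := hv
      generalize cohDegree n i u = p at hp
      generalize cohDegree n j v = q at hq
      obtain ⟨hu, hv, hn⟩ := IsIndex.weights e hp hq ht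
      have ht1 := ht.1
      have hp1 := hp.1
      have hq1 := hq.1
      have hpq : p + q = t := by
        subst hu hv e
        push_cast at ht1 hp1 hq1
        omega
      rw [comp_lieBracket x y ht hp hq hpq, comp_lieBracket y x ht hq hp (by omega),
        Hc.cup_comm hpq (by omega), smul_smul, smul_smul, neg_one_pow_eq_sgn]
      congr 1
      subst hu hv
      have hn' : Even (n : ℤ) := by exact_mod_cast hn
      rw [hp1, hq1]
      simp only [sgn_eq, Int.even_add, Int.even_sub, Int.even_mul, Int.not_even_one, Nat.cast_one,
        Nat.cast_mul]
      by_cases h1 : Even (p : ℤ) <;> by_cases h2 : Even (q : ℤ) <;> simp [h1, h2, hn']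
    · rw [comp_lieBracket_eq_zero _ _ _ hv,
        comp_lieBracket_eq_zero _ _ _ fun h3 => hv ⟨h3.2, h3.1⟩, smul_zero]
  jacobi := by
    intro i j k ij jk ki t a b c ab bc ca w _ _ _ hab hbc hca _ _ _ e₁ e₂ e₃ x y z
    rw [lieBracket_lieBracket e₁ hbc, lieBracket_lieBracket e₂ hab, lieBracket_lieBracket e₃ hca,
      smul_zero, smul_zero, smul_zero, add_zero, add_zero]

/-- A class in `H_c^n(X)`, as an element of degree `-1` and weight `1` of the Lie algebra, i.e. as
an element of degree `0` of `g[1]`. -/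
def topClass (x : Hc F X n) : (manifoldLieAlgebra F X n).obj (-1) 1 :=
  fun t => (show n = t.1 by have := t.2.1; push_cast at this; omega) ▸ x

end LieAlgebraOfManifold

/-! ### Orientations and Poincaré duality -/

section Orientation

variable (F : Type v) [Field F] {X : Type u} [TopologicalSpace X]

/-- Chains all of whose simplices lie in `U`. -/
def chainsIn (U : Set X) (q : ℕ) : Submodule F (Chain F X q) :=
  Finsupp.supported F F {σ : Simplex X q | Set.range σ ⊆ U}

/-- Relative cycles of the pair `(X, X \ A)`. -/
def relCycles (A : Set X) : (q : ℕ) → Submodule F (Chain F X q)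
  | 0 => ⊤
  | q + 1 => (chainsIn F Aᶜ q).comap (boundary F X q)

/-- Relative boundaries of the pair `(X, X \ A)`. -/
def relBoundaries (A : Set X) (q : ℕ) : Submodule F (Chain F X q) :=
  LinearMap.range (boundary F X q) ⊔ chainsIn F Aᶜ q

/-- Relative singular homology `H_q(X, X \ A; F)`: relative cycles modulo relative boundaries, as
the image of the relative cycles in the quotient of all chains by the relative boundaries. -/
def LocalHomology (A : Set X) (q : ℕ) : Submodule F (Chain F X q ⧸ relBoundaries F A q) :=
  (relCycles F A q).map (relBoundaries F A q).mkQ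

variable {F} in
lemma chainsIn_mono {A B : Set X} (h : A ⊆ B) (q : ℕ) : chainsIn F A q ≤ chainsIn F B q :=
  Finsupp.supported_mono fun _ hσ => hσ.trans h

lemma relCycles_anti {A B : Set X} (h : A ⊆ B) : ∀ q, relCycles F B q ≤ relCycles F A q
  | 0 => le_rfl
  | q + 1 => Submodule.comap_mono (chainsIn_mono (Set.compl_subset_compl.2 h) q)

lemma relBoundaries_anti {A B : Set X} (h : A ⊆ B) (q : ℕ) :
    relBoundaries F B q ≤ relBoundaries F A q :=
  sup_le_sup_left (chainsIn_mono (Set.compl_subset_compl.2 h) q) _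

/-- The class of a relative cycle. -/
def LocalHomology.mk (A : Set X) (q : ℕ) : relCycles F A q →ₗ[F] LocalHomology F A q :=
  (relBoundaries F A q).mkQ.restrict fun _ hz => Submodule.mem_map_of_mem hz

/-- The map `H_q(X, X \ B) → H_q(X, X \ A)` for `A ⊆ B`. -/
def LocalHomology.restrict {A B : Set X} (h : A ⊆ B) (q : ℕ) :
    LocalHomology F B q →ₗ[F] LocalHomology F A q :=
  (Submodule.mapQ _ _ LinearMap.id (relBoundaries_anti F h q)).restrict (by
    rintro _ ⟨z, hz, rfl⟩
    exact ⟨z, relCycles_anti F h q hz, rfl⟩)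

variable (X) in
/-- An `F`-orientation of an `n`-manifold `X`: a generator of `H_n(X, X \ p; F)` for each point
`p`, such that each point has a neighbourhood `B` for which some class in `H_n(X, X \ B; F)`
restricts to the chosen generator at each point of `B`. -/
structure HomologicalOrientation (n : ℕ) where
  localClass : ∀ p : X, LocalHomology F ({p} : Set X) n
  generates : ∀ p, Submodule.span F {localClass p} = ⊤
  consistent : ∀ p, ∃ B ∈ nhds p, ∃ β : LocalHomology F B n, ∀ (q : X) (hq : q ∈ B),
    LocalHomology.restrict F (Set.singleton_subset_iff.2 hq) n β = localClass q

variable {F}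

/-- The constant singular `0`-simplex at a point. -/
def pointSimplex (p : X) : Simplex X 0 := ContinuousMap.const _ p

/-- The cap product of an `n`-chain with an `n`-cochain, a `0`-chain: a simplex `σ` is sent to
`f(σ)` times its last vertex. -/
def capChain {n : ℕ} (f : Cochain F X n) : Chain F X n →ₗ[F] Chain F X 0 :=
  Finsupp.linearCombination F fun σ : Simplex X n =>
    Finsupp.single (σ.pull fun _ => Fin.last n) (f σ)

/-- `x ∈ H_c^n(X)` is Poincaré dual to the class of the point `p` in `H_0(X)`: it is represented by
a cocycle `f` which vanishes off a compact set `K`, and the cap product of `f` with a relative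
cycle `z` representing the fundamental class in `H_n(X, X \ K)` (the class which restricts to the
orientation at each point of `K`) is homologous to `p`. -/
def IsPoincareDualPoint {n : ℕ} (μ : HomologicalOrientation F X n) (p : X) (x : Hc F X n) : Prop :=
  ∃ (K : Set X) (f : cocycles F X n) (z : relCycles F K n),
    IsCompact K ∧ VanishesOff f.1 K ∧ Hc.mk F X n f = x ∧
    (∀ (q : X) (hq : q ∈ K), LocalHomology.restrict F (Set.singleton_subset_iff.2 hq) n
      (LocalHomology.mk F K n z) = μ.localClass q) ∧
    capChain f.1 z.1 - Finsupp.single (pointSimplex p) 1 ∈ LinearMap.range (boundary F X 0)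

end Orientation

end ConfLie

end

open ConfLie

/-! Algebra. In `g[1]` a class of `H_c^t ⊗ v` has degree `n - t` and weight `1`, and a class of
`H_c^t ⊗ [v,v]` has degree `2n - 1 - t` and weight `2`. Since `H_c^t(M) = 0` for `t > n`, and
`H_c^n(M)` is the line spanned by `x`, and `n > 2`, every homogeneous generator other than the
multiples of `x` has degree at least its weight (`isTopClass_topClass`). Every element is therefore
a polynomial in `x` whose coefficients are sums of products of the other generators, with degree at
least weight.

Because `x` has degree zero, no signs intervene, and capping with the dual functional is a
derivation that sends `x` to `1` and the other generators to `0`: it is `d/dx`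
(`IsTopClass.cap_mul`, `IsTopClass.cap_pow_mul`). It commutes with the differential because the
functional vanishes on brackets, which have weight at least two (`IsTopClass.cap_d`). In
characteristic zero antiderivatives exist, so it is surjective. In weight `k + 1` and degree `i ≤ k`
every element is divisible by `x`, and `d/dx` is injective on multiples of `x`
(`IsTopClass.eq_zero_of_cap_eq_zero`). A chain map that is epi in degree `i + 1`, iso in degree `i`
and mono in degree `i - 1` is an isomorphism on `H_i`.

Topology. What remains is that `H_c^t(M)` vanishes for `t > n` and that `x` exists, is unique and
spans `H_c^n(M)`. The relative homology `H_q(M, M \ K)` of compact `K` is studied by subdivision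
(excision and Mayer–Vietoris), prisms (homotopy invariance) and transfer along charts. It vanishes
for `q > n`, and for `q = n` classes are detected at the points of `K`
(`relAcyclic_and_pointDetected`). An orientation then gives fundamental classes
(`exists_fundamental`), and a relative cycle has a constant local value along a connected set.

Over a field, a compactly supported cocycle is a coboundary as soon as it vanishes on the relative
cycles of some compact set (`mem_coboundaries_of_evalChain`). This yields the vanishing above the
dimension. In degree `n`, enlarging `K` to a connected compact set shows that a class is determined
by its value on a fundamental cycle, and the Poincaré dual of a point is the class with value `1`.
-/

noncomputable section

namespace ConfLie

universe u v

/-! ### Chains on ordered tuples -/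

section TupleChains

variable {F : Type*} [Field F] {S T : Type*}

/-- A linear map takes the functions supported in `s` to `N` if it does so for the basis elements. -/
lemma map_mem_of_mem_supported {ι W : Type*} [AddCommGroup W] [Module F W] {s : Set ι}
    {N : Submodule F W} {f : (ι →₀ F) →ₗ[F] W} (h : ∀ a ∈ s, f (Finsupp.single a 1) ∈ N)
    {c : ι →₀ F} (hc : c ∈ Finsupp.supported F F s) : f c ∈ N := by
  refine (?_ : Finsupp.supported F F s ≤ N.comap f) hc
  rw [Finsupp.supported_eq_span_single, Submodule.span_le]
  rintro _ ⟨a, ha, rfl⟩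
  exact h a ha

/-- Chains on ordered tuples of `q + 1` points. -/
abbrev TupleChain (F : Type*) [Field F] (S : Type*) (q : ℕ) := (Fin (q + 1) → S) →₀ F

variable (F S) in
/-- The boundary of chains on tuples. -/
def tupleBoundary (q : ℕ) : TupleChain F S (q + 1) →ₗ[F] TupleChain F S q :=
  Finsupp.linearCombination F fun a : Fin (q + 2) → S =>
    ∑ i : Fin (q + 2), Finsupp.single (a ∘ i.succAbove) ((-1 : F) ^ (i : ℕ))

variable (F) in
/-- Add `s` as a first vertex. -/
def tupleJoin (s : S) (q : ℕ) : TupleChain F S q →ₗ[F] TupleChain F S (q + 1) :=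
  Finsupp.lmapDomain F F fun a => (Fin.cons s a : Fin (q + 2) → S)

variable (F) in
/-- The map on tuple chains induced by a map of points. -/
def tupleMap (f : S → T) (q : ℕ) : TupleChain F S q →ₗ[F] TupleChain F T q :=
  Finsupp.lmapDomain F F fun a => f ∘ a

lemma tupleJoin_single (s : S) {q : ℕ} (a : Fin (q + 1) → S) (c : F) :
    tupleJoin F s q (Finsupp.single a c) = Finsupp.single (Fin.cons s a : Fin (q + 2) → S) c := by
  simp [tupleJoin]

lemma tupleMap_single (f : S → T) {q : ℕ} (a : Fin (q + 1) → S) (c : F) :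
    tupleMap F f q (Finsupp.single a c) = Finsupp.single (f ∘ a) c := by
  simp [tupleMap]

lemma tupleBoundary_single {q : ℕ} (a : Fin (q + 2) → S) :
    tupleBoundary F S q (Finsupp.single a 1)
      = ∑ i : Fin (q + 2), Finsupp.single (a ∘ i.succAbove) ((-1 : F) ^ (i : ℕ)) := by
  simp [tupleBoundary]

lemma tupleBoundary_map (f : S → T) {q : ℕ} (c : TupleChain F S (q + 1)) :
    tupleBoundary F T q (tupleMap F f (q + 1) c) = tupleMap F f q (tupleBoundary F S q c) := by
  induction c using Finsupp.induction_linear with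
  | zero => simp
  | add x y hx hy => simp [hx, hy]
  | single a c =>
    rw [← Finsupp.smul_single_one]
    simp only [map_smul, tupleMap_single, tupleBoundary_single, map_sum]
    rfl

lemma tupleMap_join (f : S → T) (s : S) {q : ℕ} (c : TupleChain F S q) :
    tupleMap F f (q + 1) (tupleJoin F s q c) = tupleJoin F (f s) q (tupleMap F f q c) := by
  induction c using Finsupp.induction_linear with
  | zero => simp
  | add x y hx hy => simp [hx, hy]
  | single a c =>
    simp only [tupleMap_single, tupleJoin_single]
    congr 1
    funext j
    refine Fin.cases ?_ (fun j => ?_) j <;> simp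

lemma tupleBoundary_single_cons {q : ℕ} (s : S) (b : Fin (q + 2) → S) :
    tupleBoundary F S (q + 1) (Finsupp.single (Fin.cons s b : Fin (q + 3) → S) 1)
      = Finsupp.single b 1 - tupleJoin F s q (tupleBoundary F S q (Finsupp.single b 1)) := by
  rw [tupleBoundary_single, tupleBoundary_single, Fin.sum_univ_succ, sub_eq_add_neg, map_sum,
    ← Finset.sum_neg_distrib]
  congr 1
  · simp only [Fin.val_zero, pow_zero]
    congr 1
  · refine Finset.sum_congr rfl fun i _ => ?_
    have : (Fin.cons s b : Fin (q + 3) → S) ∘ i.succ.succAbove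
        = (Fin.cons s (b ∘ i.succAbove) : Fin (q + 2) → S) := by
      funext j
      refine Fin.cases ?_ (fun j => ?_) j <;> simp
    rw [this, Fin.val_succ, pow_succ, tupleJoin_single, ← Finsupp.single_neg]
    congr 1
    ring

/-- The sum of the coefficients. -/
def tupleAug (F : Type*) [Field F] (S : Type*) : TupleChain F S 0 →ₗ[F] F :=
  Finsupp.linearCombination F fun _ => 1

/-- Coning is a contracting homotopy. Subdivision and prisms are defined by iterated cones so that
their boundary formulas follow from this identity; degree zero needs the augmentation instead. -/
lemma tupleBoundary_join {q : ℕ} (s : S) (c : TupleChain F S (q + 1)) :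
    tupleBoundary F S (q + 1) (tupleJoin F s (q + 1) c)
      = c - tupleJoin F s q (tupleBoundary F S q c) := by
  induction c using Finsupp.induction_linear with
  | zero => simp
  | add x y hx hy => simp only [map_add, hx, hy]; abel
  | single a c =>
    rw [← Finsupp.smul_single_one]
    simp only [map_smul, tupleJoin_single, tupleBoundary_single_cons, smul_sub]

lemma tupleBoundary_join_zero (s : S) (c : TupleChain F S 0) :
    tupleBoundary F S 0 (tupleJoin F s 0 c) = c - tupleAug F S c • Finsupp.single (fun _ => s) 1 := by
  induction c using Finsupp.induction_linear with
  | zero => simp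
  | add x y hx hy => simp only [map_add, hx, hy, add_smul]; abel
  | single a c =>
    rw [← Finsupp.smul_single_one]
    simp only [map_smul, tupleJoin_single, tupleBoundary_single]
    rw [Fin.sum_univ_two, sub_eq_add_neg, smul_add]
    congr 1
    · congr 1
      simp only [Fin.val_zero, pow_zero]
      congr 1
    · have : (Fin.cons s a : Fin 2 → S) ∘ (1 : Fin 2).succAbove = fun _ => s := by
        funext i
        obtain rfl : i = 0 := Subsingleton.elim (α := Fin 1) i 0
        rfl
      rw [this]
      simp [tupleAug]

lemma tupleAug_boundary (c : TupleChain F S 1) : tupleAug F S (tupleBoundary F S 0 c) = 0 := by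
  induction c using Finsupp.induction_linear with
  | zero => simp
  | add x y hx hy => simp [hx, hy]
  | single a c =>
    rw [← Finsupp.smul_single_one]
    rw [map_smul, map_smul, tupleBoundary_single, Fin.sum_univ_two]
    simp [tupleAug]

/-- Every tuple is the cone on its tail `b`, so the cone formula, applied twice, reduces the claim
to the vanishing of the double boundary of `b`. In the lowest degree the augmentation kills
boundaries. -/
lemma tupleBoundary_boundary {q : ℕ} (c : TupleChain F S (q + 2)) :
    tupleBoundary F S q (tupleBoundary F S (q + 1) c) = 0 := by
  induction c using Finsupp.induction_linear with
  | zero => simp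
  | add x y hx hy => simp [hx, hy]
  | single a c =>
    rw [← Finsupp.smul_single_one, map_smul, map_smul]
    refine smul_eq_zero_of_right _ ?_
    induction q with
    | zero =>
      obtain ⟨s, b, rfl⟩ : ∃ s b, a = Fin.cons s b :=
        ⟨a 0, Fin.tail a, (Fin.cons_self_tail a).symm⟩
      rw [tupleBoundary_single_cons, map_sub, tupleBoundary_join_zero, tupleAug_boundary]
      simp
    | succ q ih =>
      obtain ⟨s, b, rfl⟩ : ∃ s b, a = Fin.cons s b :=
        ⟨a 0, Fin.tail a, (Fin.cons_self_tail a).symm⟩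
      rw [tupleBoundary_single_cons, map_sub, tupleBoundary_join, ih]
      simp

/-- Barycentric subdivision, for a choice of barycenter of every tuple. -/
def tupleSd (F : Type*) [Field F] {S : Type*} (bar : ∀ q : ℕ, (Fin (q + 1) → S) → S) :
    (q : ℕ) → TupleChain F S q →ₗ[F] TupleChain F S q
  | 0 => LinearMap.id
  | q + 1 => Finsupp.linearCombination F fun a : Fin (q + 2) → S =>
      tupleJoin F (bar (q + 1) a) q (tupleSd F bar q (tupleBoundary F S q (Finsupp.single a 1)))

/-- The chain homotopy between the identity and barycentric subdivision. -/
def tupleSdHomotopy (F : Type*) [Field F] {S : Type*} (bar : ∀ q : ℕ, (Fin (q + 1) → S) → S) :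
    (q : ℕ) → TupleChain F S q →ₗ[F] TupleChain F S (q + 1)
  | 0 => 0
  | q + 1 => Finsupp.linearCombination F fun a : Fin (q + 2) → S =>
      tupleJoin F (bar (q + 1) a) (q + 1) (Finsupp.single a 1
        - tupleSd F bar (q + 1) (Finsupp.single a 1)
        - tupleSdHomotopy F bar q (tupleBoundary F S q (Finsupp.single a 1)))

variable (bar : ∀ q : ℕ, (Fin (q + 1) → S) → S)

lemma tupleSd_single {q : ℕ} (a : Fin (q + 2) → S) :
    tupleSd F bar (q + 1) (Finsupp.single a 1) = tupleJoin F (bar (q + 1) a) q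
      (tupleSd F bar q (tupleBoundary F S q (Finsupp.single a 1))) := by
  simp [tupleSd]

lemma tupleSdHomotopy_single {q : ℕ} (a : Fin (q + 2) → S) :
    tupleSdHomotopy F bar (q + 1) (Finsupp.single a 1) = tupleJoin F (bar (q + 1) a) (q + 1)
      (Finsupp.single a 1 - tupleSd F bar (q + 1) (Finsupp.single a 1)
        - tupleSdHomotopy F bar q (tupleBoundary F S q (Finsupp.single a 1))) := by
  simp [tupleSdHomotopy]

/-- Two linear maps on tuple chains agree if they agree on tuples. -/
lemma tupleChain_ext {q : ℕ} {W : Type*} [AddCommGroup W] [Module F W]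
    {f g : TupleChain F S q →ₗ[F] W}
    (h : ∀ a, f (Finsupp.single a 1) = g (Finsupp.single a 1)) (c : TupleChain F S q) :
    f c = g c :=
  LinearMap.congr_fun (Finsupp.lhom_ext' fun a => LinearMap.ext_ring (h a)) c

/-- The subdivision of `a` is a cone over the subdivision of `∂a`; by induction the latter is a
cycle, so the cone formula leaves only the base. -/
lemma tupleBoundary_sd {q : ℕ} (c : TupleChain F S (q + 1)) :
    tupleBoundary F S q (tupleSd F bar (q + 1) c) = tupleSd F bar q (tupleBoundary F S q c) := by
  induction q with
  | zero =>
    refine tupleChain_ext (f := tupleBoundary F S 0 ∘ₗ tupleSd F bar 1)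
      (g := tupleSd F bar 0 ∘ₗ tupleBoundary F S 0) (fun a => ?_) c
    simp only [LinearMap.comp_apply]
    rw [tupleSd_single, tupleBoundary_join_zero]
    -- Subdivision is the identity in degree zero.
    change _ - tupleAug F S (tupleBoundary F S 0 _) • _ = _
    rw [tupleAug_boundary, zero_smul, sub_zero]
  | succ q ih =>
    refine tupleChain_ext (f := tupleBoundary F S (q + 1) ∘ₗ tupleSd F bar (q + 2))
      (g := tupleSd F bar (q + 1) ∘ₗ tupleBoundary F S (q + 1)) (fun a => ?_) c
    simp only [LinearMap.comp_apply]
    rw [tupleSd_single, tupleBoundary_join, ih, tupleBoundary_boundary]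
    simp

/-- The homotopy cones `a - Sd a - T ∂a`. By induction this is a cycle, as `∂T∂a = ∂a - Sd ∂a -
T∂∂a`, so the boundary of the cone is its base. -/
lemma tupleBoundary_sdHomotopy {q : ℕ} (c : TupleChain F S (q + 1)) :
    tupleBoundary F S (q + 1) (tupleSdHomotopy F bar (q + 1) c)
      = c - tupleSd F bar (q + 1) c - tupleSdHomotopy F bar q (tupleBoundary F S q c) := by
  refine tupleChain_ext (f := tupleBoundary F S (q + 1) ∘ₗ tupleSdHomotopy F bar (q + 1))
    (g := LinearMap.id - tupleSd F bar (q + 1) - tupleSdHomotopy F bar q ∘ₗ tupleBoundary F S q)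
    (fun a => ?_) c
  simp only [LinearMap.comp_apply, LinearMap.sub_apply, LinearMap.id_apply]
  rw [tupleSdHomotopy_single, tupleBoundary_join]
  simp only [map_sub, tupleBoundary_sd]
  cases q with
  | zero =>
    have h1 : ∀ x : TupleChain F S 0, tupleSdHomotopy F bar 0 x = 0 := fun x => rfl
    have h2 : ∀ x : TupleChain F S 0, tupleSd F bar 0 x = x := fun x => rfl
    simp [h1, h2]
  | succ q =>
    rw [tupleBoundary_sdHomotopy (q := q), tupleBoundary_boundary]
    simp

/-- The condition on `f` holds for affine maps of simplices, which preserve barycenters. This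
naturality is what carries subdivision over to singular chains. -/
lemma tupleSd_map {bar' : ∀ q : ℕ, (Fin (q + 1) → T) → T} (f : S → T)
    (hf : ∀ (q : ℕ) (a : Fin (q + 1) → S), f (bar q a) = bar' q (f ∘ a)) {q : ℕ}
    (c : TupleChain F S q) :
    tupleSd F bar' q (tupleMap F f q c) = tupleMap F f q (tupleSd F bar q c) := by
  induction q with
  | zero => rfl
  | succ q ih =>
    refine tupleChain_ext (f := tupleSd F bar' (q + 1) ∘ₗ tupleMap F f (q + 1))
      (g := tupleMap F f (q + 1) ∘ₗ tupleSd F bar (q + 1)) (fun a => ?_) c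
    simp only [LinearMap.comp_apply]
    rw [tupleSd_single, tupleMap_join, hf, ← ih, ← tupleBoundary_map, tupleMap_single,
      tupleSd_single]

lemma tupleSdHomotopy_map {bar' : ∀ q : ℕ, (Fin (q + 1) → T) → T} (f : S → T)
    (hf : ∀ (q : ℕ) (a : Fin (q + 1) → S), f (bar q a) = bar' q (f ∘ a)) {q : ℕ}
    (c : TupleChain F S q) :
    tupleSdHomotopy F bar' q (tupleMap F f q c)
      = tupleMap F f (q + 1) (tupleSdHomotopy F bar q c) := by
  induction q with
  | zero => simp [tupleSdHomotopy]
  | succ q ih =>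
    refine tupleChain_ext (f := tupleSdHomotopy F bar' (q + 1) ∘ₗ tupleMap F f (q + 1))
      (g := tupleMap F f (q + 2) ∘ₗ tupleSdHomotopy F bar (q + 1)) (fun a => ?_) c
    simp only [LinearMap.comp_apply]
    rw [tupleSdHomotopy_single, tupleMap_join, hf]
    simp only [map_sub (tupleMap F f (q + 1))]
    rw [← ih, ← tupleBoundary_map, ← tupleSd_map bar f hf, tupleMap_single,
      tupleSdHomotopy_single]

end TupleChains

/-! ### Affine simplices -/

section Affine

/-- The standard topological simplex. -/
abbrev Delta (q : ℕ) := stdSimplex ℝ (Fin (q + 1))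

/-- The affine map of standard simplices with given values on the vertices. -/
def affMap {q r : ℕ} (a : Fin (q + 1) → Delta r) : C(Delta q, Delta r) where
  toFun t := ⟨fun j => ∑ i, t i * a i j,
    fun j => Finset.sum_nonneg fun i _ => mul_nonneg (t.2.1 i) ((a i).2.1 j), by
      rw [Finset.sum_comm]
      simp_rw [← Finset.mul_sum]
      simp⟩
  continuous_toFun := by
    refine Continuous.subtype_mk (continuous_pi fun j => continuous_finsetSum _ fun i _ => ?_) _
    exact ((continuous_apply i).comp continuous_subtype_val).mul continuous_const

lemma affMap_apply {q r : ℕ} (a : Fin (q + 1) → Delta r) (t : Delta q) (j : Fin (r + 1)) :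
    affMap a t j = ∑ i, t i * a i j := rfl

lemma affMap_map {p q r : ℕ} (a : Fin (q + 1) → Delta r) (f : Fin (p + 1) → Fin (q + 1))
    (t : Delta p) : affMap a (stdSimplex.map f t) = affMap (a ∘ f) t := by
  refine stdSimplex.ext (funext fun j => ?_)
  simp only [affMap_apply, stdSimplex.map_coe, FunOnFinite.linearMap_apply_apply, Finset.sum_mul]
  rw [← Finset.sum_fiberwise Finset.univ f]
  refine Finset.sum_congr rfl fun i _ => Finset.sum_congr rfl fun k hk => ?_
  rw [Function.comp, (Finset.mem_filter.1 hk).2]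

lemma affMap_affMap {p q r : ℕ} (a : Fin (q + 1) → Delta r) (b : Fin (p + 1) → Delta q)
    (t : Delta p) : affMap a (affMap b t) = affMap (affMap a ∘ b) t := by
  refine stdSimplex.ext (funext fun j => ?_)
  simp only [affMap_apply, Function.comp, Finset.sum_mul, Finset.mul_sum]
  rw [Finset.sum_comm]
  exact Finset.sum_congr rfl fun i _ => Finset.sum_congr rfl fun k _ => by ring

lemma affMap_vertices {q : ℕ} (t : Delta q) : affMap stdSimplex.vertex t = t := by
  refine stdSimplex.ext (funext fun j => ?_)
  simp [affMap_apply, Pi.single_apply]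

lemma affMap_vertex {q r : ℕ} (a : Fin (q + 1) → Delta r) (i : Fin (q + 1)) :
    affMap a (stdSimplex.vertex i) = a i := by
  refine stdSimplex.ext (funext fun j => ?_)
  simp [affMap_apply, Pi.single_apply]

lemma affMap_comp_vertex {q r : ℕ} (a : Fin (q + 1) → Delta r) :
    affMap a ∘ stdSimplex.vertex = a :=
  funext fun i => affMap_vertex a i

/-- The barycenter of a tuple. -/
def bary {r : ℕ} (q : ℕ) (a : Fin (q + 1) → Delta r) : Delta r := affMap a stdSimplex.barycenter

lemma affMap_bary {p r : ℕ} (a : Fin (p + 1) → Delta r) (q : ℕ) (b : Fin (q + 1) → Delta p) :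
    affMap a (bary q b) = bary q (affMap a ∘ b) :=
  affMap_affMap a b _

/-- Balls are convex, so a bound at the vertices holds on the whole affine simplex. -/
lemma dist_affMap_le {q r : ℕ} (a : Fin (q + 1) → Delta r) (x : Delta r) (d : ℝ)
    (h : ∀ i, dist x (a i) ≤ d) (t : Delta q) : dist x (affMap a t) ≤ d := by
  have h1 : (affMap a t).1 ∈ Metric.closedBall x.1 d := by
    have : (affMap a t).1 = ∑ i, t i • (a i).1 := by
      funext j
      simp only [Finset.sum_apply, Pi.smul_apply, smul_eq_mul]
      rfl
    rw [this]
    refine (convex_closedBall (x.1 : Fin (r + 1) → ℝ) d).sum_mem (fun i _ => t.2.1 i) t.2.2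
      fun i _ => ?_
    rw [Metric.mem_closedBall, dist_comm]
    exact h i
  rw [dist_comm]
  exact h1

/-- The difference is the average of the `q + 1` vectors `a i - a k`, one of which is zero; the
other `q` have norm at most `d`. -/
lemma dist_bary_le {q r : ℕ} (a : Fin (q + 1) → Delta r) (d : ℝ)
    (h : ∀ i j, dist (a i) (a j) ≤ d) (k : Fin (q + 1)) :
    dist (bary q a) (a k) ≤ q / (q + 1) * d := by
  have h0 : (0 : ℝ) < q + 1 := by positivity
  have hsub : (bary q a).1 - (a k).1
      = ∑ i : Fin (q + 1), ((q : ℝ) + 1)⁻¹ • ((a i).1 - (a k).1 : Fin (r + 1) → ℝ) := by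
    funext j
    simp only [Pi.sub_apply, Finset.sum_apply, Pi.smul_apply, smul_eq_mul, mul_sub,
      Finset.sum_sub_distrib, Finset.sum_const, Finset.card_univ, Fintype.card_fin]
    have : (bary q a).1 j = ∑ i, ((q : ℝ) + 1)⁻¹ * (a i).1 j := by
      refine (affMap_apply a stdSimplex.barycenter j).trans (Finset.sum_congr rfl fun i _ => ?_)
      congr 1
      change ((Fintype.card (Fin (q + 1)) : ℝ))⁻¹ = _
      simp
    rw [this, nsmul_eq_mul]
    push_cast
    field_simp
  have h1 : dist (bary q a) (a k) = ‖((bary q a).1 - (a k).1 : Fin (r + 1) → ℝ)‖ :=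
    (Subtype.dist_eq _ _).trans (dist_eq_norm _ _)
  rw [h1, hsub]
  have h2 : ∀ i ∈ Finset.univ, ‖((q : ℝ) + 1)⁻¹ • ((a i).1 - (a k).1)‖
      ≤ if i = k then 0 else ((q : ℝ) + 1)⁻¹ * d := by
    intro i _
    split_ifs with hi
    · simp [hi]
    · rw [norm_smul, norm_inv, Real.norm_of_nonneg h0.le, ← dist_eq_norm,
        ← Subtype.dist_eq]
      exact mul_le_mul_of_nonneg_left (h i k) (by positivity)
  refine (norm_sum_le_of_le _ h2).trans (le_of_eq ?_)
  rw [Finset.sum_ite, Finset.sum_const_zero, Finset.sum_const, zero_add,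
    Finset.filter_ne' Finset.univ k, Finset.card_erase_of_mem (Finset.mem_univ k)]
  simp
  field_simp

/-- The tuples in the subdivision of a tuple of diameter at most `d` lie in its convex hull and have
diameter at most `q / (q + 1) d`. -/
lemma tupleSd_mem {F : Type*} [Field F] {q r : ℕ} (a : Fin (q + 1) → Delta r) (d : ℝ)
    (h : ∀ i j, dist (a i) (a j) ≤ d) :
    tupleSd F bary q (Finsupp.single a 1) ∈ Finsupp.supported F F
      {w : Fin (q + 1) → Delta r | (∀ i, w i ∈ Set.range (affMap a)) ∧
        ∀ i j, dist (w i) (w j) ≤ q / (q + 1) * d} := by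
  have hd : 0 ≤ d := dist_nonneg.trans (h 0 0)
  induction q with
  | zero =>
    refine Finsupp.single_mem_supported F _ ⟨fun i => ⟨_, affMap_vertex a i⟩, fun i j => ?_⟩
    rw [Subsingleton.elim (α := Fin 1) i j, dist_self]
    simp
  | succ q ih =>
    rw [tupleSd_single, tupleBoundary_single, map_sum, map_sum]
    refine Submodule.sum_mem _ fun k _ => ?_
    have h1 := ih (a ∘ k.succAbove) fun i j => h _ _
    rw [← Finsupp.smul_single_one, map_smul, map_smul]
    refine Submodule.smul_mem _ _ ?_
    refine map_mem_of_mem_supported ?_ h1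
    rintro w ⟨hw1, hw2⟩
    rw [tupleJoin_single]
    have hw3 : ∀ i, w i ∈ Set.range (affMap a) := by
      intro i
      obtain ⟨t, ht⟩ := hw1 i
      exact ⟨_, (affMap_map a _ t).trans ht⟩
    -- The ratio `q / (q + 1)` increases with `q`, so the bound for the faces is good enough.
    have hle : (q : ℝ) / (q + 1) * d ≤ ((q + 1 : ℕ) : ℝ) / ((q + 1 : ℕ) + 1) * d := by
      refine mul_le_mul_of_nonneg_right ?_ hd
      rw [div_le_div_iff₀ (by positivity) (by positivity)]
      push_cast
      nlinarith
    -- The old vertices lie in the convex hull of `a`, all of whose points are as close to the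
    -- barycenter as the vertices of `a` are required to be.
    have hb : ∀ i, dist (bary (q + 1) a) (w i) ≤ ((q + 1 : ℕ) : ℝ) / ((q + 1 : ℕ) + 1) * d := by
      intro i
      obtain ⟨t, ht⟩ := hw3 i
      rw [← ht]
      exact dist_affMap_le _ _ _ (dist_bary_le a d h) t
    refine Finsupp.single_mem_supported F _ ⟨fun i => ?_, fun i j => ?_⟩
    · refine Fin.cases ?_ (fun i => ?_) i
      · exact ⟨_, rfl⟩
      · exact hw3 i
    · refine Fin.cases ?_ (fun i => ?_) i <;> refine Fin.cases ?_ (fun j => ?_) j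
      · rw [dist_self]; positivity
      · exact hb j
      · rw [dist_comm]; exact hb i
      · exact (hw2 i j).trans hle

/-- The iterated subdivisions consist of tuples of small diameter. -/
lemma tupleSd_iterate_mem (F : Type*) [Field F] (q r m : ℕ) (a : Fin (q + 1) → Delta r) (d : ℝ)
    (h : ∀ i j, dist (a i) (a j) ≤ d) :
    (tupleSd F bary q ^ m) (Finsupp.single a 1) ∈ Finsupp.supported F F
      {w : Fin (q + 1) → Delta r | ∀ i j, dist (w i) (w j) ≤ (q / (q + 1) : ℝ) ^ m * d} := by
  induction m with
  | zero => exact Finsupp.single_mem_supported F _ (by simpa using h)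
  | succ m ih =>
    rw [pow_succ' (tupleSd F bary q), Module.End.mul_apply]
    refine map_mem_of_mem_supported (fun w hw => ?_) ih
    refine Finsupp.supported_mono ?_ (tupleSd_mem w _ hw)
    rintro w' ⟨-, hw'⟩ i j
    rw [pow_succ', mul_assoc]
    exact hw' i j

end Affine

/-! ### Singular chains -/

section SingularChains

variable {F : Type v} [Field F] {X : Type u} [TopologicalSpace X]

/-- The restriction of a singular simplex to an affine simplex. -/
def Simplex.aff {q r : ℕ} (σ : Simplex X r) (a : Fin (q + 1) → Delta r) : Simplex X q :=
  σ.comp (affMap a)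

lemma Simplex.aff_aff {p q r : ℕ} (σ : Simplex X r) (a : Fin (q + 1) → Delta r)
    (b : Fin (p + 1) → Delta q) : (σ.aff a).aff b = σ.aff (affMap a ∘ b) := by
  ext t
  exact congrArg σ (affMap_affMap a b t)

lemma Simplex.aff_vertex {q : ℕ} (σ : Simplex X q) : σ.aff stdSimplex.vertex = σ := by
  ext t
  exact congrArg σ (affMap_vertices t)

lemma Simplex.aff_face {q r : ℕ} (σ : Simplex X r) (a : Fin (q + 2) → Delta r) (i : Fin (q + 2)) :
    (σ.aff a).face i = σ.aff (a ∘ i.succAbove) := by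
  ext t
  exact congrArg σ (affMap_map a _ t)

lemma Simplex.range_aff {q r : ℕ} (σ : Simplex X r) (a : Fin (q + 1) → Delta r) :
    Set.range (σ.aff a) ⊆ Set.range σ := by
  rintro _ ⟨t, rfl⟩
  exact ⟨_, rfl⟩

lemma boundary_single {q : ℕ} (σ : Simplex X (q + 1)) :
    boundary F X q (Finsupp.single σ 1)
      = ∑ i : Fin (q + 2), Finsupp.single (σ.face i) ((-1 : F) ^ (i : ℕ)) := by
  simp [boundary]

lemma chain_ext {q : ℕ} {W : Type*} [AddCommGroup W] [Module F W] {f g : Chain F X q →ₗ[F] W}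
    (h : ∀ σ, f (Finsupp.single σ 1) = g (Finsupp.single σ 1)) (c : Chain F X q) : f c = g c :=
  LinearMap.congr_fun (Finsupp.lhom_ext' fun σ => LinearMap.ext_ring (h σ)) c

/-- A linear map takes chains in `U` to `W` if it does so for simplices. -/
lemma chainsIn_le_comap {q : ℕ} {U : Set X} {W : Type*} [AddCommGroup W] [Module F W]
    {f : Chain F X q →ₗ[F] W} {N : Submodule F W}
    (h : ∀ σ : Simplex X q, Set.range σ ⊆ U → f (Finsupp.single σ 1) ∈ N) {c : Chain F X q}
    (hc : c ∈ chainsIn F U q) : f c ∈ N :=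
  map_mem_of_mem_supported h hc

lemma single_mem_chainsIn {q : ℕ} {U : Set X} {σ : Simplex X q} (h : Set.range σ ⊆ U) (c : F) :
    Finsupp.single σ c ∈ chainsIn F U q :=
  Finsupp.single_mem_supported F c h

lemma boundary_mem_chainsIn {q : ℕ} {U : Set X} {c : Chain F X (q + 1)}
    (hc : c ∈ chainsIn F U (q + 1)) : boundary F X q c ∈ chainsIn F U q := by
  refine chainsIn_le_comap (fun σ hσ => ?_) hc
  rw [boundary_single]
  exact Submodule.sum_mem _ fun i _ => single_mem_chainsIn ((σ.range_pull _).trans hσ) _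

variable (F) in
/-- A singular simplex as a map from tuple chains to singular chains. -/
def realize {r : ℕ} (σ : Simplex X r) (q : ℕ) : TupleChain F (Delta r) q →ₗ[F] Chain F X q :=
  Finsupp.lmapDomain F F σ.aff

lemma realize_single {q r : ℕ} (σ : Simplex X r) (a : Fin (q + 1) → Delta r) (c : F) :
    realize F σ q (Finsupp.single a c) = Finsupp.single (σ.aff a) c := by
  simp [realize]

lemma boundary_realize {q r : ℕ} (σ : Simplex X r) (c : TupleChain F (Delta r) (q + 1)) :
    boundary F X q (realize F σ (q + 1) c) = realize F σ q (tupleBoundary F (Delta r) q c) := by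
  refine tupleChain_ext (f := boundary F X q ∘ₗ realize F σ (q + 1))
    (g := realize F σ q ∘ₗ tupleBoundary F (Delta r) q) (fun a => ?_) c
  simp only [LinearMap.comp_apply, realize_single, boundary_single, tupleBoundary_single, map_sum,
    Simplex.aff_face]

lemma realize_aff {p q r : ℕ} (σ : Simplex X r) (a : Fin (q + 1) → Delta r)
    (c : TupleChain F (Delta q) p) :
    realize F (σ.aff a) p c = realize F σ p (tupleMap F (affMap a) p c) := by
  refine tupleChain_ext (f := realize F (σ.aff a) p)
    (g := realize F σ p ∘ₗ tupleMap F (affMap a) p) (fun b => ?_) c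
  simp only [LinearMap.comp_apply, realize_single, tupleMap_single, Simplex.aff_aff]

lemma realize_vertex {q : ℕ} (σ : Simplex X q) (c : F) :
    realize F σ q (Finsupp.single stdSimplex.vertex c) = Finsupp.single σ c := by
  rw [realize_single, Simplex.aff_vertex]

lemma realize_mem_chainsIn {q r : ℕ} (σ : Simplex X r) {U : Set X} (h : Set.range σ ⊆ U)
    (c : TupleChain F (Delta r) q) : realize F σ q c ∈ chainsIn F U q := by
  induction c using Finsupp.induction_linear with
  | zero => simp
  | add x y hx hy => rw [map_add]; exact Submodule.add_mem _ hx hy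
  | single a c =>
    rw [realize_single]
    exact single_mem_chainsIn ((σ.range_aff a).trans h) c

/-- The operator on singular chains given by a natural operator on tuple chains. -/
def chainOp {p : ℕ} (q : ℕ)
    (Θ : ∀ r : ℕ, TupleChain F (Delta r) p →ₗ[F] TupleChain F (Delta r) q) :
    Chain F X p →ₗ[F] Chain F X q :=
  Finsupp.linearCombination F fun σ => realize F σ q (Θ p (Finsupp.single stdSimplex.vertex 1))

/-- The operator is defined by its effect on the tuple of vertices of a standard simplex. Every
tuple `a` is the image of that tuple under `affMap a`, so naturality determines the rest. -/
lemma chainOp_realize {p q r : ℕ}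
    (Θ : ∀ r : ℕ, TupleChain F (Delta r) p →ₗ[F] TupleChain F (Delta r) q)
    (h : ∀ (s r : ℕ) (a : Fin (s + 1) → Delta r) (c : TupleChain F (Delta s) p),
      Θ r (tupleMap F (affMap a) p c) = tupleMap F (affMap a) q (Θ s c))
    (σ : Simplex X r) (c : TupleChain F (Delta r) p) :
    chainOp q Θ (realize F σ p c) = realize F σ q (Θ r c) := by
  refine tupleChain_ext (f := chainOp q Θ ∘ₗ realize F σ p) (g := realize F σ q ∘ₗ Θ r)
    (fun a => ?_) c
  simp only [LinearMap.comp_apply, realize_single, chainOp, Finsupp.linearCombination_single,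
    one_smul]
  rw [realize_aff, ← h, tupleMap_single, affMap_comp_vertex]

lemma chainOp_mem {p q : ℕ}
    (Θ : ∀ r : ℕ, TupleChain F (Delta r) p →ₗ[F] TupleChain F (Delta r) q) {U : Set X}
    {c : Chain F X p} (hc : c ∈ chainsIn F U p) : chainOp q Θ c ∈ chainsIn F U q := by
  refine chainsIn_le_comap (fun σ hσ => ?_) hc
  simp only [chainOp, Finsupp.linearCombination_single, one_smul]
  exact realize_mem_chainsIn σ hσ _

variable (F X) in
/-- Barycentric subdivision of singular chains. -/
def chainSd (q : ℕ) : Chain F X q →ₗ[F] Chain F X q :=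
  chainOp q fun _ => tupleSd F bary q

variable (F X) in
/-- The chain homotopy between the identity and subdivision. -/
def chainSdHomotopy (q : ℕ) : Chain F X q →ₗ[F] Chain F X (q + 1) :=
  chainOp (q + 1) fun _ => tupleSdHomotopy F bary q

lemma chainSd_realize {q r : ℕ} (σ : Simplex X r) (c : TupleChain F (Delta r) q) :
    chainSd F X q (realize F σ q c) = realize F σ q (tupleSd F bary q c) :=
  chainOp_realize _ (fun _ _ a c => tupleSd_map bary (affMap a) (affMap_bary a) c) σ c

lemma chainSdHomotopy_realize {q r : ℕ} (σ : Simplex X r) (c : TupleChain F (Delta r) q) :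
    chainSdHomotopy F X q (realize F σ q c) = realize F σ (q + 1) (tupleSdHomotopy F bary q c) :=
  chainOp_realize _ (fun _ _ a c => tupleSdHomotopy_map bary (affMap a) (affMap_bary a) c) σ c

lemma boundary_chainSd {q : ℕ} (c : Chain F X (q + 1)) :
    boundary F X q (chainSd F X (q + 1) c) = chainSd F X q (boundary F X q c) := by
  refine chain_ext (f := boundary F X q ∘ₗ chainSd F X (q + 1))
    (g := chainSd F X q ∘ₗ boundary F X q) (fun σ => ?_) c
  simp only [LinearMap.comp_apply]
  rw [← realize_vertex σ, chainSd_realize, boundary_realize, boundary_realize, chainSd_realize,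
    tupleBoundary_sd]

lemma boundary_chainSdHomotopy {q : ℕ} (c : Chain F X (q + 1)) :
    boundary F X (q + 1) (chainSdHomotopy F X (q + 1) c)
      = c - chainSd F X (q + 1) c - chainSdHomotopy F X q (boundary F X q c) := by
  refine chain_ext (f := boundary F X (q + 1) ∘ₗ chainSdHomotopy F X (q + 1))
    (g := LinearMap.id - chainSd F X (q + 1) - chainSdHomotopy F X q ∘ₗ boundary F X q)
    (fun σ => ?_) c
  simp only [LinearMap.comp_apply, LinearMap.sub_apply, LinearMap.id_apply]
  rw [← realize_vertex σ, chainSd_realize, boundary_realize, chainSdHomotopy_realize,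
    boundary_realize, chainSdHomotopy_realize, tupleBoundary_sdHomotopy, map_sub, map_sub]

lemma boundary_boundary {q : ℕ} (c : Chain F X (q + 2)) :
    boundary F X q (boundary F X (q + 1) c) = 0 := by
  refine chain_ext (f := boundary F X q ∘ₗ boundary F X (q + 1)) (g := 0) (fun σ => ?_) c
  simp only [LinearMap.comp_apply, LinearMap.zero_apply]
  rw [← realize_vertex σ, boundary_realize, boundary_realize, tupleBoundary_boundary, map_zero]

/-- Iterated subdivisions of a simplex in the union of two open sets are sums of simplices which
are contained in one of them. -/
lemma exists_chainSd_iterate_single_mem {U V : Set X} (hU : IsOpen U) (hV : IsOpen V) {q : ℕ}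
    (σ : Simplex X q) (hσ : Set.range σ ⊆ U ∪ V) :
    ∃ m : ℕ, (chainSd F X q ^ m) (Finsupp.single σ 1) ∈ chainsIn F U q ⊔ chainsIn F V q := by
  have hcov : (Set.univ : Set (Delta q)) ⊆ ⋃ b : Bool, σ ⁻¹' (bif b then U else V) := by
    intro t _
    rcases hσ ⟨t, rfl⟩ with h | h
    · exact Set.mem_iUnion.2 ⟨true, h⟩
    · exact Set.mem_iUnion.2 ⟨false, h⟩
  -- A Lebesgue number of the cover of the standard simplex by the preimages of `U` and `V`.
  obtain ⟨δ, hδ, hleb⟩ := lebesgue_number_lemma_of_metric isCompact_univ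
    (fun b : Bool => by cases b <;> exact IsOpen.preimage σ.continuous ‹_›) hcov
  have hlt : (q / (q + 1) : ℝ) < 1 := by
    rw [div_lt_one (by positivity)]
    linarith
  -- The standard simplex lies in the unit ball about the origin, so it has diameter at most `2`;
  -- after `m` subdivisions the diameters are below `2 * (δ / 2) = δ`.
  obtain ⟨m, hm⟩ := exists_pow_lt_of_lt_one (show 0 < δ / 2 by positivity) hlt
  have hd : ∀ x y : Delta q, dist x y ≤ 2 := by
    intro x y
    have h1 := stdSimplex_subset_closedBall x.2
    have h2 := stdSimplex_subset_closedBall y.2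
    have h3 := dist_triangle_right x.1 y.1 0
    rw [Metric.mem_closedBall] at h1 h2
    calc dist x y = dist x.1 y.1 := rfl
      _ ≤ 2 := by linarith
  refine ⟨m, ?_⟩
  have hpow : ∀ c : TupleChain F (Delta q) q, (chainSd F X q ^ m) (realize F σ q c)
      = realize F σ q ((tupleSd F bary q ^ m) c) := by
    clear hm
    induction m with
    | zero => intro c; rfl
    | succ m ih =>
      intro c
      rw [pow_succ', Module.End.mul_apply, ih, chainSd_realize, pow_succ', Module.End.mul_apply]
  rw [← realize_vertex σ, hpow]
  refine map_mem_of_mem_supported (fun w hw => ?_)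
    (tupleSd_iterate_mem F q q m stdSimplex.vertex 2 fun i j => hd _ _)
  rw [realize_single]
  obtain ⟨b, hb⟩ := hleb (w 0) (Set.mem_univ _)
  have hr : Set.range (σ.aff w) ⊆ bif b then U else V := by
    rintro _ ⟨t, rfl⟩
    refine hb ?_
    rw [Metric.mem_ball, dist_comm]
    refine (dist_affMap_le w (w 0) _ (hw 0) t).trans_lt ?_
    linarith
  cases b
  · exact Submodule.mem_sup_right (single_mem_chainsIn hr 1)
  · exact Submodule.mem_sup_left (single_mem_chainsIn hr 1)

lemma chainSd_mem {q : ℕ} {U : Set X} {c : Chain F X q} (hc : c ∈ chainsIn F U q) :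
    chainSd F X q c ∈ chainsIn F U q :=
  chainOp_mem _ hc

lemma chainSdHomotopy_mem {q : ℕ} {U : Set X} {c : Chain F X q} (hc : c ∈ chainsIn F U q) :
    chainSdHomotopy F X q c ∈ chainsIn F U (q + 1) :=
  chainOp_mem _ hc

lemma map_mem_sup {V W : Type*} [AddCommGroup V] [Module F V] [AddCommGroup W] [Module F W]
    {f : V →ₗ[F] W} {A B : Submodule F V} {A' B' : Submodule F W} (hA : ∀ x ∈ A, f x ∈ A')
    (hB : ∀ x ∈ B, f x ∈ B') {x : V} (hx : x ∈ A ⊔ B) : f x ∈ A' ⊔ B' := by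
  obtain ⟨a, ha, b, hb, rfl⟩ := Submodule.mem_sup.1 hx
  rw [map_add]
  exact Submodule.add_mem_sup (hA a ha) (hB b hb)

lemma chainSd_pow_mem_sup {q : ℕ} {U V : Set X} {c : Chain F X q}
    (hc : c ∈ chainsIn F U q ⊔ chainsIn F V q) (m : ℕ) :
    (chainSd F X q ^ m) c ∈ chainsIn F U q ⊔ chainsIn F V q := by
  induction m with
  | zero => exact hc
  | succ m ih =>
    rw [pow_succ', Module.End.mul_apply]
    exact map_mem_sup (fun _ => chainSd_mem) (fun _ => chainSd_mem) ih

lemma exists_chainSd_iterate_mem {U V : Set X} (hU : IsOpen U) (hV : IsOpen V) {q : ℕ}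
    {c : Chain F X q} (hc : c ∈ chainsIn F (U ∪ V) q) :
    ∃ m : ℕ, (chainSd F X q ^ m) c ∈ chainsIn F U q ⊔ chainsIn F V q := by
  rw [chainsIn, Finsupp.supported_eq_span_single] at hc
  induction hc using Submodule.span_induction with
  | mem c hc =>
    obtain ⟨σ, hσ, rfl⟩ := hc
    exact exists_chainSd_iterate_single_mem hU hV σ hσ
  | zero => exact ⟨0, Submodule.zero_mem _⟩
  | add a b _ _ ha hb =>
    obtain ⟨m, hm⟩ := ha
    obtain ⟨k, hk⟩ := hb
    -- Further subdivision preserves a splitting, so one exponent serves both summands.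
    refine ⟨k + m, ?_⟩
    rw [map_add]
    refine Submodule.add_mem _ ?_ ?_
    · rw [pow_add, Module.End.mul_apply]
      exact chainSd_pow_mem_sup hm k
    · rw [add_comm, pow_add, Module.End.mul_apply]
      exact chainSd_pow_mem_sup hk m
  | smul r a _ ha =>
    obtain ⟨m, hm⟩ := ha
    exact ⟨m, by rw [map_smul]; exact Submodule.smul_mem _ r hm⟩

/-- A chain in `U ∪ V` whose boundary is a sum of chains in `U` and in `V` is homologous to a sum
of chains in `U` and in `V`. -/
lemma exists_split {U V : Set X} (hU : IsOpen U) (hV : IsOpen V) {q : ℕ} {c : Chain F X (q + 1)}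
    (hc : c ∈ chainsIn F (U ∪ V) (q + 1))
    (hb : boundary F X q c ∈ chainsIn F U q ⊔ chainsIn F V q) :
    ∃ a ∈ chainsIn F U (q + 1), ∃ b ∈ chainsIn F V (q + 1), ∃ y ∈ chainsIn F (U ∪ V) (q + 2),
      c = a + b + boundary F X (q + 1) y := by
  obtain ⟨m, hm⟩ := exists_chainSd_iterate_mem hU hV hc
  induction m generalizing c with
  | zero =>
    obtain ⟨a, ha, b, hb, h⟩ := Submodule.mem_sup.1 hm
    exact ⟨a, ha, b, hb, 0, Submodule.zero_mem _, by rw [map_zero, add_zero]; exact h.symm⟩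
  | succ m ih =>
    -- Induction on the number of subdivisions: `c - Sd c` is the boundary of `T c` plus `T ∂c`, and
    -- `T ∂c` splits because `∂c` does and `T` preserves supports.
    have h1 := boundary_chainSdHomotopy c
    obtain ⟨a, ha, b, hb', y, hy, h⟩ := ih (chainSd_mem hc)
      (by rw [boundary_chainSd]
          exact map_mem_sup (fun _ => chainSd_mem) (fun _ => chainSd_mem) hb)
      (by rwa [← Module.End.mul_apply, ← pow_succ])
    obtain ⟨a', ha', b', hb'', h'⟩ := Submodule.mem_sup.1
      (map_mem_sup (f := chainSdHomotopy F X q) (fun _ => chainSdHomotopy_mem)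
        (fun _ => chainSdHomotopy_mem) hb)
    refine ⟨a + a', Submodule.add_mem _ ha ha', b + b', Submodule.add_mem _ hb' hb'',
      y + chainSdHomotopy F X (q + 1) c, Submodule.add_mem _ hy (chainSdHomotopy_mem hc), ?_⟩
    rw [map_add, h1, ← h', h]
    abel

/-- A connected `0`-simplex in `U ∪ V` lies in `U` or in `V`. -/
lemma chainsIn_union_zero (U V : Set X) :
    chainsIn F (U ∪ V) 0 = chainsIn F U 0 ⊔ chainsIn F V 0 := by
  refine le_antisymm ?_ (sup_le (chainsIn_mono Set.subset_union_left 0)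
    (chainsIn_mono Set.subset_union_right 0))
  rw [chainsIn, Finsupp.supported_eq_span_single, Submodule.span_le]
  rintro _ ⟨σ, hσ, rfl⟩
  have hr : Set.range σ ⊆ {σ default} := by
    rintro _ ⟨t, rfl⟩
    rw [Subsingleton.elim t default]
    rfl
  rcases hσ ⟨default, rfl⟩ with h | h
  · exact Submodule.mem_sup_left (single_mem_chainsIn (hr.trans (Set.singleton_subset_iff.2 h)) 1)
  · exact Submodule.mem_sup_right (single_mem_chainsIn (hr.trans (Set.singleton_subset_iff.2 h)) 1)

end SingularChains

/-! ### Homotopy invariance -/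

section TupleHomotopy

variable {F : Type*} [Field F] {S T E : Type*}

/-- The prism over a tuple, as a chain in the product with `E`. -/
def tuplePrismChain (F : Type*) [Field F] {S E : Type*} (e₀ e₁ : E) :
    (q : ℕ) → TupleChain F S q →ₗ[F] TupleChain F (S × E) (q + 1)
  | 0 => Finsupp.linearCombination F fun a : Fin 1 → S =>
      tupleJoin F (a 0, e₀) 0 (tupleMap F (·, e₁) 0 (Finsupp.single a 1))
  | q + 1 => Finsupp.linearCombination F fun a : Fin (q + 2) → S =>
      tupleJoin F (a 0, e₀) (q + 1) (tupleMap F (·, e₁) (q + 1) (Finsupp.single a 1)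
        - tuplePrismChain F e₀ e₁ q (Finsupp.single (Fin.tail a) 1))

variable (e₀ e₁ : E)

lemma tuplePrismChain_zero (a : Fin 1 → S) :
    tuplePrismChain F e₀ e₁ 0 (Finsupp.single a 1)
      = tupleJoin F (a 0, e₀) 0 (tupleMap F (·, e₁) 0 (Finsupp.single a 1)) := by
  simp [tuplePrismChain]

lemma tuplePrismChain_single {q : ℕ} (a : Fin (q + 2) → S) :
    tuplePrismChain F e₀ e₁ (q + 1) (Finsupp.single a 1)
      = tupleJoin F (a 0, e₀) (q + 1) (tupleMap F (·, e₁) (q + 1) (Finsupp.single a 1)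
        - tuplePrismChain F e₀ e₁ q (Finsupp.single (Fin.tail a) 1)) := by
  simp [tuplePrismChain]

/-- The prism over a cone is again a cone, with apex the copy of `s` at the end `e₀`. This reduces
the boundary of a prism to the cone formula. -/
lemma tuplePrismChain_join {q : ℕ} (s : S) (c : TupleChain F S q) :
    tuplePrismChain F e₀ e₁ (q + 1) (tupleJoin F s q c)
      = tupleJoin F (s, e₀) (q + 1) (tupleMap F (·, e₁) (q + 1) (tupleJoin F s q c)
        - tuplePrismChain F e₀ e₁ q c) := by
  refine tupleChain_ext (f := tuplePrismChain F e₀ e₁ (q + 1) ∘ₗ tupleJoin F s q)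
    (g := tupleJoin F (s, e₀) (q + 1) ∘ₗ (tupleMap F (·, e₁) (q + 1) ∘ₗ tupleJoin F s q
        - tuplePrismChain F e₀ e₁ q)) (fun a => ?_) c
  simp only [LinearMap.comp_apply, LinearMap.sub_apply]
  rw [tupleJoin_single, tuplePrismChain_single, Fin.cons_zero, Fin.tail_cons]

lemma tupleBoundary_prism_zero (c : TupleChain F S 0) :
    tupleBoundary F (S × E) 0 (tuplePrismChain F e₀ e₁ 0 c)
      = tupleMap F (·, e₁) 0 c - tupleMap F (·, e₀) 0 c := by
  refine tupleChain_ext (f := tupleBoundary F (S × E) 0 ∘ₗ tuplePrismChain F e₀ e₁ 0)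
    (g := tupleMap F (·, e₁) 0 - tupleMap F (·, e₀) 0) (fun a => ?_) c
  simp only [LinearMap.comp_apply, LinearMap.sub_apply]
  rw [tuplePrismChain_zero, tupleBoundary_join_zero, tupleMap_single, tupleMap_single]
  congr 1
  have : (fun _ => (a 0, e₀) : Fin 1 → S × E) = (·, e₀) ∘ a := by
    funext i
    rw [Subsingleton.elim (α := Fin 1) i 0]
    rfl
  rw [this]
  simp [tupleAug]

/-- Every tuple is a cone, so the boundary is computed by the cone formula and induction. The first
case is separate because the boundary of a cone over a `0`-chain contains an augmentation term. -/
lemma tupleBoundary_prism {q : ℕ} (c : TupleChain F S (q + 1)) :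
    tupleBoundary F (S × E) (q + 1) (tuplePrismChain F e₀ e₁ (q + 1) c)
      = tupleMap F (·, e₁) (q + 1) c - tupleMap F (·, e₀) (q + 1) c
        - tuplePrismChain F e₀ e₁ q (tupleBoundary F S q c) := by
  refine tupleChain_ext
    (f := tupleBoundary F (S × E) (q + 1) ∘ₗ tuplePrismChain F e₀ e₁ (q + 1))
    (g := tupleMap F (·, e₁) (q + 1) - tupleMap F (·, e₀) (q + 1)
      - tuplePrismChain F e₀ e₁ q ∘ₗ tupleBoundary F S q) (fun a => ?_) c
  simp only [LinearMap.comp_apply, LinearMap.sub_apply]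
  obtain ⟨s, b, rfl⟩ : ∃ s b, a = Fin.cons s b := ⟨a 0, Fin.tail a, (Fin.cons_self_tail a).symm⟩
  rw [← tupleJoin_single, tuplePrismChain_join, tupleBoundary_join, map_sub, tupleBoundary_map,
    tupleMap_join (·, e₀)]
  cases q with
  | zero =>
    rw [tupleBoundary_prism_zero, tupleBoundary_join_zero]
    have h : tupleAug F S (Finsupp.single b 1) = 1 := by simp [tupleAug]
    rw [h, one_smul, map_sub (tuplePrismChain F e₀ e₁ 0), tuplePrismChain_zero e₀ e₁ fun _ => s]
    simp only [map_sub]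
    abel
  | succ q =>
    rw [tupleBoundary_prism (q := q), tupleBoundary_join,
      map_sub (tuplePrismChain F e₀ e₁ (q + 1)), tuplePrismChain_join]
    simp only [map_sub]
    abel

lemma tuplePrismChain_map (f : S → T) {q : ℕ} (c : TupleChain F S q) :
    tuplePrismChain F e₀ e₁ q (tupleMap F f q c)
      = tupleMap F (Prod.map f id) (q + 1) (tuplePrismChain F e₀ e₁ q c) := by
  refine tupleChain_ext (f := tuplePrismChain F e₀ e₁ q ∘ₗ tupleMap F f q)
    (g := tupleMap F (Prod.map f id) (q + 1) ∘ₗ tuplePrismChain F e₀ e₁ q) (fun a => ?_) c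
  simp only [LinearMap.comp_apply]
  cases q with
  | zero =>
    rw [tupleMap_single, tuplePrismChain_zero, tuplePrismChain_zero, tupleMap_join,
      tupleMap_single, tupleMap_single, tupleMap_single]
    rfl
  | succ q =>
    have ht : Fin.tail (f ∘ a) = f ∘ Fin.tail a := rfl
    rw [tupleMap_single, tuplePrismChain_single, tuplePrismChain_single, tupleMap_join,
      map_sub (tupleMap F (Prod.map f id) (q + 1)), ← tuplePrismChain_map, tupleMap_single,
      tupleMap_single, tupleMap_single, tupleMap_single, ht]
    rfl

end TupleHomotopy
-- Prism operators on singular chains.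
section Homotopy

variable {F : Type v} [Field F] {X Y : Type*} [TopologicalSpace X] [TopologicalSpace Y]

variable (F) in
/-- The map on singular chains induced by a continuous map. -/
def chainMap (f : C(X, Y)) (q : ℕ) : Chain F X q →ₗ[F] Chain F Y q :=
  Finsupp.lmapDomain F F fun σ : Simplex X q => f.comp σ

lemma chainMap_single (f : C(X, Y)) {q : ℕ} (σ : Simplex X q) (c : F) :
    chainMap F f q (Finsupp.single σ c) = Finsupp.single (f.comp σ : Simplex Y q) c := by
  simp [chainMap]

lemma boundary_chainMap (f : C(X, Y)) {q : ℕ} (c : Chain F X (q + 1)) :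
    boundary F Y q (chainMap F f (q + 1) c) = chainMap F f q (boundary F X q c) := by
  refine chain_ext (f := boundary F Y q ∘ₗ chainMap F f (q + 1))
    (g := chainMap F f q ∘ₗ boundary F X q) (fun σ => ?_) c
  simp only [LinearMap.comp_apply, chainMap_single, boundary_single, map_sum]
  rfl

lemma chainMap_mem (f : C(X, Y)) {q : ℕ} {U : Set X} {V : Set Y} (h : Set.MapsTo f U V)
    {c : Chain F X q} (hc : c ∈ chainsIn F U q) : chainMap F f q c ∈ chainsIn F V q := by
  refine chainsIn_le_comap (fun σ hσ => ?_) hc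
  rw [chainMap_single]
  refine single_mem_chainsIn ?_ 1
  rintro _ ⟨t, rfl⟩
  exact h (hσ ⟨t, rfl⟩)

variable (H : C(X × Delta 1, Y))

/-- An affine simplex in a prism, mapped to `Y` by a homotopy. -/
def prismSimplex {p q : ℕ} (σ : Simplex X p) (w : Fin (q + 1) → Delta p × Delta 1) :
    Simplex Y q :=
  H.comp (ContinuousMap.prodMk (σ.aff (Prod.fst ∘ w)) (affMap (Prod.snd ∘ w)))

variable (F) in
/-- A prism, as a map from tuple chains to singular chains. -/
def prismRealize {p : ℕ} (σ : Simplex X p) (q : ℕ) :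
    TupleChain F (Delta p × Delta 1) q →ₗ[F] Chain F Y q :=
  Finsupp.lmapDomain F F (prismSimplex H σ)

lemma prismRealize_single {p q : ℕ} (σ : Simplex X p) (w : Fin (q + 1) → Delta p × Delta 1)
    (c : F) : prismRealize F H σ q (Finsupp.single w c)
      = Finsupp.single (prismSimplex H σ w) c := by
  simp [prismRealize]

lemma boundary_prismRealize {p q : ℕ} (σ : Simplex X p)
    (c : TupleChain F (Delta p × Delta 1) (q + 1)) :
    boundary F Y q (prismRealize F H σ (q + 1) c)
      = prismRealize F H σ q (tupleBoundary F _ q c) := by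
  refine tupleChain_ext (f := boundary F Y q ∘ₗ prismRealize F H σ (q + 1))
    (g := prismRealize F H σ q ∘ₗ tupleBoundary F _ q) (fun w => ?_) c
  simp only [LinearMap.comp_apply, prismRealize_single, boundary_single, tupleBoundary_single,
    map_sum]
  refine Finset.sum_congr rfl fun i _ => ?_
  congr 1
  ext t
  exact congrArg H (Prod.ext (congrArg σ (affMap_map (Prod.fst ∘ w) _ t))
    (affMap_map (Prod.snd ∘ w) _ t))

lemma prismRealize_aff {p q r : ℕ} (σ : Simplex X r) (a : Fin (p + 1) → Delta r)
    (c : TupleChain F (Delta p × Delta 1) q) :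
    prismRealize F H (σ.aff a) q c
      = prismRealize F H σ q (tupleMap F (Prod.map (affMap a) id) q c) := by
  refine tupleChain_ext (f := prismRealize F H (σ.aff a) q)
    (g := prismRealize F H σ q ∘ₗ tupleMap F (Prod.map (affMap a) id) q) (fun w => ?_) c
  simp only [LinearMap.comp_apply, prismRealize_single, tupleMap_single]
  congr 1
  ext t
  exact congrArg H (Prod.ext (congrArg σ (affMap_affMap a (Prod.fst ∘ w) t)) rfl)

/-- One end of a homotopy. -/
def homotopyEnd (i : Fin 2) : C(X, Y) :=
  H.comp (ContinuousMap.prodMk (ContinuousMap.id X) (ContinuousMap.const X (stdSimplex.vertex i)))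

lemma homotopyEnd_apply (i : Fin 2) (x : X) :
    homotopyEnd H i x = H (x, stdSimplex.vertex i) := rfl

lemma affMap_const {q r : ℕ} (x : Delta r) (t : Delta q) : affMap (fun _ => x) t = x := by
  refine stdSimplex.ext (funext fun j => ?_)
  rw [affMap_apply, ← Finset.sum_mul, stdSimplex.sum_eq_one, one_mul]

lemma prismRealize_end {q r : ℕ} (σ : Simplex X r) (i : Fin 2) (c : TupleChain F (Delta r) q) :
    prismRealize F H σ q (tupleMap F (·, stdSimplex.vertex i) q c)
      = chainMap F (homotopyEnd H i) q (realize F σ q c) := by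
  refine tupleChain_ext
    (f := prismRealize F H σ q ∘ₗ tupleMap F (·, (stdSimplex.vertex i : Delta 1)) q)
    (g := chainMap F (homotopyEnd H i) q ∘ₗ realize F σ q) (fun a => ?_) c
  simp only [LinearMap.comp_apply, prismRealize_single, tupleMap_single, realize_single,
    chainMap_single]
  congr 1
  ext t
  exact congrArg H (Prod.ext rfl (affMap_const _ t))

variable (F) in
/-- The chain homotopy between the maps given by the ends of a homotopy. -/
def chainPrism (q : ℕ) : Chain F X q →ₗ[F] Chain F Y (q + 1) :=
  Finsupp.linearCombination F fun σ => prismRealize F H σ (q + 1)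
    (tuplePrismChain F (stdSimplex.vertex 0) (stdSimplex.vertex 1) q
      (Finsupp.single stdSimplex.vertex 1))

/-- As for subdivision, naturality in affine maps extends the formula from the tuple of vertices to
all tuples. -/
lemma chainPrism_realize {q r : ℕ} (σ : Simplex X r) (c : TupleChain F (Delta r) q) :
    chainPrism F H q (realize F σ q c) = prismRealize F H σ (q + 1)
      (tuplePrismChain F (stdSimplex.vertex 0) (stdSimplex.vertex 1) q c) := by
  refine tupleChain_ext (f := chainPrism F H q ∘ₗ realize F σ q)
    (g := prismRealize F H σ (q + 1) ∘ₗ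
      tuplePrismChain F (stdSimplex.vertex 0) (stdSimplex.vertex 1) q) (fun a => ?_) c
  simp only [LinearMap.comp_apply, realize_single, chainPrism, Finsupp.linearCombination_single,
    one_smul]
  rw [prismRealize_aff, ← tuplePrismChain_map, tupleMap_single, affMap_comp_vertex]

lemma boundary_chainPrism_zero (c : Chain F X 0) :
    boundary F Y 0 (chainPrism F H 0 c)
      = chainMap F (homotopyEnd H 1) 0 c - chainMap F (homotopyEnd H 0) 0 c := by
  refine chain_ext (f := boundary F Y 0 ∘ₗ chainPrism F H 0)
    (g := chainMap F (homotopyEnd H 1) 0 - chainMap F (homotopyEnd H 0) 0) (fun σ => ?_) c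
  simp only [LinearMap.comp_apply, LinearMap.sub_apply]
  rw [← realize_vertex σ, chainPrism_realize, boundary_prismRealize, tupleBoundary_prism_zero,
    map_sub, prismRealize_end, prismRealize_end]

lemma boundary_chainPrism {q : ℕ} (c : Chain F X (q + 1)) :
    boundary F Y (q + 1) (chainPrism F H (q + 1) c)
      = chainMap F (homotopyEnd H 1) (q + 1) c - chainMap F (homotopyEnd H 0) (q + 1) c
        - chainPrism F H q (boundary F X q c) := by
  refine chain_ext (f := boundary F Y (q + 1) ∘ₗ chainPrism F H (q + 1))
    (g := chainMap F (homotopyEnd H 1) (q + 1) - chainMap F (homotopyEnd H 0) (q + 1)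
      - chainPrism F H q ∘ₗ boundary F X q) (fun σ => ?_) c
  simp only [LinearMap.comp_apply, LinearMap.sub_apply]
  rw [← realize_vertex σ, chainPrism_realize, boundary_prismRealize, tupleBoundary_prism,
    map_sub, map_sub, prismRealize_end, prismRealize_end, boundary_realize, chainPrism_realize]

lemma chainPrism_mem {U : Set X} {V : Set Y} (h : ∀ x ∈ U, ∀ t, H (x, t) ∈ V) {q : ℕ}
    {c : Chain F X q} (hc : c ∈ chainsIn F U q) : chainPrism F H q c ∈ chainsIn F V (q + 1) := by
  refine chainsIn_le_comap (fun σ hσ => ?_) hc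
  simp only [chainPrism, Finsupp.linearCombination_single, one_smul]
  generalize tuplePrismChain F _ _ q _ = w
  induction w using Finsupp.induction_linear with
  | zero => simp
  | add x y hx hy => rw [map_add]; exact Submodule.add_mem _ hx hy
  | single a c =>
    rw [prismRealize_single]
    refine single_mem_chainsIn ?_ c
    rintro _ ⟨t, rfl⟩
    exact h _ (hσ ⟨_, rfl⟩) _

end Homotopy

/-! ### Relative homology -/

section Relative

variable {F : Type v} [Field F] {X : Type u} [TopologicalSpace X]

variable (F) in
/-- The vanishing of the relative homology `H_q(X, X \ A)`. -/
def RelAcyclic (A : Set X) (q : ℕ) : Prop := relCycles F A q ≤ relBoundaries F A q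

lemma mem_relBoundaries {A : Set X} {q : ℕ} {z : Chain F X q} :
    z ∈ relBoundaries F A q ↔ ∃ e, ∃ w ∈ chainsIn F Aᶜ q, z = boundary F X q e + w := by
  rw [relBoundaries, Submodule.mem_sup]
  constructor
  · rintro ⟨_, ⟨e, rfl⟩, w, hw, rfl⟩
    exact ⟨e, w, hw, rfl⟩
  · rintro ⟨e, w, hw, rfl⟩
    exact ⟨_, ⟨e, rfl⟩, w, hw, rfl⟩

lemma boundary_mem_relBoundaries (A : Set X) {q : ℕ} (e : Chain F X (q + 1)) :
    boundary F X q e ∈ relBoundaries F A q :=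
  Submodule.mem_sup_left ⟨e, rfl⟩

lemma chainsIn_le_relBoundaries (A : Set X) (q : ℕ) :
    chainsIn F Aᶜ q ≤ relBoundaries F A q :=
  le_sup_right

lemma mem_relCycles_succ {A : Set X} {q : ℕ} {z : Chain F X (q + 1)} :
    z ∈ relCycles F A (q + 1) ↔ boundary F X q z ∈ chainsIn F Aᶜ q := Iff.rfl

lemma relBoundaries_le_relCycles (A : Set X) (q : ℕ) :
    relBoundaries F A q ≤ relCycles F A q := by
  cases q with
  | zero => exact le_top
  | succ q =>
    intro z hz
    obtain ⟨e, w, hw, rfl⟩ := mem_relBoundaries.1 hz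
    rw [mem_relCycles_succ, map_add, boundary_boundary, zero_add]
    exact boundary_mem_chainsIn hw

lemma mem_chainsIn_inter {U V : Set X} {q : ℕ} {z : Chain F X q} (hU : z ∈ chainsIn F U q)
    (hV : z ∈ chainsIn F V q) : z ∈ chainsIn F (U ∩ V) q := by
  intro σ hσ
  exact Set.subset_inter (hU hσ) (hV hσ)

lemma chainsIn_univ (q : ℕ) (z : Chain F X q) : z ∈ chainsIn F Set.univ q :=
  fun _ _ => Set.subset_univ _

lemma relAcyclic_empty (q : ℕ) : RelAcyclic F (∅ : Set X) q := by
  intro z _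
  refine chainsIn_le_relBoundaries _ _ ?_
  rw [Set.compl_empty]
  exact chainsIn_univ q z

variable {A B : Set X} (hA : IsClosed A) (hB : IsClosed B)
include hA hB

/-- A chain in the complement of `A ∩ B` splits, up to boundaries, if its boundary does. -/
lemma exists_split_compl {q : ℕ} {c : Chain F X (q + 1)}
    (hc : c ∈ chainsIn F (A ∩ B)ᶜ (q + 1))
    (hb : boundary F X q c ∈ chainsIn F Aᶜ q ⊔ chainsIn F Bᶜ q) :
    ∃ a ∈ chainsIn F Aᶜ (q + 1), ∃ b ∈ chainsIn F Bᶜ (q + 1), ∃ y ∈ chainsIn F (A ∩ B)ᶜ (q + 2),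
      c = a + b + boundary F X (q + 1) y := by
  rw [Set.compl_inter] at hc ⊢
  exact exists_split hA.isOpen_compl hB.isOpen_compl hc hb

/-- Mayer–Vietoris: injectivity. -/
lemma mem_relBoundaries_union {q : ℕ} (hAB : RelAcyclic F (A ∩ B) (q + 1)) {z : Chain F X q}
    (hzA : z ∈ relBoundaries F A q) (hzB : z ∈ relBoundaries F B q) :
    z ∈ relBoundaries F (A ∪ B) q := by
  obtain ⟨a, u, hu, rfl⟩ := mem_relBoundaries.1 hzA
  obtain ⟨b, v, hv, h⟩ := mem_relBoundaries.1 hzB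
  have hab : boundary F X q (a - b) = v - u := by
    rw [map_sub, sub_eq_sub_iff_add_eq_add, h, add_comm]
  have hsup : v - u ∈ chainsIn F Aᶜ q ⊔ chainsIn F Bᶜ q :=
    Submodule.sub_mem _ (Submodule.mem_sup_right hv) (Submodule.mem_sup_left hu)
  have hle : chainsIn F Aᶜ q ⊔ chainsIn F Bᶜ q ≤ chainsIn F (A ∩ B)ᶜ q :=
    sup_le (chainsIn_mono (Set.compl_subset_compl.2 Set.inter_subset_left) q)
      (chainsIn_mono (Set.compl_subset_compl.2 Set.inter_subset_right) q)
  have hcyc : a - b ∈ relCycles F (A ∩ B) (q + 1) := by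
    rw [mem_relCycles_succ, hab]
    exact hle hsup
  -- The two bounding chains of `z` differ by a relative cycle of `A ∩ B`, which bounds up to a
  -- chain `w` off `A ∩ B`.
  obtain ⟨e, w, hw, hew⟩ := mem_relBoundaries.1 (hAB hcyc)
  have hbw : boundary F X q w = v - u := by
    rw [← hab, hew, map_add, boundary_boundary, zero_add]
  -- Subtracting from `a` the part `w₁` off `A` corrects the remainder to `u + ∂w₁ = v - ∂w₂`, which
  -- avoids both `A` and `B`.
  obtain ⟨w₁, hw₁, w₂, hw₂, y, -, hw'⟩ := exists_split_compl hA hB hw (by rwa [hbw])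
  have h3 : boundary F X q w₁ + boundary F X q w₂ = v - u := by
    rw [← hbw, hw', map_add, boundary_boundary, add_zero, map_add]
  refine mem_relBoundaries.2 ⟨a - w₁, u + boundary F X q w₁, ?_, by rw [map_sub]; abel⟩
  rw [Set.compl_union]
  refine mem_chainsIn_inter (Submodule.add_mem _ hu (boundary_mem_chainsIn hw₁)) ?_
  have : u + boundary F X q w₁ = v - boundary F X q w₂ := by
    rw [eq_sub_iff_add_eq, add_assoc, h3]; abel
  rw [this]
  exact Submodule.sub_mem _ hv (boundary_mem_chainsIn hw₂)

/-- Mayer–Vietoris: vanishing for the intersection. -/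
lemma relAcyclic_inter {q : ℕ} (h₁ : RelAcyclic F A (q + 1)) (h₂ : RelAcyclic F B (q + 1))
    (h₃ : RelAcyclic F (A ∪ B) q) : RelAcyclic F (A ∩ B) (q + 1) := by
  intro z hz
  have hz' := mem_relCycles_succ.1 hz
  -- modify `z` such that its boundary is a sum
  obtain ⟨y, hy, u, hu, v, hv, huv⟩ : ∃ y ∈ chainsIn F (A ∩ B)ᶜ (q + 1),
      ∃ u ∈ chainsIn F Aᶜ q, ∃ v ∈ chainsIn F Bᶜ q, boundary F X q (z - y) = u + v := by
    cases q with
    | zero =>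
      rw [Set.compl_inter, chainsIn_union_zero] at hz'
      obtain ⟨u, hu, v, hv, h⟩ := Submodule.mem_sup.1 hz'
      exact ⟨0, Submodule.zero_mem _, u, hu, v, hv, by rw [sub_zero, h]⟩
    | succ q =>
      obtain ⟨u, hu, v, hv, y, hy, h⟩ := exists_split_compl hA hB hz'
        (by rw [boundary_boundary]; exact Submodule.zero_mem _)
      exact ⟨y, hy, u, hu, v, hv, by rw [map_sub, h, add_sub_cancel_right]⟩
  -- As `∂u = -∂v`, the boundary of `u` avoids both `A` and `B`.
  have hucyc : u ∈ relCycles F (A ∪ B) q := by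
    cases q with
    | zero => exact Submodule.mem_top
    | succ q =>
      rw [mem_relCycles_succ, Set.compl_union]
      refine mem_chainsIn_inter (boundary_mem_chainsIn hu) ?_
      have h := congrArg (boundary F X q) huv
      rw [boundary_boundary, map_add] at h
      rw [eq_neg_of_add_eq_zero_left h.symm]
      exact Submodule.neg_mem _ (boundary_mem_chainsIn hv)
  -- A chain `a` bounding `u` up to chains off `A ∪ B` splits `z - y` as `a`, a relative cycle of
  -- `A`, plus `z - y - a`, a relative cycle of `B`.
  obtain ⟨a, w, hw, haw⟩ := mem_relBoundaries.1 (h₃ hucyc)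
  rw [Set.compl_union] at hw
  have hwA := chainsIn_mono (F := F) (Set.inter_subset_left : Aᶜ ∩ Bᶜ ⊆ Aᶜ) q hw
  have hwB := chainsIn_mono (F := F) (Set.inter_subset_right : Aᶜ ∩ Bᶜ ⊆ Bᶜ) q hw
  have ha : a ∈ relBoundaries F A (q + 1) := by
    refine h₁ ?_
    rw [mem_relCycles_succ, eq_sub_of_add_eq haw.symm]
    exact Submodule.sub_mem _ hu hwA
  have hb : z - y - a ∈ relBoundaries F B (q + 1) := by
    refine h₂ ?_
    rw [mem_relCycles_succ, map_sub, huv, haw]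
    have : boundary F X q a + w + v - boundary F X q a = w + v := by abel
    rw [this]
    exact Submodule.add_mem _ hwB hv
  have hsum : z = a + (z - y - a) + y := by abel
  rw [hsum]
  exact Submodule.add_mem _ (Submodule.add_mem _
    (relBoundaries_anti F Set.inter_subset_left _ ha)
    (relBoundaries_anti F Set.inter_subset_right _ hb)) (chainsIn_le_relBoundaries _ _ hy)

/-- Mayer–Vietoris: gluing of relative cycles. -/
lemma exists_relCycles_union {q : ℕ} {a b : Chain F X (q + 1)} (ha : a ∈ relCycles F A (q + 1))
    (hb : b ∈ relCycles F B (q + 1)) (hab : a - b ∈ relBoundaries F (A ∩ B) (q + 1)) :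
    ∃ z ∈ relCycles F (A ∪ B) (q + 1), z - a ∈ relBoundaries F A (q + 1) ∧
      z - b ∈ relBoundaries F B (q + 1) := by
  obtain ⟨e, w, hw, h⟩ := mem_relBoundaries.1 hab
  have hbw : boundary F X q w = boundary F X q a - boundary F X q b := by
    rw [← map_sub, h, map_add, boundary_boundary, zero_add]
  obtain ⟨u, hu, v, hv, y, -, rfl⟩ := exists_split_compl hA hB hw
    (by rw [hbw]; exact Submodule.sub_mem _ (Submodule.mem_sup_left ha) (Submodule.mem_sup_right hb))
  -- The glued cycle is `b + v`: it differs from `b` by a chain off `B`, and from `a` by a chain off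
  -- `A` and a boundary.
  have hz : b + v = a - u - boundary F X (q + 1) (e + y) := by
    have : a = b + (a - b) := by abel
    rw [this, h, map_add]
    abel
  refine ⟨b + v, ?_, ?_, ?_⟩
  · rw [mem_relCycles_succ, Set.compl_union]
    refine mem_chainsIn_inter ?_ ?_
    · rw [hz, map_sub, boundary_boundary, sub_zero, map_sub]
      exact Submodule.sub_mem _ ha (boundary_mem_chainsIn hu)
    · rw [map_add]
      exact Submodule.add_mem _ hb (boundary_mem_chainsIn hv)
  · have : b + v - a = -u - boundary F X (q + 1) (e + y) := by rw [hz]; abel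
    rw [this]
    exact Submodule.sub_mem _ (Submodule.neg_mem _ (chainsIn_le_relBoundaries _ _ hu))
      (boundary_mem_relBoundaries _ _)
  · rw [add_sub_cancel_left]
    exact chainsIn_le_relBoundaries _ _ hv

omit hA hB

variable {K U : Set X} (hK : IsClosed K) (hU : IsOpen U) (hKU : K ⊆ U)
include hK hU hKU

/-- Excision: surjectivity. -/
lemma exists_excision {q : ℕ} {z : Chain F X (q + 1)} (hz : z ∈ relCycles F K (q + 1)) :
    ∃ z' ∈ chainsIn F U (q + 1), z - z' ∈ relBoundaries F K (q + 1) := by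
  have hcov : U ∪ Kᶜ = Set.univ := Set.eq_univ_of_forall fun x => by
    by_cases h : x ∈ K
    · exact Or.inl (hKU h)
    · exact Or.inr h
  obtain ⟨a, ha, b, hb, y, -, rfl⟩ := exists_split hU hK.isOpen_compl
    (by rw [hcov]; exact chainsIn_univ _ z) (Submodule.mem_sup_right hz)
  refine ⟨a, ha, ?_⟩
  rw [add_assoc, add_sub_cancel_left]
  exact Submodule.add_mem _ (chainsIn_le_relBoundaries _ _ hb) (boundary_mem_relBoundaries _ _)

/-- Excision: injectivity. -/
lemma exists_excision_boundary {q : ℕ} {z : Chain F X q} (hz : z ∈ chainsIn F U q)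
    (hzK : z ∈ relBoundaries F K q) :
    ∃ e ∈ chainsIn F U (q + 1), ∃ w ∈ chainsIn F (U ∩ Kᶜ) q, z = boundary F X q e + w := by
  have hcov : U ∪ Kᶜ = Set.univ := Set.eq_univ_of_forall fun x => by
    by_cases h : x ∈ K
    · exact Or.inl (hKU h)
    · exact Or.inr h
  obtain ⟨e, w, hw, rfl⟩ := mem_relBoundaries.1 hzK
  obtain ⟨a, ha, b, hb, y, -, rfl⟩ := exists_split (c := e) hU hK.isOpen_compl
    (by rw [hcov]; exact chainsIn_univ _ e) (by
      rw [← add_sub_cancel_right (boundary F X q e) w]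
      exact Submodule.sub_mem _ (Submodule.mem_sup_left hz) (Submodule.mem_sup_right hw))
  refine ⟨a, ha, boundary F X q b + w, mem_chainsIn_inter ?_
    (Submodule.add_mem _ (boundary_mem_chainsIn hb) hw), ?_⟩
  · have h := Submodule.sub_mem _ hz (boundary_mem_chainsIn ha)
    rw [map_add, map_add, boundary_boundary, add_zero] at h
    convert h using 1
    abel
  · rw [map_add, map_add, boundary_boundary]
    abel

end Relative

/-! ### Relative homology of real vector spaces -/

section VectorSpace

variable {F : Type v} [Field F] {E : Type u} [AddCommGroup E] [Module ℝ E] [TopologicalSpace E]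
  [ContinuousAdd E] [ContinuousSMul ℝ E]

/-- The contraction of a vector space to a point. -/
def contraction (c : E) : C(E × Delta 1, E) where
  toFun p := p.2 0 • p.1 + p.2 1 • c
  continuous_toFun := by
    have h : ∀ i : Fin 2, Continuous fun p : E × Delta 1 => p.2 i := fun i =>
      (continuous_apply i).comp (continuous_subtype_val.comp continuous_snd)
    exact ((h 0).smul continuous_fst).add ((h 1).smul continuous_const)

lemma contraction_end_zero (c : E) : homotopyEnd (contraction c) 0 = ContinuousMap.id E := by
  ext x
  simp [homotopyEnd_apply, contraction]

lemma contraction_end_one (c : E) : homotopyEnd (contraction c) 1 = ContinuousMap.const E c := by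
  ext x
  simp [homotopyEnd_apply, contraction]

omit [AddCommGroup E] [Module ℝ E] [ContinuousAdd E] [ContinuousSMul ℝ E] in
lemma chainMap_id {q : ℕ} (z : Chain F E q) : chainMap F (ContinuousMap.id E) q z = z := by
  refine chain_ext (f := chainMap F (ContinuousMap.id E) q) (g := LinearMap.id) (fun σ => ?_) z
  rw [chainMap_single, ContinuousMap.id_comp, LinearMap.id_apply]

/-- If the complement of `A` is star-shaped, the relative homology vanishes. -/
lemma relAcyclic_of_starConvex_compl {A : Set E} {c : E} (hc : c ∉ A) (h : StarConvex ℝ c Aᶜ)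
    (q : ℕ) : RelAcyclic F A q := by
  intro z hz
  have hconst : ∀ q (z : Chain F E q),
      chainMap F (ContinuousMap.const E c) q z ∈ relBoundaries F A q := by
    intro q z
    refine chainsIn_le_relBoundaries _ _ (chainMap_mem _ (U := Set.univ) ?_ (chainsIn_univ q z))
    exact fun x _ => hc
  cases q with
  | zero =>
    have h1 := boundary_chainPrism_zero (contraction c) z
    rw [contraction_end_zero, contraction_end_one, chainMap_id] at h1
    rw [← sub_sub_self (chainMap F (ContinuousMap.const E c) 0 z) z, ← h1]
    exact Submodule.sub_mem _ (hconst _ _) (boundary_mem_relBoundaries _ _)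
  | succ q =>
    have h1 := boundary_chainPrism (contraction c) z
    rw [contraction_end_zero, contraction_end_one, chainMap_id] at h1
    have h2 : z = chainMap F (ContinuousMap.const E c) (q + 1) z
        - boundary F E (q + 1) (chainPrism F (contraction c) (q + 1) z)
        - chainPrism F (contraction c) q (boundary F E q z) := by
      rw [h1]; abel
    rw [h2]
    refine Submodule.sub_mem _ (Submodule.sub_mem _ (hconst _ _) (boundary_mem_relBoundaries _ _))
      (chainsIn_le_relBoundaries _ _ (chainPrism_mem _ (fun x hx t => ?_) hz))
    -- The contraction moves points off `A` along segments to `c`, which stay off `A`; hence the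
    -- prism over `∂z` is negligible.
    have h3 := h hx (t.2.1 1) (t.2.1 0) (by rw [add_comm]; exact stdSimplex.add_eq_one t)
    rw [add_comm] at h3
    exact h3

omit [AddCommGroup E] [Module ℝ E] [ContinuousAdd E] [ContinuousSMul ℝ E] in
lemma mem_chainsIn_empty {q : ℕ} {z : Chain F E q} : z ∈ chainsIn F (∅ : Set E) q ↔ z = 0 := by
  have h : {σ : Simplex E q | Set.range σ ⊆ ∅} = ∅ := by
    ext σ
    simp [Set.subset_empty_iff, Set.range_eq_empty_iff]
  rw [chainsIn, h, Finsupp.supported_empty, Submodule.mem_bot]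

omit [AddCommGroup E] [Module ℝ E] [ContinuousAdd E] [ContinuousSMul ℝ E] in
lemma chainMap_const (c : E) {q : ℕ} (z : Chain F E q) : ∃ r : F,
    chainMap F (ContinuousMap.const E c) q z = Finsupp.single (ContinuousMap.const _ c) r := by
  induction z using Finsupp.induction_linear with
  | zero => exact ⟨0, by simp⟩
  | add x y hx hy =>
    obtain ⟨r, hr⟩ := hx
    obtain ⟨s, hs⟩ := hy
    exact ⟨r + s, by rw [map_add, hr, hs, Finsupp.single_add]⟩
  | single σ r => exact ⟨r, by rw [chainMap_single]; rfl⟩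

omit [AddCommGroup E] [Module ℝ E] [ContinuousAdd E] [ContinuousSMul ℝ E] in
-- All `q + 2` faces coincide, so the boundary is an alternating sum of equal terms.
lemma boundary_single_const (c : E) (q : ℕ) (r : F) :
    boundary F E q (Finsupp.single (ContinuousMap.const _ c) r)
      = (if Even q then 0 else r) • Finsupp.single (ContinuousMap.const _ c) 1 := by
  rw [← Finsupp.smul_single_one, map_smul, boundary_single]
  have h : ∀ i : Fin (q + 2), Finsupp.single
        (Simplex.face (ContinuousMap.const _ c : Simplex E (q + 1)) i) ((-1 : F) ^ (i : ℕ))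
      = (-1 : F) ^ (i : ℕ) • Finsupp.single (ContinuousMap.const _ c : Simplex E q) 1 := by
    intro i
    rw [Finsupp.smul_single_one]
    rfl
  rw [Finset.sum_congr rfl fun i _ => h i, ← Finset.sum_smul, smul_smul,
    Fin.sum_univ_eq_sum_range (fun i => (-1 : F) ^ i), neg_one_geom_sum]
  congr 1
  by_cases hq : Even q <;> simp [Nat.even_add, hq]

/-- Contraction to the origin makes a cycle homologous to a multiple of the constant simplex. For
even `q` this is the boundary of a constant simplex one dimension higher; for odd `q` it is a cycle
only if the multiple is zero. -/
lemma relAcyclic_univ (q : ℕ) : RelAcyclic F (Set.univ : Set E) (q + 1) := by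
  intro z hz
  rw [mem_relCycles_succ, Set.compl_univ, mem_chainsIn_empty] at hz
  have h1 := boundary_chainPrism (contraction (0 : E)) z
  rw [contraction_end_zero, contraction_end_one, chainMap_id, hz, map_zero, sub_zero] at h1
  rw [← sub_sub_self (chainMap F (ContinuousMap.const E 0) (q + 1) z) z, ← h1]
  refine Submodule.sub_mem _ ?_ (boundary_mem_relBoundaries _ _)
  obtain ⟨r, hr⟩ := chainMap_const (0 : E) z
  rw [hr]
  by_cases hq : Even q
  · have h2 := boundary_single_const (F := F) (0 : E) (q + 1) r
    rw [if_neg (by simpa [Nat.even_add] using hq), Finsupp.smul_single_one] at h2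
    rw [← h2]
    exact boundary_mem_relBoundaries _ _
  · have h2 := boundary_single_const (F := F) (0 : E) q r
    rw [if_neg hq, ← hr, boundary_chainMap, hz, map_zero, Finsupp.smul_single_one] at h2
    rw [Finsupp.single_eq_zero.1 h2.symm, Finsupp.single_zero]
    exact Submodule.zero_mem _

/-- The sum of the coefficients of a `0`-chain. -/
def augmentation (F : Type v) [Field F] (X : Type u) [TopologicalSpace X] : Chain F X 0 →ₗ[F] F :=
  Finsupp.linearCombination F fun _ => 1

lemma augmentation_single {X : Type u} [TopologicalSpace X] (σ : Simplex X 0) (c : F) :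
    augmentation F X (Finsupp.single σ c) = c := by
  simp [augmentation]

lemma augmentation_boundary {X : Type u} [TopologicalSpace X] (c : Chain F X 1) :
    augmentation F X (boundary F X 0 c) = 0 := by
  refine chain_ext (f := augmentation F X ∘ₗ boundary F X 0) (g := 0) (fun σ => ?_) c
  rw [LinearMap.comp_apply, boundary_single, Fin.sum_univ_two, map_add, augmentation_single,
    augmentation_single]
  simp

omit [AddCommGroup E] [Module ℝ E] [ContinuousAdd E] [ContinuousSMul ℝ E] in
-- A point has augmentation `1`, a boundary has augmentation `0`.
lemma not_relAcyclic_univ_zero [Nonempty E] : ¬ RelAcyclic F (Set.univ : Set E) 0 := by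
  intro h
  obtain ⟨x⟩ := ‹Nonempty E›
  obtain ⟨e, w, hw, he⟩ := mem_relBoundaries.1
    (h (show (Finsupp.single (pointSimplex x) 1 : Chain F E 0) ∈ relCycles F Set.univ 0 from
      Submodule.mem_top))
  rw [Set.compl_univ, mem_chainsIn_empty] at hw
  have h1 := congrArg (augmentation F E) he
  rw [hw, add_zero, augmentation_boundary, augmentation_single] at h1
  exact one_ne_zero h1

end VectorSpace

/-! ### Local homology of Euclidean space -/

section Euclidean

variable {F : Type v} [Field F] {n : ℕ}

/-- The points which agree with `p` in the first `k` coordinates. -/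
def flag (p : EuclideanSpace ℝ (Fin n)) (k : ℕ) : Set (EuclideanSpace ℝ (Fin n)) :=
  {x | ∀ j : Fin n, (j : ℕ) < k → x j = p j}

/-- Half of a flag: the points of `flag p k` whose next coordinate is on the side of that of `p`
given by the sign `ε`. -/
def halfFlag (p : EuclideanSpace ℝ (Fin n)) (k : Fin n) (ε : ℝ) : Set (EuclideanSpace ℝ (Fin n)) :=
  {x | x ∈ flag p k ∧ 0 ≤ ε * (x k - p k)}

lemma isClosed_flag (p : EuclideanSpace ℝ (Fin n)) (k : ℕ) : IsClosed (flag p k) := by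
  simp only [flag, Set.ofPred_forall]
  exact isClosed_iInter fun j => isClosed_iInter fun _ =>
    isClosed_eq (by fun_prop) continuous_const

lemma isClosed_halfFlag (p : EuclideanSpace ℝ (Fin n)) (k : Fin n) (ε : ℝ) :
    IsClosed (halfFlag p k ε) :=
  (isClosed_flag p k).inter (isClosed_le continuous_const
    (show Continuous fun x : EuclideanSpace ℝ (Fin n) => ε * (x k - p k) by fun_prop))

lemma halfFlag_union (p : EuclideanSpace ℝ (Fin n)) (k : Fin n) :
    halfFlag p k 1 ∪ halfFlag p k (-1) = flag p k := by
  ext x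
  simp only [halfFlag, Set.mem_union, Set.mem_ofPred_eq, ← and_or_left]
  refine and_iff_left ?_
  rcases le_total (p k) (x k) with h | h
  · left; linarith
  · right; linarith

lemma halfFlag_inter (p : EuclideanSpace ℝ (Fin n)) (k : Fin n) :
    halfFlag p k 1 ∩ halfFlag p k (-1) = flag p (k + 1) := by
  ext x
  simp only [halfFlag, flag, Set.mem_inter_iff, Set.mem_ofPred_eq]
  constructor
  · rintro ⟨⟨h, h1⟩, -, h2⟩ j hj
    rcases Nat.lt_succ_iff_lt_or_eq.1 hj with hj | hj
    · exact h j hj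
    · obtain rfl : j = k := Fin.ext hj
      linarith
  · intro h
    have h1 := h k (Nat.lt_succ_self _)
    have h2 : ∀ j : Fin n, (j : ℕ) < k → x j = p j := fun j hj => h j (hj.trans (Nat.lt_succ_self _))
    exact ⟨⟨h2, by rw [h1]; simp⟩, h2, by rw [h1]; simp⟩

/-- The complement is star-shaped about `p` displaced by `-ε` in the `k`-th coordinate: if a point
of the segment from there to `y` lies in the half flag, its coordinates force `y` into it as well.
-/
lemma relAcyclic_halfFlag (p : EuclideanSpace ℝ (Fin n)) (k : Fin n) {ε : ℝ} (hε : ε ≠ 0) (q : ℕ) :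
    RelAcyclic F (halfFlag p k ε) q := by
  have hε2 : 0 < ε * ε := mul_self_pos.2 hε
  refine relAcyclic_of_starConvex_compl (c := p - EuclideanSpace.single k ε) ?_ ?_ q
  · rintro ⟨-, h⟩
    simp at h
    linarith
  · intro y hy a b ha hb hab hmem
    refine hy ?_
    obtain ⟨h1, h2⟩ := hmem
    have hb0 : b ≠ 0 := by
      rintro rfl
      obtain rfl : a = 1 := by linarith
      simp at h2
      linarith
    have hbp : 0 < b := lt_of_le_of_ne hb hb0.symm
    obtain rfl : a = 1 - b := by linarith
    constructor
    · intro j hj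
      have h3 := h1 j hj
      have hjk : j ≠ k := fun h => by rw [h] at hj; exact lt_irrefl _ hj
      simp [hjk] at h3
      have : b * (y j - p j) = 0 := by linarith
      rcases mul_eq_zero.1 this with h | h
      · exact absurd h hb0
      · linarith
    · simp at h2
      have h3 : 0 ≤ b * (ε * (y k - p k)) := by nlinarith
      exact nonneg_of_mul_nonneg_right h3 hbp

lemma flag_zero (p : EuclideanSpace ℝ (Fin n)) : flag p 0 = Set.univ := by
  ext x; simp [flag]

lemma flag_self (p : EuclideanSpace ℝ (Fin n)) : flag p n = {p} := by
  ext x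
  simp only [flag, Fin.is_lt, true_implies, Set.mem_ofPred_eq, Set.mem_singleton_iff]
  exact ⟨fun h => PiLp.ext h, fun h => by simp [h]⟩

/-- Two half flags have union `flag p k` and intersection `flag p (k + 1)`. Both are acyclic, so
Mayer–Vietoris shifts the degree by one. After `n` steps the flag is a point, and local homology is
compared with the homology of the whole space. -/
lemma relAcyclic_flag_iff (p : EuclideanSpace ℝ (Fin n)) {k : ℕ} (hk : k ≤ n) (q : ℕ) :
    RelAcyclic F (flag p k) (q + k) ↔ RelAcyclic F (Set.univ : Set (EuclideanSpace ℝ (Fin n))) q := by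
  induction k with
  | zero => rw [flag_zero]; rfl
  | succ k ih =>
    rw [← ih (by omega), ← add_assoc]
    have hi := halfFlag_inter p ⟨k, hk⟩
    have hu := halfFlag_union p ⟨k, hk⟩
    simp only at hi hu
    rw [← hi, ← hu]
    have h1 := relAcyclic_halfFlag (F := F) p ⟨k, hk⟩ one_ne_zero
    have h2 := relAcyclic_halfFlag (F := F) p ⟨k, hk⟩ (neg_ne_zero.2 (one_ne_zero (α := ℝ)))
    have c1 := isClosed_halfFlag p ⟨k, hk⟩ 1
    have c2 := isClosed_halfFlag p ⟨k, hk⟩ (-1)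
    constructor
    · intro h z hz
      exact mem_relBoundaries_union c1 c2 h
        (h1 _ (relCycles_anti F Set.subset_union_left _ hz))
        (h2 _ (relCycles_anti F Set.subset_union_right _ hz))
    · exact relAcyclic_inter c1 c2 (h1 _) (h2 _)

lemma relAcyclic_point (p : EuclideanSpace ℝ (Fin n)) {q : ℕ} (hq : n < q) :
    RelAcyclic F ({p} : Set (EuclideanSpace ℝ (Fin n))) q := by
  obtain ⟨i, rfl⟩ : ∃ i, q = i + 1 + n := ⟨q - n - 1, by omega⟩
  rw [← flag_self, relAcyclic_flag_iff p le_rfl]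
  exact relAcyclic_univ i

lemma not_relAcyclic_point (p : EuclideanSpace ℝ (Fin n)) :
    ¬ RelAcyclic F ({p} : Set (EuclideanSpace ℝ (Fin n))) n := by
  have h := relAcyclic_flag_iff (F := F) p le_rfl 0
  rw [flag_self, zero_add] at h
  rw [h]
  exact not_relAcyclic_univ_zero

end Euclidean

/-! ### Compact supports of chains and detection at points. -/

section Support

variable {F : Type v} [Field F] {X : Type u} [TopologicalSpace X]

/-- A chain lies in a compact set, the union of its simplices. -/
lemma exists_compact_support {V : Set X} {q : ℕ} {c : Chain F X q} (hc : c ∈ chainsIn F V q) :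
    ∃ Q : Set X, IsCompact Q ∧ Q ⊆ V ∧ c ∈ chainsIn F Q q := by
  refine ⟨⋃ σ ∈ c.support, Set.range σ,
    c.support.isCompact_biUnion fun σ _ => isCompact_range σ.continuous,
    Set.iUnion₂_subset fun σ hσ => hc hσ, fun σ hσ => ?_⟩
  exact Set.subset_biUnion_of_mem (u := fun σ : Simplex X q => Set.range σ) hσ

/-- A relative cycle of `(X, X \ K)` is a relative cycle for a neighbourhood of `K`. -/
lemma exists_open_relCycles [T2Space X] {K : Set X} {q : ℕ} {z : Chain F X (q + 1)}
    (hz : z ∈ relCycles F K (q + 1)) :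
    ∃ N, IsOpen N ∧ K ⊆ N ∧ z ∈ relCycles F N (q + 1) := by
  obtain ⟨Q, hQ, hQK, hzQ⟩ := exists_compact_support (mem_relCycles_succ.1 hz)
  refine ⟨Qᶜ, hQ.isClosed.isOpen_compl, Set.subset_compl_comm.1 hQK, ?_⟩
  rwa [mem_relCycles_succ, compl_compl]

lemma relAcyclic_union {A B : Set X} (hA : IsClosed A) (hB : IsClosed B) {q : ℕ}
    (h₁ : RelAcyclic F A q) (h₂ : RelAcyclic F B q) (h₃ : RelAcyclic F (A ∩ B) (q + 1)) :
    RelAcyclic F (A ∪ B) q := fun _ hz =>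
  mem_relBoundaries_union hA hB h₃ (h₁ (relCycles_anti F Set.subset_union_left _ hz))
    (h₂ (relCycles_anti F Set.subset_union_right _ hz))

variable (F) in
/-- Classes in `H_q(X, X \ A)` are determined by their restrictions to the points of `A`. -/
def PointDetected (A : Set X) (q : ℕ) : Prop :=
  ∀ z ∈ relCycles F A q, (∀ x ∈ A, z ∈ relBoundaries F {x} q) → z ∈ relBoundaries F A q

lemma pointDetected_union {A B : Set X} (hA : IsClosed A) (hB : IsClosed B) {q : ℕ}
    (h₁ : PointDetected F A q) (h₂ : PointDetected F B q) (h₃ : RelAcyclic F (A ∩ B) (q + 1)) :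
    PointDetected F (A ∪ B) q := fun z hz h =>
  mem_relBoundaries_union hA hB h₃
    (h₁ z (relCycles_anti F Set.subset_union_left _ hz) fun x hx => h x (Or.inl hx))
    (h₂ z (relCycles_anti F Set.subset_union_right _ hz) fun x hx => h x (Or.inr hx))

end Support

/-! ### Expansion from the center of a star-shaped set. -/

section Homothety

variable {F : Type v} [Field F] {E : Type u} [NormedAddCommGroup E] [NormedSpace ℝ E]

/-- The homotopy from the identity to the homothety with center `p` and factor `r`. -/
def homothetyHomotopy (p : E) (r : ℝ) : C(E × Delta 1, E) where
  toFun x := p + (x.2 0 + x.2 1 * r) • (x.1 - p)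
  continuous_toFun := by
    have h : ∀ i : Fin 2, Continuous fun x : E × Delta 1 => x.2 i := fun i =>
      (continuous_apply i).comp (continuous_subtype_val.comp continuous_snd)
    exact continuous_const.add (((h 0).add ((h 1).mul continuous_const)).smul
      (continuous_fst.sub continuous_const))

lemma homothetyHomotopy_end_zero (p : E) (r : ℝ) :
    homotopyEnd (homothetyHomotopy p r) 0 = ContinuousMap.id E := by
  ext x
  simp [homotopyEnd_apply, homothetyHomotopy]

lemma homothetyHomotopy_end_one (p : E) (r : ℝ) (x : E) :
    homotopyEnd (homothetyHomotopy p r) 1 x = p + r • (x - p) := by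
  simp [homotopyEnd_apply, homothetyHomotopy]

/-- The point `x` lies on the segment from `p` to the expanded point, at parameter `r⁻¹`. -/
lemma notMem_of_starConvex {K : Set E} {p : E} (hK : StarConvex ℝ p K) {x : E}
    (hx : x ∉ K) {r : ℝ} (hr : 1 ≤ r) : p + r • (x - p) ∉ K := by
  intro h
  refine hx ?_
  have h1 := hK h (a := 1 - r⁻¹) (b := r⁻¹) (sub_nonneg.2 (inv_le_one_of_one_le₀ hr))
    (by positivity) (by ring)
  convert h1 using 1
  rw [smul_add, smul_smul, inv_mul_cancel₀ (by positivity), sub_smul, one_smul, one_smul]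
  abel

/-- A relative cycle for a compact star-shaped set vanishes if it does so at the center. -/
lemma mem_relBoundaries_of_starConvex {K : Set E} {p : E} (hK : StarConvex ℝ p K)
    (hKc : IsCompact K) {q : ℕ} {z : Chain F E q} (hz : z ∈ relCycles F K q)
    (hzp : z ∈ relBoundaries F {p} q) : z ∈ relBoundaries F K q := by
  obtain ⟨a, u, hu, rfl⟩ := mem_relBoundaries.1 hzp
  obtain ⟨Q, hQ, hQp, huQ⟩ := exists_compact_support hu
  obtain ⟨ε, hε, hball⟩ := Metric.isOpen_iff.1 hQ.isClosed.isOpen_compl p fun h => hQp h rfl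
  obtain ⟨R, hR⟩ := hKc.isBounded.subset_closedBall p
  -- The support `Q` of `u` has distance at least `ε` from `p`, and `K` lies within distance `R`;
  -- expansion by `r` therefore moves `u` off `K`.
  obtain ⟨r, hr, hrR⟩ : ∃ r : ℝ, 1 ≤ r ∧ R < r * ε := by
    refine ⟨max 1 (R / ε + 1), le_max_left _ _, ?_⟩
    calc R < (R / ε + 1) * ε := by rw [add_mul, div_mul_cancel₀ _ hε.ne']; linarith
      _ ≤ _ := mul_le_mul_of_nonneg_right (le_max_right _ _) hε.le
  set H := homothetyHomotopy p r
  have hHu : chainMap F (homotopyEnd H 1) q u ∈ chainsIn F Kᶜ q := by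
    refine chainMap_mem _ (fun x hx => ?_) huQ
    rw [homothetyHomotopy_end_one]
    intro h
    have h1 := hR h
    rw [Metric.mem_closedBall, dist_eq_norm, add_sub_cancel_left, norm_smul,
      Real.norm_of_nonneg (by positivity)] at h1
    have h2 : ε ≤ ‖x - p‖ := by
      rw [← dist_eq_norm]
      by_contra hlt
      exact hball (not_le.1 hlt) hx
    nlinarith
  have hHz : chainMap F (homotopyEnd H 1) q (boundary F E q a + u) ∈ relBoundaries F K q := by
    rw [map_add, ← boundary_chainMap]
    exact Submodule.add_mem _ (boundary_mem_relBoundaries _ _) (chainsIn_le_relBoundaries _ _ hHu)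
  generalize boundary F E q a + u = z at hz hHz
  cases q with
  | zero =>
    have h1 := boundary_chainPrism_zero H z
    rw [homothetyHomotopy_end_zero, chainMap_id] at h1
    rw [← sub_sub_self (chainMap F (homotopyEnd H 1) 0 z) z, ← h1]
    exact Submodule.sub_mem _ hHz (boundary_mem_relBoundaries _ _)
  | succ q =>
    have h1 := boundary_chainPrism H z
    -- During the expansion the boundary of `z` stays off `K`, so `z` is relatively homologous to
    -- its image, which is already known to be a relative boundary.
    rw [homothetyHomotopy_end_zero, chainMap_id] at h1
    have h2 : z = chainMap F (homotopyEnd H 1) (q + 1) z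
        - boundary F E (q + 1) (chainPrism F H (q + 1) z)
        - chainPrism F H q (boundary F E q z) := by
      rw [h1]; abel
    rw [h2]
    refine Submodule.sub_mem _ (Submodule.sub_mem _ hHz (boundary_mem_relBoundaries _ _))
      (chainsIn_le_relBoundaries _ _ (chainPrism_mem _ (fun x hx t => ?_)
        (mem_relCycles_succ.1 hz)))
    -- The factor `t 0 + t 1 * r` is at least `1`, since `t 0 + t 1 = 1` and `1 ≤ r`.
    refine notMem_of_starConvex hK hx ?_
    have h3 := stdSimplex.add_eq_one t
    have h4 := mul_le_mul_of_nonneg_left hr (stdSimplex.zero_le t 1)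
    linarith

end Homothety

/-! ### Compact subsets of Euclidean space. -/

section EuclideanCompact

variable {F : Type v} [Field F] {n : ℕ} {q : ℕ}

lemma relAcyclic_of_convex {K : Set (EuclideanSpace ℝ (Fin n))} (hK : Convex ℝ K)
    (hKc : IsCompact K) (hq : n < q) : RelAcyclic F K q := by
  rcases K.eq_empty_or_nonempty with rfl | ⟨p, hp⟩
  · exact relAcyclic_empty q
  · intro z hz
    exact mem_relBoundaries_of_starConvex (hK.starConvex hp) hKc hz
      (relAcyclic_point p hq (relCycles_anti F (Set.singleton_subset_iff.2 hp) _ hz))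

/-- Induction on the number of sets, for all families and all degrees above `n`: the intersection of
`C i` with the other sets is the union of the convex sets `C i ∩ C j`, one fewer in number, and
Mayer–Vietoris asks for its vanishing one degree higher. -/
lemma relAcyclic_biUnion_convex {ι : Type*} (s : Finset ι)
    (C : ι → Set (EuclideanSpace ℝ (Fin n))) (hC : ∀ i, Convex ℝ (C i))
    (hCc : ∀ i, IsCompact (C i)) (hq : n < q) : RelAcyclic F (⋃ i ∈ s, C i) q := by
  classical
  induction s using Finset.induction_on generalizing C q with
  | empty => simpa using relAcyclic_empty q
  | insert i s _ ih =>
    rw [Finset.set_biUnion_insert]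
    refine relAcyclic_union (hCc i).isClosed (s.isCompact_biUnion fun j _ => hCc j).isClosed
      (relAcyclic_of_convex (hC i) (hCc i) hq) (ih C hC hCc hq) ?_
    rw [Set.inter_iUnion₂]
    exact ih (fun j => C i ∩ C j) (fun j => (hC i).inter (hC j))
      (fun j => (hCc i).inter_right (hCc j).isClosed) (hq.trans (Nat.lt_succ_self _))

/-- Gluing needs the vanishing for intersections only in degree `q + 1`, so degree `n` itself is
allowed. -/
lemma mem_relBoundaries_biUnion_convex {ι : Type*} (s : Finset ι)
    (C : ι → Set (EuclideanSpace ℝ (Fin n))) (hC : ∀ i, Convex ℝ (C i))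
    (hCc : ∀ i, IsCompact (C i)) (hq : n ≤ q) {z : Chain F (EuclideanSpace ℝ (Fin n)) q}
    (hz : ∀ i ∈ s, z ∈ relBoundaries F (C i) q) : z ∈ relBoundaries F (⋃ i ∈ s, C i) q := by
  classical
  induction s using Finset.induction_on with
  | empty =>
    refine chainsIn_le_relBoundaries _ _ ?_
    simpa using chainsIn_univ q z
  | insert i s _ ih =>
    rw [Finset.set_biUnion_insert]
    refine mem_relBoundaries_union (hCc i).isClosed (s.isCompact_biUnion fun j _ => hCc j).isClosed
      ?_ (hz i (Finset.mem_insert_self i s)) (ih fun j hj => hz j (Finset.mem_insert_of_mem hj))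
    rw [Set.inter_iUnion₂]
    exact relAcyclic_biUnion_convex s (fun j => C i ∩ C j) (fun j => (hC i).inter (hC j))
      (fun j => (hCc i).inter_right (hCc j).isClosed) (Nat.lt_succ_of_le hq)

/-- A relative cycle of a compact set is a relative cycle of a finite union of balls with centers
in that set. -/
lemma exists_balls {K : Set (EuclideanSpace ℝ (Fin n))} (hK : IsCompact K)
    {z : Chain F (EuclideanSpace ℝ (Fin n)) (q + 1)} (hz : z ∈ relCycles F K (q + 1)) :
    ∃ (r : EuclideanSpace ℝ (Fin n) → ℝ) (t : Finset (EuclideanSpace ℝ (Fin n))),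
      (∀ x ∈ t, x ∈ K) ∧ (∀ x ∈ t, 0 ≤ r x) ∧ K ⊆ (⋃ x ∈ t, Metric.closedBall x (r x)) ∧
      z ∈ relCycles F (⋃ x ∈ t, Metric.closedBall x (r x)) (q + 1) := by
  obtain ⟨N, hN, hKN, hzN⟩ := exists_open_relCycles hz
  have h : ∀ x : EuclideanSpace ℝ (Fin n), ∃ r > 0, x ∈ K → Metric.closedBall x r ⊆ N := by
    intro x
    by_cases hx : x ∈ K
    · obtain ⟨r, hr, hrN⟩ := Metric.nhds_basis_closedBall.mem_iff.1 (hN.mem_nhds (hKN hx))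
      exact ⟨r, hr, fun _ => hrN⟩
    · exact ⟨1, one_pos, fun h => absurd h hx⟩
  choose r hr hrN using h
  obtain ⟨t, htK, ht⟩ := hK.elim_nhds_subcover (fun x => Metric.closedBall x (r x))
    fun x _ => Metric.closedBall_mem_nhds x (hr x)
  exact ⟨r, t, htK, fun x _ => (hr x).le, ht,
    relCycles_anti F (Set.iUnion₂_subset fun x hx => hrN x (htK x hx)) _ hzN⟩

/-- A relative cycle of `K` extends to a finite union of balls, vanishes there, and so vanishes
after restriction to `K`. -/
lemma relAcyclic_of_isCompact {K : Set (EuclideanSpace ℝ (Fin n))} (hK : IsCompact K)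
    (hq : n < q) : RelAcyclic F K q := by
  obtain ⟨q, rfl⟩ : ∃ k, q = k + 1 := ⟨q - 1, by omega⟩
  intro z hz
  obtain ⟨r, t, -, -, hKt, hzt⟩ := exists_balls hK hz
  exact relBoundaries_anti F hKt _ (relAcyclic_biUnion_convex t _
    (fun x => convex_closedBall x (r x)) (fun x => isCompact_closedBall x (r x)) hq hzt)

/-- The balls have their centers in `K`, where the class is assumed to vanish; expansion spreads
this over each ball, and then over their union. -/
lemma pointDetected_of_isCompact {K : Set (EuclideanSpace ℝ (Fin n))} (hK : IsCompact K)
    (hq : n ≤ q + 1) : PointDetected F K (q + 1) := by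
  intro z hz h
  obtain ⟨r, t, htK, hr, hKt, hzt⟩ := exists_balls hK hz
  refine relBoundaries_anti F hKt _ (mem_relBoundaries_biUnion_convex t _
    (fun x => convex_closedBall x (r x)) (fun x => isCompact_closedBall x (r x)) hq
    fun x hx => ?_)
  have hx' := Metric.mem_closedBall_self (x := x) (hr x hx)
  exact mem_relBoundaries_of_starConvex ((convex_closedBall x (r x)).starConvex hx')
    (isCompact_closedBall x (r x))
    (relCycles_anti F (Set.subset_biUnion_of_mem (u := fun x => Metric.closedBall x (r x)) hx) _ hzt)
    (h x (htK x hx))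

end EuclideanCompact

/-! ### Transfer along charts -/

section Transfer

variable {F : Type v} [Field F] {X Y : Type*} [TopologicalSpace X] [TopologicalSpace Y]

/-- The image of a simplex in the source of a partial homeomorphism. -/
def pushSimplex (φ : OpenPartialHomeomorph X Y) {q : ℕ} (σ : Simplex X q)
    (h : Set.range σ ⊆ φ.source) : Simplex Y q :=
  ⟨φ ∘ σ, φ.continuousOn.comp_continuous σ.continuous fun t => h ⟨t, rfl⟩⟩

variable (F) in
open Classical in
/-- The image of a chain under a partial homeomorphism; simplices which do not lie in the source are
dropped. -/
def pushChain (φ : OpenPartialHomeomorph X Y) (q : ℕ) : Chain F X q →ₗ[F] Chain F Y q :=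
  Finsupp.linearCombination F fun σ =>
    if h : Set.range σ ⊆ φ.source then Finsupp.single (pushSimplex φ σ h) 1 else 0

lemma pushChain_single (φ : OpenPartialHomeomorph X Y) {q : ℕ} (σ : Simplex X q)
    (h : Set.range σ ⊆ φ.source) :
    pushChain F φ q (Finsupp.single σ 1) = Finsupp.single (pushSimplex φ σ h) 1 := by
  simp [pushChain, h]

/-- Two linear maps which agree on the simplices in `U` agree on the chains in `U`. -/
lemma eqOn_chainsIn {q : ℕ} {U : Set X} {W : Type*} [AddCommGroup W] [Module F W]
    {f g : Chain F X q →ₗ[F] W}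
    (h : ∀ σ : Simplex X q, Set.range σ ⊆ U →
      f (Finsupp.single σ 1) = g (Finsupp.single σ 1)) {c : Chain F X q}
    (hc : c ∈ chainsIn F U q) : f c = g c := by
  rw [← sub_eq_zero, ← LinearMap.sub_apply, ← Submodule.mem_bot F]
  refine chainsIn_le_comap (fun σ hσ => ?_) hc
  rw [LinearMap.sub_apply, h σ hσ, sub_self]
  exact Submodule.zero_mem _

lemma boundary_pushChain (φ : OpenPartialHomeomorph X Y) {q : ℕ} {c : Chain F X (q + 1)}
    (hc : c ∈ chainsIn F φ.source (q + 1)) :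
    boundary F Y q (pushChain F φ (q + 1) c) = pushChain F φ q (boundary F X q c) := by
  refine eqOn_chainsIn (f := boundary F Y q ∘ₗ pushChain F φ (q + 1))
    (g := pushChain F φ q ∘ₗ boundary F X q) (fun σ hσ => ?_) hc
  rw [LinearMap.comp_apply, LinearMap.comp_apply, pushChain_single φ σ hσ, boundary_single,
    boundary_single, map_sum]
  refine Finset.sum_congr rfl fun i _ => ?_
  rw [← Finsupp.smul_single_one (σ.face i), map_smul,
    pushChain_single φ (σ.face i) ((σ.range_pull _).trans hσ), Finsupp.smul_single_one]
  rfl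

lemma pushChain_mem (φ : OpenPartialHomeomorph X Y) {q : ℕ} {U : Set X} {V : Set Y}
    (hU : U ⊆ φ.source) (h : Set.MapsTo φ U V) {c : Chain F X q} (hc : c ∈ chainsIn F U q) :
    pushChain F φ q c ∈ chainsIn F V q := by
  refine chainsIn_le_comap (fun σ hσ => ?_) hc
  rw [pushChain_single φ σ (hσ.trans hU)]
  refine single_mem_chainsIn ?_ 1
  rintro _ ⟨t, rfl⟩
  exact h (hσ ⟨t, rfl⟩)

lemma pushChain_symm (φ : OpenPartialHomeomorph X Y) {q : ℕ} {c : Chain F X q}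
    (hc : c ∈ chainsIn F φ.source q) :
    pushChain F φ.symm q (pushChain F φ q c) = c := by
  refine eqOn_chainsIn (f := pushChain F φ.symm q ∘ₗ pushChain F φ q) (g := LinearMap.id)
    (fun σ hσ => ?_) hc
  have hσ' : Set.range (pushSimplex φ σ hσ) ⊆ φ.symm.source := by
    rintro _ ⟨t, rfl⟩
    exact φ.map_source (hσ ⟨t, rfl⟩)
  rw [LinearMap.comp_apply, pushChain_single φ σ hσ, pushChain_single φ.symm _ hσ']
  congr 1
  ext t
  exact φ.left_inv (hσ ⟨t, rfl⟩)

lemma mapsTo_compl_image (φ : OpenPartialHomeomorph X Y) {K : Set X} (hK : K ⊆ φ.source) :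
    Set.MapsTo φ (φ.source ∩ Kᶜ) (φ '' K)ᶜ := by
  rintro x ⟨hx, hxK⟩ ⟨y, hy, hyx⟩
  exact hxK (φ.injOn (hK hy) hx hyx ▸ hy)

variable [T2Space X]

/-- Excision moves the bounding chain into the source of `φ`, where pushing forward commutes with
the boundary. -/
lemma pushChain_mem_relBoundaries (φ : OpenPartialHomeomorph X Y) {K : Set X} (hK : IsCompact K)
    (hKφ : K ⊆ φ.source) {q : ℕ} {z : Chain F X q} (hz : z ∈ chainsIn F φ.source q)
    (hzK : z ∈ relBoundaries F K q) : pushChain F φ q z ∈ relBoundaries F (φ '' K) q := by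
  obtain ⟨e, he, w, hw, rfl⟩ := exists_excision_boundary hK.isClosed φ.open_source hKφ hz hzK
  rw [map_add, ← boundary_pushChain φ he]
  exact Submodule.add_mem _ (boundary_mem_relBoundaries _ _) (chainsIn_le_relBoundaries _ _
    (pushChain_mem φ Set.inter_subset_left (mapsTo_compl_image φ hKφ) hw))

/-- Transfer of relative cycles of a compact set in the source of a partial homeomorphism. -/
lemma exists_transfer [T2Space Y] (φ : OpenPartialHomeomorph X Y) {K : Set X} (hK : IsCompact K)
    (hKφ : K ⊆ φ.source) {q : ℕ} {z : Chain F X (q + 1)} (hz : z ∈ relCycles F K (q + 1)) :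
    ∃ z' ∈ relCycles F (φ '' K) (q + 1), ∀ L ⊆ K, IsCompact L →
      (z ∈ relBoundaries F L (q + 1) ↔ z' ∈ relBoundaries F (φ '' L) (q + 1)) := by
  -- A representative inside the source can be pushed forward without loss, and pushed back by the
  -- inverse homeomorphism for the converse.
  obtain ⟨y, hy, hzy⟩ := exists_excision hK.isClosed φ.open_source hKφ hz
  have hyK : y ∈ relCycles F K (q + 1) := by
    have := Submodule.sub_mem _ hz (relBoundaries_le_relCycles K _ hzy)
    rwa [sub_sub_cancel] at this
  refine ⟨pushChain F φ (q + 1) y, ?_, fun L hLK hL => ?_⟩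
  · rw [mem_relCycles_succ, boundary_pushChain φ hy]
    exact pushChain_mem φ Set.inter_subset_left (mapsTo_compl_image φ hKφ)
      (mem_chainsIn_inter (boundary_mem_chainsIn hy) hyK)
  · have hzyL := relBoundaries_anti F hLK _ hzy
    have h1 : z ∈ relBoundaries F L (q + 1) ↔ y ∈ relBoundaries F L (q + 1) := by
      constructor
      · intro h
        have := Submodule.sub_mem _ h hzyL
        rwa [sub_sub_cancel] at this
      · intro h
        have := Submodule.add_mem _ hzyL h
        rwa [sub_add_cancel] at this
    have hLφ := hLK.trans hKφ
    rw [h1]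
    constructor
    · exact pushChain_mem_relBoundaries φ hL hLφ hy
    · intro h
      have h2 := pushChain_mem_relBoundaries φ.symm (hL.image_of_continuousOn
        (φ.continuousOn.mono hLφ)) (by
          rintro _ ⟨x, hx, rfl⟩
          exact φ.map_source (hLφ hx))
        (pushChain_mem φ (V := φ.symm.source) subset_rfl φ.mapsTo hy) h
      rwa [pushChain_symm φ hy, (φ.leftInvOn.mono hLφ).image_image] at h2

end Transfer

/-! ### Compact subsets of manifolds -/

/-- To prove a property of all compact sets, it suffices to prove it for the compact subsets of some
neighbourhood of each point, and to deduce it for `A ∪ B` from `A`, `B` and `A ∩ B`. -/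
lemma compact_induction {X : Type u} [TopologicalSpace X] [T2Space X] [LocallyCompactSpace X]
    {P : Set X → Prop} (hempty : P ∅)
    (hloc : ∀ x : X, ∃ B ∈ nhds x, ∀ C ⊆ B, IsCompact C → P C)
    (hunion : ∀ A B : Set X, IsCompact A → IsCompact B → P A → P B → P (A ∩ B) → P (A ∪ B))
    {K : Set X} (hK : IsCompact K) : P K := by
  -- The property is strengthened to all compact subsets of a compact `L`, because the union step
  -- also uses `P` for an intersection.
  have key : ∃ L, IsCompact L ∧ K ⊆ L ∧ ∀ C ⊆ L, IsCompact C → P C := by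
    refine hK.induction_on (p := fun s => ∃ L, IsCompact L ∧ s ⊆ L ∧ ∀ C ⊆ L, IsCompact C → P C)
      ⟨∅, isCompact_empty, subset_rfl, fun C hC _ => Set.subset_empty_iff.1 hC ▸ hempty⟩ ?_ ?_ ?_
    · rintro s t hst ⟨L, hL, htL, h⟩
      exact ⟨L, hL, hst.trans htL, h⟩
    · rintro s t ⟨L, hL, hsL, h⟩ ⟨L', hL', htL', h'⟩
      refine ⟨L ∪ L', hL.union hL', Set.union_subset_union hsL htL', fun C hC hCc => ?_⟩
      have hCu : C = (C ∩ L) ∪ (C ∩ L') := by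
        rw [← Set.inter_union_distrib_left, Set.inter_eq_left.2 hC]
      have c1 := hCc.inter_right hL.isClosed
      have c2 := hCc.inter_right hL'.isClosed
      rw [hCu]
      exact hunion _ _ c1 c2 (h _ Set.inter_subset_right c1) (h' _ Set.inter_subset_right c2)
        (h _ (Set.inter_subset_left.trans Set.inter_subset_right) (c1.inter_right c2.isClosed))
    · intro x _
      obtain ⟨B, hB, h⟩ := hloc x
      obtain ⟨L, hL, hLB, hLc⟩ := local_compact_nhds hB
      exact ⟨L, mem_nhdsWithin_of_mem_nhds hL, L, hLc, subset_rfl,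
        fun C hC hCc => h C (hC.trans hLB) hCc⟩
  obtain ⟨L, -, hKL, h⟩ := key
  exact h K hKL hK

section Manifold

variable {F : Type v} [Field F] {m : ℕ} {M : Type u} [TopologicalSpace M] [T2Space M]

lemma relAcyclic_of_subset_source
    (φ : OpenPartialHomeomorph M (EuclideanSpace ℝ (Fin (m + 1)))) {K : Set M} (hK : IsCompact K)
    (hKφ : K ⊆ φ.source) {q : ℕ} (hq : m + 1 < q) : RelAcyclic F K q := by
  obtain ⟨q, rfl⟩ : ∃ k, q = k + 1 := ⟨q - 1, by omega⟩
  intro z hz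
  obtain ⟨z', hz', h⟩ := exists_transfer φ hK hKφ hz
  exact (h K subset_rfl hK).2 (relAcyclic_of_isCompact
    (hK.image_of_continuousOn (φ.continuousOn.mono hKφ)) hq hz')

lemma pointDetected_of_subset_source
    (φ : OpenPartialHomeomorph M (EuclideanSpace ℝ (Fin (m + 1)))) {K : Set M} (hK : IsCompact K)
    (hKφ : K ⊆ φ.source) : PointDetected F K (m + 1) := by
  intro z hz hzx
  obtain ⟨z', hz', h⟩ := exists_transfer φ hK hKφ hz
  refine (h K subset_rfl hK).2 (pointDetected_of_isCompact
    (hK.image_of_continuousOn (φ.continuousOn.mono hKφ)) le_rfl z' hz' ?_)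
  rintro _ ⟨x, hx, rfl⟩
  rw [← Set.image_singleton]
  exact (h {x} (Set.singleton_subset_iff.2 hx) isCompact_singleton).1 (hzx x hx)

variable [ChartedSpace (EuclideanSpace ℝ (Fin (m + 1))) M]

variable (m) in
/-- Every neighbourhood of a point contains a compact connected neighbourhood for which relative
classes are determined by their restriction to any point. -/
lemma exists_chart_ball (F : Type v) [Field F] {x : M} {N : Set M} (hN : N ∈ nhds x) :
    ∃ B ∈ nhds x, B ⊆ N ∧ IsCompact B ∧ IsConnected B ∧
      B ⊆ (chartAt (EuclideanSpace ℝ (Fin (m + 1))) x).source ∧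
      ∀ z ∈ relCycles F B (m + 1), ∀ a ∈ B, z ∈ relBoundaries F {a} (m + 1) →
        z ∈ relBoundaries F B (m + 1) := by
  set φ := chartAt (EuclideanSpace ℝ (Fin (m + 1))) x
  have hxs : x ∈ φ.source := mem_chart_source _ x
  have hV : φ.target ∩ φ.symm ⁻¹' N ∈ nhds (φ x) := by
    refine Filter.inter_mem (φ.open_target.mem_nhds (φ.map_source hxs)) ?_
    refine (φ.continuousAt_symm (φ.map_source hxs)).preimage_mem_nhds ?_
    rwa [φ.left_inv hxs]
  obtain ⟨r, hr, hrV⟩ := Metric.nhds_basis_closedBall.mem_iff.1 hV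
  set D := Metric.closedBall (φ x) r
  have hDt : D ⊆ φ.target := fun y hy => (hrV hy).1
  have hDc : IsCompact D := isCompact_closedBall _ _
  have hDB : φ '' (φ.symm '' D) = D := (φ.rightInvOn.mono hDt).image_image
  have hBs : φ.symm '' D ⊆ φ.source := by
    rintro _ ⟨y, hy, rfl⟩
    exact φ.map_target (hDt hy)
  have hBc : IsCompact (φ.symm '' D) :=
    hDc.image_of_continuousOn (φ.continuousOn_symm.mono hDt)
  refine ⟨φ.symm '' D, ?_, ?_, hBc, ?_, hBs, ?_⟩
  · have h1 : φ.source ∩ φ ⁻¹' D ∈ nhds x := Filter.inter_mem (φ.open_source.mem_nhds hxs)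
      ((φ.continuousAt hxs).preimage_mem_nhds (Metric.closedBall_mem_nhds _ hr))
    exact Filter.mem_of_superset h1 fun y hy => ⟨φ y, hy.2, φ.left_inv hy.1⟩
  · rintro _ ⟨y, hy, rfl⟩
    exact (hrV hy).2
  · exact ⟨⟨_, φ x, Metric.mem_closedBall_self hr.le, rfl⟩,
      (convex_closedBall _ _).isPreconnected.image _ (φ.continuousOn_symm.mono hDt)⟩
  · intro z hz a ha hza
    obtain ⟨z', hz', h⟩ := exists_transfer φ hBc hBs hz
    rw [h _ subset_rfl hBc, hDB]
    rw [hDB] at hz'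
    rw [h {a} (Set.singleton_subset_iff.2 ha) isCompact_singleton, Set.image_singleton] at hza
    have haD : φ a ∈ D := hDB ▸ ⟨a, ha, rfl⟩
    exact mem_relBoundaries_of_starConvex ((convex_closedBall _ _).starConvex haD) hDc hz' hza

variable (m M) in
/-- The relative homology of compact subsets above the dimension vanishes. -/
theorem relAcyclic_and_pointDetected (F : Type v) [Field F] {K : Set M} (hK : IsCompact K) :
    (∀ q, m + 1 < q → RelAcyclic F K q) ∧ PointDetected F K (m + 1) := by
  have := ChartedSpace.locallyCompactSpace (EuclideanSpace ℝ (Fin (m + 1))) M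
  -- The two claims are proved together: detection at points for a union uses the vanishing for the
  -- intersection in degree `m + 2`.
  refine compact_induction
    (P := fun K => (∀ q, m + 1 < q → RelAcyclic F K q) ∧ PointDetected F K (m + 1))
    ⟨fun q _ => relAcyclic_empty q, ?_⟩ (fun x => ?_) ?_ hK
  · intro z hz _
    refine chainsIn_le_relBoundaries _ _ ?_
    rw [Set.compl_empty]
    exact chainsIn_univ _ z
  · exact ⟨_, chart_source_mem_nhds (EuclideanSpace ℝ (Fin (m + 1))) x, fun C hC hCc =>
      ⟨fun q hq => relAcyclic_of_subset_source _ hCc hC hq,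
        pointDetected_of_subset_source _ hCc hC⟩⟩
  · rintro A B hA hB ⟨hA₁, hA₂⟩ ⟨hB₁, hB₂⟩ ⟨h₁, -⟩
    exact ⟨fun q hq => relAcyclic_union hA.isClosed hB.isClosed (hA₁ q hq) (hB₁ q hq)
        (h₁ _ (hq.trans (Nat.lt_succ_self q))),
      pointDetected_union hA.isClosed hB.isClosed hA₂ hB₂ (h₁ _ (Nat.lt_succ_self _))⟩

variable (m) in
-- Transfer along the inverse chart would make the local homology of Euclidean space vanish in its
-- dimension.
lemma not_relAcyclic_singleton (F : Type v) [Field F] (x : M) :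
    ¬ RelAcyclic F ({x} : Set M) (m + 1) := by
  intro h
  set φ := chartAt (EuclideanSpace ℝ (Fin (m + 1))) x
  have hxs : x ∈ φ.source := mem_chart_source _ x
  refine not_relAcyclic_point (F := F) (φ x) fun z hz => ?_
  have hs : ({φ x} : Set (EuclideanSpace ℝ (Fin (m + 1)))) ⊆ φ.symm.source :=
    Set.singleton_subset_iff.2 (φ.map_source hxs)
  obtain ⟨z', hz', h'⟩ := exists_transfer φ.symm isCompact_singleton hs hz
  have h1 : φ.symm '' {φ x} = {x} := by rw [Set.image_singleton, φ.left_inv hxs]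
  rw [h' _ subset_rfl isCompact_singleton, h1]
  rw [h1] at hz'
  exact h hz'

/-- A compact subset of a connected manifold is contained in a compact connected set which contains
a given point. -/
lemma exists_compact_connected (m : ℕ) [ChartedSpace (EuclideanSpace ℝ (Fin (m + 1))) M]
    [ConnectedSpace M] (p : M) {K : Set M} (hK : IsCompact K) :
    ∃ L, IsCompact L ∧ IsPreconnected L ∧ p ∈ L ∧ K ⊆ L := by
  have := ChartedSpace.locallyPathConnectedSpace (EuclideanSpace ℝ (Fin (m + 1))) M
  have : PathConnectedSpace M := pathConnectedSpace_iff_connectedSpace.2 inferInstance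
  refine hK.induction_on (p := fun s => ∃ L, IsCompact L ∧ IsPreconnected L ∧ p ∈ L ∧ s ⊆ L)
    ⟨{p}, isCompact_singleton, isPreconnected_singleton, rfl, Set.empty_subset _⟩ ?_ ?_ ?_
  · rintro s t hst ⟨L, h₁, h₂, h₃, h₄⟩
    exact ⟨L, h₁, h₂, h₃, hst.trans h₄⟩
  · rintro s t ⟨L, h₁, h₂, h₃, h₄⟩ ⟨L', h₁', h₂', h₃', h₄'⟩
    exact ⟨L ∪ L', h₁.union h₁', h₂.union p h₃ h₃' h₂', Or.inl h₃, Set.union_subset_union h₄ h₄'⟩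
  · intro x _
    -- The coefficients play no role: only a compact connected neighbourhood is needed, joined to
    -- `p` by a path.
    obtain ⟨B, hB, -, hBc, hBconn, -, -⟩ := exists_chart_ball m ℚ (x := x) Filter.univ_mem
    let γ := PathConnectedSpace.somePath p x
    exact ⟨B, mem_nhdsWithin_of_mem_nhds hB, Set.range γ ∪ B,
      (isCompact_range γ.continuous).union hBc,
      (isPreconnected_range γ.continuous).union x ⟨1, γ.target⟩ (mem_of_mem_nhds hB)
        hBconn.isPreconnected, Or.inl ⟨0, γ.source⟩, Set.subset_union_right⟩

end Manifold

/-! ### Fundamental classes -/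

section Fundamental

variable {F : Type v} [Field F] {X : Type u} [TopologicalSpace X]

lemma LocalHomology.mk_eq_mk_iff {A : Set X} {q : ℕ} (z w : relCycles F A q) :
    LocalHomology.mk F A q z = LocalHomology.mk F A q w
      ↔ (z : Chain F X q) - w ∈ relBoundaries F A q := by
  rw [Subtype.ext_iff]
  exact Submodule.Quotient.eq _

lemma LocalHomology.restrict_mk {A B : Set X} (h : A ⊆ B) {q : ℕ} (z : relCycles F B q) :
    LocalHomology.restrict F h q (LocalHomology.mk F B q z)
      = LocalHomology.mk F A q ⟨z, relCycles_anti F h q z.2⟩ :=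
  rfl

lemma LocalHomology.mk_surjective (A : Set X) (q : ℕ) :
    Function.Surjective (LocalHomology.mk F A q) := by
  rintro ⟨_, z, hz, rfl⟩
  exact ⟨⟨z, hz⟩, rfl⟩

namespace HomologicalOrientation

variable {n : ℕ} (μ : HomologicalOrientation F X n)

/-- A relative cycle which represents the orientation at a point. -/
def rep (q : X) : relCycles F ({q} : Set X) n :=
  (LocalHomology.mk_surjective {q} n (μ.localClass q)).choose

lemma mk_rep (q : X) : LocalHomology.mk F {q} n (μ.rep q) = μ.localClass q :=
  (LocalHomology.mk_surjective {q} n (μ.localClass q)).choose_spec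

/-- `z` is a relative cycle whose class restricts to `c` times the orientation at `q`. -/
def HasValue (q : X) (z : Chain F X n) (c : F) : Prop :=
  z - c • (μ.rep q : Chain F X n) ∈ relBoundaries F {q} n

lemma restrict_mk_eq_iff {K : Set X} {q : X} (hq : q ∈ K) (z : relCycles F K n) :
    LocalHomology.restrict F (Set.singleton_subset_iff.2 hq) n (LocalHomology.mk F K n z)
      = μ.localClass q ↔ μ.HasValue q z 1 := by
  rw [LocalHomology.restrict_mk, ← mk_rep, LocalHomology.mk_eq_mk_iff, HasValue, one_smul]

variable {μ}

lemma HasValue.sub {q : X} {z w : Chain F X n} {c d : F} (hz : μ.HasValue q z c)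
    (hw : μ.HasValue q w d) : μ.HasValue q (z - w) (c - d) := by
  have := Submodule.sub_mem _ hz hw
  rw [HasValue, sub_smul]
  convert this using 1
  abel

lemma HasValue.smul {q : X} {z : Chain F X n} {c : F} (hz : μ.HasValue q z c) (r : F) :
    μ.HasValue q (r • z) (r * c) := by
  have := Submodule.smul_mem _ r hz
  rwa [smul_sub, smul_smul] at this

lemma hasValue_zero_iff {q : X} {z : Chain F X n} :
    μ.HasValue q z 0 ↔ z ∈ relBoundaries F {q} n := by
  rw [HasValue, zero_smul, sub_zero]

variable (μ)

lemma exists_hasValue {q : X} {z : Chain F X n} (hz : z ∈ relCycles F {q} n) :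
    ∃ c, μ.HasValue q z c := by
  have h : LocalHomology.mk F {q} n ⟨z, hz⟩ ∈ Submodule.span F {μ.localClass q} := by
    rw [μ.generates]
    exact Submodule.mem_top
  obtain ⟨c, hc⟩ := Submodule.mem_span_singleton.1 h
  refine ⟨c, ?_⟩
  rw [← mk_rep, ← map_smul, eq_comm, LocalHomology.mk_eq_mk_iff] at hc
  exact hc

lemma exists_consistent (p : X) : ∃ B ∈ nhds p, ∃ β ∈ relCycles F B n,
    ∀ q ∈ B, μ.HasValue q β 1 := by
  obtain ⟨B, hB, β, hβ⟩ := μ.consistent p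
  obtain ⟨z, rfl⟩ := LocalHomology.mk_surjective B n β
  exact ⟨B, hB, z, z.2, fun q hq => (μ.restrict_mk_eq_iff hq z).1 (hβ q hq)⟩

end HomologicalOrientation

end Fundamental

/-! ### Local values of relative cycles and existence of fundamental classes. -/

section Manifold

variable {F : Type v} [Field F] {m : ℕ} {M : Type u} [TopologicalSpace M] [T2Space M]
  [ChartedSpace (EuclideanSpace ℝ (Fin (m + 1))) M]

namespace HomologicalOrientation

variable (μ : HomologicalOrientation F M (m + 1))

/-- Two different values would make the orientation class zero at `q`; since it generates, the local
homology would vanish. -/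
lemma HasValue.unique {μ : HomologicalOrientation F M (m + 1)} {q : M} {z : Chain F M (m + 1)}
    {c d : F} (hc : μ.HasValue q z c) (hd : μ.HasValue q z d) : c = d := by
  by_contra hne
  refine not_relAcyclic_singleton m F q fun w hw => ?_
  have h1 := hc.sub hd
  rw [sub_self, HasValue, zero_sub, Submodule.neg_mem_iff,
    Submodule.smul_mem_iff _ (sub_ne_zero.2 hne)] at h1
  obtain ⟨e, he⟩ := μ.exists_hasValue hw
  have := Submodule.add_mem _ he (Submodule.smul_mem _ e h1)
  rwa [sub_add_cancel] at this

/-- Near `a` a single class `β` has value `1` everywhere. The class of `z - c • β` vanishes at `a`,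
hence on a chart ball around `a`, hence at each of its points. -/
lemma isOpen_hasValue {N : Set M} (hN : IsOpen N) {z : Chain F M (m + 1)}
    (hz : z ∈ relCycles F N (m + 1)) (c : F) : IsOpen {q | q ∈ N ∧ μ.HasValue q z c} := by
  rw [isOpen_iff_mem_nhds]
  rintro a ⟨haN, ha⟩
  obtain ⟨B, hB, β, hβ, hβB⟩ := μ.exists_consistent a
  obtain ⟨B', hB', hB'N, -, -, -, h⟩ := exists_chart_ball m F (Filter.inter_mem (hN.mem_nhds haN) hB)
  refine Filter.mem_of_superset hB' fun b hb => ⟨(hB'N hb).1, ?_⟩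
  have haB' : a ∈ B' := mem_of_mem_nhds hB'
  have h1 : z - c • β ∈ relBoundaries F B' (m + 1) := by
    refine h _ (Submodule.sub_mem _ (relCycles_anti F (hB'N.trans Set.inter_subset_left) _ hz)
      (Submodule.smul_mem _ c (relCycles_anti F (hB'N.trans Set.inter_subset_right) _ hβ)))
      a haB' ?_
    have := ha.sub ((hβB a (hB'N haB').2).smul c)
    rwa [mul_one, sub_self, hasValue_zero_iff] at this
  have h2 := relBoundaries_anti F (Set.singleton_subset_iff.2 hb) _ h1
  have h3 := Submodule.add_mem _ h2 ((hβB b (hB'N hb).2).smul c)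
  rw [HasValue]
  rw [mul_one] at h3
  convert h3 using 1
  abel

/-- A relative cycle has a constant value on a connected compact set. -/
lemma hasValue_of_isPreconnected {L : Set M} (hL : IsPreconnected L) {z : Chain F M (m + 1)}
    (hz : z ∈ relCycles F L (m + 1)) {a b : M} (ha : a ∈ L) (hb : b ∈ L) {c : F}
    (hc : μ.HasValue a z c) : μ.HasValue b z c := by
  obtain ⟨N, hN, hLN, hzN⟩ := exists_open_relCycles hz
  have hu := μ.isOpen_hasValue hN hzN c
  -- The points of `N` with any other value also form an open set, so connectedness applies.
  have hv : IsOpen (⋃ d ∈ {d : F | d ≠ c}, {q | q ∈ N ∧ μ.HasValue q z d}) :=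
    isOpen_biUnion fun d _ => μ.isOpen_hasValue hN hzN d
  refine ((hL.subset_left_of_subset_union hu hv ?_ ?_ ⟨a, ha, hLN ha, hc⟩) hb).2
  · rw [Set.disjoint_left]
    rintro q ⟨-, hq⟩ hq'
    obtain ⟨d, hd, -, hq'⟩ := Set.mem_iUnion₂.1 hq'
    exact hd (hq'.unique hq)
  · intro q hq
    obtain ⟨d, hd⟩ := μ.exists_hasValue (relCycles_anti F (Set.singleton_subset_iff.2 hq) _ hz)
    by_cases hdc : d = c
    · exact Or.inl ⟨hLN hq, hdc ▸ hd⟩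
    · exact Or.inr (Set.mem_iUnion₂.2 ⟨d, hdc, hLN hq, hd⟩)

/-- Two relative cycles of a compact set with the same values are homologous. -/
lemma sub_mem_relBoundaries {K : Set M} (hK : IsCompact K) {z w : Chain F M (m + 1)}
    (hz : z ∈ relCycles F K (m + 1)) (hw : w ∈ relCycles F K (m + 1)) {c : M → F}
    (hzc : ∀ q ∈ K, μ.HasValue q z (c q)) (hwc : ∀ q ∈ K, μ.HasValue q w (c q)) :
    z - w ∈ relBoundaries F K (m + 1) := by
  refine (relAcyclic_and_pointDetected m M F hK).2 _ (Submodule.sub_mem _ hz hw) fun q hq => ?_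
  have := (hzc q hq).sub (hwc q hq)
  rwa [sub_self, hasValue_zero_iff] at this

/-- Every compact set has a fundamental class. -/
theorem exists_fundamental {K : Set M} (hK : IsCompact K) :
    ∃ z ∈ relCycles F K (m + 1), ∀ q ∈ K, μ.HasValue q z 1 := by
  have := ChartedSpace.locallyCompactSpace (EuclideanSpace ℝ (Fin (m + 1))) M
  refine compact_induction
    (P := fun K => ∃ z ∈ relCycles F K (m + 1), ∀ q ∈ K, μ.HasValue q z 1)
    ⟨0, Submodule.zero_mem _, fun q hq => absurd hq (Set.notMem_empty q)⟩ (fun x => ?_) ?_ hK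
  · obtain ⟨B, hB, β, hβ, h⟩ := μ.exists_consistent x
    exact ⟨B, hB, fun C hC _ => ⟨β, relCycles_anti F hC _ hβ, fun q hq => h q (hC hq)⟩⟩
  · rintro A B hA hB ⟨a, ha, ha'⟩ ⟨b, hb, hb'⟩ -
    -- Over `A ∩ B` the two fundamental cycles have the same value at every point, hence are
    -- homologous there and can be glued.
    obtain ⟨z, hz, hza, hzb⟩ := exists_relCycles_union hA.isClosed hB.isClosed ha hb
      (μ.sub_mem_relBoundaries (hA.inter_right hB.isClosed) (c := fun _ => 1)
        (relCycles_anti F Set.inter_subset_left _ ha)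
        (relCycles_anti F Set.inter_subset_right _ hb)
        (fun q hq => ha' q hq.1) (fun q hq => hb' q hq.2))
    refine ⟨z, hz, fun q hq => ?_⟩
    rcases hq with hq | hq
    · have := Submodule.add_mem _ (relBoundaries_anti F (Set.singleton_subset_iff.2 hq) _ hza)
        (ha' q hq)
      rwa [sub_add_sub_cancel] at this
    · have := Submodule.add_mem _ (relBoundaries_anti F (Set.singleton_subset_iff.2 hq) _ hzb)
        (hb' q hq)
      rwa [sub_add_sub_cancel] at this

end HomologicalOrientation

end Manifold

/-! ### Compactly supported cohomology and relative homology -/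

section Evaluation

variable {F : Type v} [Field F] {X : Type u} [TopologicalSpace X]

/-- A cochain as a functional on chains. -/
def evalChain {q : ℕ} (f : Cochain F X q) : Chain F X q →ₗ[F] F := Finsupp.linearCombination F f

lemma evalChain_single {q : ℕ} (f : Cochain F X q) (σ : Simplex X q) :
    evalChain f (Finsupp.single σ 1) = f σ := by
  simp [evalChain]

lemma evalChain_sub {q : ℕ} (f g : Cochain F X q) (c : Chain F X q) :
    evalChain (f - g) c = evalChain f c - evalChain g c := by
  refine chain_ext (f := evalChain (f - g)) (g := evalChain f - evalChain g) (fun σ => ?_) c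
  simp only [LinearMap.sub_apply, evalChain_single, Pi.sub_apply]

lemma evalChain_smul {q : ℕ} (r : F) (f : Cochain F X q) (c : Chain F X q) :
    evalChain (r • f) c = r * evalChain f c := by
  refine chain_ext (f := evalChain (r • f)) (g := r • evalChain f) (fun σ => ?_) c
  simp only [LinearMap.smul_apply, evalChain_single, Pi.smul_apply]

lemma coboundary_apply {q : ℕ} (f : Cochain F X q) (σ : Simplex X (q + 1)) :
    coboundary F X q f σ = evalChain f (boundary F X q (Finsupp.single σ 1)) := by
  rw [boundary_single, map_sum]
  change ∑ i : Fin (q + 2), (-1 : F) ^ (i : ℕ) * f (σ.face i) = _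
  refine Finset.sum_congr rfl fun i _ => ?_
  rw [← Finsupp.smul_single_one, map_smul, evalChain_single, smul_eq_mul]

lemma evalChain_coboundary {q : ℕ} (f : Cochain F X q) (c : Chain F X (q + 1)) :
    evalChain (coboundary F X q f) c = evalChain f (boundary F X q c) := by
  refine chain_ext (f := evalChain (coboundary F X q f)) (g := evalChain f ∘ₗ boundary F X q)
    (fun σ => ?_) c
  rw [evalChain_single, coboundary_apply, LinearMap.comp_apply]

lemma VanishesOff.evalChain {q : ℕ} {f : Cochain F X q} {K : Set X} (hf : VanishesOff f K)
    {c : Chain F X q} (hc : c ∈ chainsIn F Kᶜ q) : evalChain f c = 0 := by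
  rw [← Submodule.mem_bot F]
  refine chainsIn_le_comap (fun σ hσ => ?_) hc
  rw [evalChain_single, hf σ hσ]
  exact Submodule.zero_mem _

lemma VanishesOff.mono {q : ℕ} {f : Cochain F X q} {K L : Set X} (hf : VanishesOff f K)
    (h : K ⊆ L) : VanishesOff f L :=
  fun σ hσ => hf σ (hσ.trans (Set.compl_subset_compl.2 h))

lemma evalChain_eq_zero_of_mem_relBoundaries {q : ℕ} {f : Cochain F X q} {K : Set X}
    (hf : VanishesOff f K) (hd : coboundary F X q f = 0) {c : Chain F X q}
    (hc : c ∈ relBoundaries F K q) : evalChain f c = 0 := by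
  obtain ⟨e, w, hw, rfl⟩ := mem_relBoundaries.1 hc
  rw [map_add, ← evalChain_coboundary, hd, hf.evalChain hw, add_zero]
  simp [evalChain]

lemma exists_evalChain_eq {q : ℕ} (φ : Chain F X q →ₗ[F] F) :
    ∃ f : Cochain F X q, ∀ c, evalChain f c = φ c :=
  ⟨fun σ => φ (Finsupp.single σ 1), chain_ext fun σ => evalChain_single _ σ⟩

/-- A cocycle which vanishes on the relative cycles of a compact set is a coboundary. -/
lemma mem_coboundaries_of_evalChain {q : ℕ} {f : Cochain F X (q + 1)} {K : Set X}
    (hK : IsCompact K) (h : ∀ c ∈ relCycles F K (q + 1), evalChain f c = 0) :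
    f ∈ coboundaries F X (q + 1) := by
  set D := (chainsIn F Kᶜ q).mkQ ∘ₗ boundary F X q
  have h1 : evalChain f ∈ (LinearMap.ker D).dualAnnihilator := by
    rw [Submodule.mem_dualAnnihilator]
    intro c hc
    refine h c ?_
    rw [LinearMap.mem_ker, LinearMap.comp_apply, Submodule.mkQ_apply,
      Submodule.Quotient.mk_eq_zero] at hc
    exact hc
  -- The kernel of `D` consists of the relative cycles. Over a field, a functional vanishing on it
  -- is `g ∘ D` for a functional `g` on chains modulo chains off `K`; as a cochain, `g` vanishes off
  -- `K` and is the required primitive.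
  rw [← LinearMap.range_dualMap_eq_dualAnnihilator_ker] at h1
  obtain ⟨g, hg⟩ := h1
  obtain ⟨f', hf'⟩ := exists_evalChain_eq (g ∘ₗ (chainsIn F Kᶜ q).mkQ)
  refine ⟨f', ⟨K, hK, fun σ hσ => ?_⟩, ?_⟩
  · rw [← evalChain_single f', hf', LinearMap.comp_apply, Submodule.mkQ_apply,
      (Submodule.Quotient.mk_eq_zero (chainsIn F Kᶜ q)).2 (single_mem_chainsIn hσ (1 : F)), map_zero]
  · funext σ
    rw [coboundary_apply, hf', ← evalChain_single f, ← hg]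
    rfl

lemma Hc.mk_eq_zero_iff {q : ℕ} {f : cocycles F X q} :
    Hc.mk F X q f = 0 ↔ f.1 ∈ coboundaries F X q :=
  Submodule.Quotient.mk_eq_zero _

lemma augmentation_capChain {n : ℕ} (f : Cochain F X n) (z : Chain F X n) :
    augmentation F X (capChain f z) = evalChain f z := by
  refine chain_ext (f := augmentation F X ∘ₗ capChain f) (g := evalChain f) (fun σ => ?_) z
  rw [LinearMap.comp_apply, evalChain_single, capChain, Finsupp.linearCombination_single, one_smul,
    augmentation_single]

/-- In a path connected space, a `0`-chain is a boundary if its coefficients add up to zero. -/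
lemma mem_range_boundary_iff [PathConnectedSpace X] (c : Chain F X 0) :
    c ∈ LinearMap.range (boundary F X 0) ↔ augmentation F X c = 0 := by
  constructor
  · rintro ⟨e, rfl⟩
    exact augmentation_boundary e
  · intro h
    obtain ⟨p⟩ := (inferInstance : Nonempty X)
    have key : ∀ c : Chain F X 0, c - augmentation F X c • Finsupp.single (pointSimplex p) 1
        ∈ LinearMap.range (boundary F X 0) := by
      intro c
      induction c using Finsupp.induction_linear with
      | zero => simp
      | add x y hx hy =>
        convert Submodule.add_mem _ hx hy using 1
        rw [map_add, add_smul]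
        abel
      | single σ r =>
        rw [augmentation_single, ← Finsupp.smul_single_one σ r, ← smul_sub]
        refine Submodule.smul_mem _ _ ?_
        -- A path from `p` to the point of `σ`, viewed as a `1`-simplex, has boundary `σ` minus the
        -- simplex at `p`.
        let γ := PathConnectedSpace.somePath p (σ default)
        let τ : Simplex X 1 := ⟨γ ∘ stdSimplexHomeomorphUnitInterval,
          γ.continuous.comp stdSimplexHomeomorphUnitInterval.continuous⟩
        have h0 : ∀ (i : Fin 2) (ρ : Simplex X 0),
            τ (stdSimplex.map (fun _ => i) (default : stdSimplex ℝ (Fin 1))) = ρ default →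
            τ.pull (fun _ => i) = ρ := by
          intro i ρ h
          ext t
          rw [Subsingleton.elim t default, ← h]
          rfl
        refine ⟨Finsupp.single τ 1, ?_⟩
        have e0 : τ.face 0 = σ := by
          rw [Simplex.face, show Fin.succAbove (0 : Fin (0 + 2)) = fun _ => 1 by decide]
          refine h0 1 σ ?_
          have : stdSimplexHomeomorphUnitInterval
              (stdSimplex.map (fun _ => (1 : Fin 2)) (default : stdSimplex ℝ (Fin 1))) = 1 := by
            refine Subtype.ext ?_
            change stdSimplex.map (fun _ => (1 : Fin 2)) (default : stdSimplex ℝ (Fin 1)) 1 = 1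
            rw [stdSimplex.map_coe, FunOnFinite.linearMap_apply_apply]
            simp
          exact (congrArg γ this).trans γ.target
        have e1 : τ.face 1 = pointSimplex p := by
          rw [Simplex.face, show Fin.succAbove (1 : Fin (0 + 2)) = fun _ => 0 by decide]
          refine h0 0 _ ?_
          have : stdSimplexHomeomorphUnitInterval
              (stdSimplex.map (fun _ => (0 : Fin 2)) (default : stdSimplex ℝ (Fin 1))) = 0 := by
            refine Subtype.ext ?_
            change stdSimplex.map (fun _ => (0 : Fin 2)) (default : stdSimplex ℝ (Fin 1)) 1 = 0
            rw [stdSimplex.map_coe, FunOnFinite.linearMap_apply_apply]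
            simp
          exact (congrArg γ this).trans γ.source
        rw [boundary_single, Fin.sum_univ_two, e0, e1]
        simp [sub_eq_add_neg, Finsupp.single_neg]
    have := key c
    rwa [h, zero_smul, sub_zero] at this

end Evaluation

/-! ### The top compactly supported cohomology of a manifold -/

section Manifold

variable {F : Type v} [Field F] {m : ℕ} {M : Type u} [TopologicalSpace M] [T2Space M]
  [ChartedSpace (EuclideanSpace ℝ (Fin (m + 1))) M]

variable (F m M) in
/-- Compactly supported cohomology vanishes above the dimension. -/
theorem Hc.eq_zero_of_dim_lt {q : ℕ} (hq : m + 1 < q) (x : Hc F M q) : x = 0 := by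
  obtain ⟨q, rfl⟩ : ∃ k, q = k + 1 := ⟨q - 1, by omega⟩
  obtain ⟨⟨f, ⟨K, hK, hf⟩, hd⟩, rfl⟩ := Hc.mk_surjective x
  exact Hc.mk_eq_zero (mem_coboundaries_of_evalChain hK fun c hc =>
    evalChain_eq_zero_of_mem_relBoundaries hf hd ((relAcyclic_and_pointDetected m M F hK).1 _ hq hc))

variable (μ : HomologicalOrientation F M (m + 1))

/-- Point detection makes `w` homologous to `c • z` relative to the complement of `K`, and `f` takes
equal values on homologous relative cycles. -/
lemma evalChain_eq_mul {f : Cochain F M (m + 1)} {K : Set M} (hK : IsCompact K)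
    (hf : VanishesOff f K) (hd : coboundary F M (m + 1) f = 0) {z w : Chain F M (m + 1)}
    (hz : z ∈ relCycles F K (m + 1)) (hz1 : ∀ q ∈ K, μ.HasValue q z 1)
    (hw : w ∈ relCycles F K (m + 1)) {c : F} (hwc : ∀ q ∈ K, μ.HasValue q w c) :
    evalChain f w = c * evalChain f z := by
  have h := μ.sub_mem_relBoundaries hK hw (Submodule.smul_mem _ c hz) (c := fun _ => c) hwc
    fun q hq => by simpa using (hz1 q hq).smul c
  have := evalChain_eq_zero_of_mem_relBoundaries hf hd h
  rwa [map_sub, map_smul, smul_eq_mul, sub_eq_zero] at this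

/-- A cocycle whose value on the fundamental class is zero is a coboundary. -/
lemma mem_coboundaries_of_evalChain_fundamental [ConnectedSpace M] {f : Cochain F M (m + 1)}
    {K : Set M} (hK : IsCompact K) (hf : VanishesOff f K) (hd : coboundary F M (m + 1) f = 0)
    {z : Chain F M (m + 1)} (hz : z ∈ relCycles F K (m + 1)) (hz1 : ∀ q ∈ K, μ.HasValue q z 1)
    (h : evalChain f z = 0) : f ∈ coboundaries F M (m + 1) := by
  obtain ⟨p⟩ := (inferInstance : Nonempty M)
  -- On a connected `L` a relative cycle has a single value, so over `K` it is a multiple of the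
  -- fundamental cycle. The price is a primitive supported in `L` instead of `K`.
  obtain ⟨L, hL, hLc, hpL, hKL⟩ := exists_compact_connected m p hK
  refine mem_coboundaries_of_evalChain hL fun w hw => ?_
  obtain ⟨c, hc⟩ := μ.exists_hasValue (relCycles_anti F (Set.singleton_subset_iff.2 hpL) _ hw)
  rw [evalChain_eq_mul μ hK hf hd hz hz1 (relCycles_anti F hKL _ hw) fun q hq =>
    μ.hasValue_of_isPreconnected hLc hw hpL (hKL hq) hc, h, mul_zero]

/-- Two cocycles with the same value on fundamental classes are cohomologous. -/
lemma Hc.mk_eq_mk_of_evalChain [ConnectedSpace M] {f g : cocycles F M (m + 1)} {K L : Set M}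
    (hK : IsCompact K) (hL : IsCompact L) (hf : VanishesOff f.1 K) (hg : VanishesOff g.1 L)
    {z w : Chain F M (m + 1)} (hz : z ∈ relCycles F K (m + 1)) (hz1 : ∀ q ∈ K, μ.HasValue q z 1)
    (hw : w ∈ relCycles F L (m + 1)) (hw1 : ∀ q ∈ L, μ.HasValue q w 1)
    (h : evalChain f.1 z = evalChain g.1 w) : Hc.mk F M (m + 1) f = Hc.mk F M (m + 1) g := by
  -- A fundamental cycle of the union serves both supports, so the two evaluations can be compared
  -- on one chain.
  obtain ⟨y, hy, hy1⟩ := μ.exists_fundamental (hK.union hL)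
  rw [← sub_eq_zero, ← map_sub]
  refine Hc.mk_eq_zero (mem_coboundaries_of_evalChain_fundamental μ (hK.union hL)
    (f := f.1 - g.1) (fun σ hσ => ?_) ((f - g).2.2) hy hy1 ?_)
  · rw [Pi.sub_apply, hf.mono Set.subset_union_left σ hσ, hg.mono Set.subset_union_right σ hσ,
      sub_zero]
  · rw [evalChain_sub, evalChain_eq_mul μ hK hf f.2.2 hz hz1
        (relCycles_anti F Set.subset_union_left _ hy) fun q hq => hy1 q (Or.inl hq),
      evalChain_eq_mul μ hL hg g.2.2 hw hw1
        (relCycles_anti F Set.subset_union_right _ hy) fun q hq => hy1 q (Or.inr hq), h, sub_self]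

variable [ConnectedSpace M]

omit [T2Space M] in
-- Since `M` is path connected, `0`-chains are homologous exactly when their augmentations agree,
-- and the augmentation of a cap product is the evaluation. The condition no longer involves `p`.
lemma isPoincareDualPoint_iff (p : M) (x : Hc F M (m + 1)) :
    IsPoincareDualPoint μ p x ↔ ∃ (K : Set M) (f : cocycles F M (m + 1)) (z : Chain F M (m + 1)),
      IsCompact K ∧ VanishesOff f.1 K ∧ Hc.mk F M (m + 1) f = x ∧ z ∈ relCycles F K (m + 1) ∧
      (∀ q ∈ K, μ.HasValue q z 1) ∧ evalChain f.1 z = 1 := by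
  have := ChartedSpace.locallyPathConnectedSpace (EuclideanSpace ℝ (Fin (m + 1))) M
  have : PathConnectedSpace M := pathConnectedSpace_iff_connectedSpace.2 inferInstance
  simp only [IsPoincareDualPoint, mem_range_boundary_iff, map_sub, augmentation_capChain, augmentation_single, sub_eq_zero]
  constructor
  · rintro ⟨K, f, z, h₁, h₂, h₃, h₄, h₅⟩
    exact ⟨K, f, z, h₁, h₂, h₃, z.2, fun q hq => (μ.restrict_mk_eq_iff hq z).1 (h₄ q hq), h₅⟩
  · rintro ⟨K, f, z, h₁, h₂, h₃, h₄, h₅, h₆⟩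
    exact ⟨K, f, ⟨z, h₄⟩, h₁, h₂, h₃,
      fun q hq => (μ.restrict_mk_eq_iff hq ⟨z, h₄⟩).2 (h₅ q hq), h₆⟩

/-- The Poincaré dual of the class of a point exists and is unique. -/
theorem existsUnique_isPoincareDualPoint (p : M) :
    ∃! x : Hc F M (m + 1), IsPoincareDualPoint μ p x := by
  refine existsUnique_of_exists_of_unique ?_ ?_
  · have hrep : (μ.rep p : Chain F M (m + 1)) ∉ relBoundaries F {p} (m + 1) := fun h =>
      zero_ne_one ((HomologicalOrientation.hasValue_zero_iff.2 h).unique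
        (show μ.HasValue p _ 1 by
          rw [HomologicalOrientation.HasValue, one_smul, sub_self]; exact Submodule.zero_mem _))
    -- A functional that kills the relative boundaries at `p` is a cocycle vanishing off `{p}`;
    -- dividing by its value on the orientation cycle normalizes it.
    obtain ⟨l, hl0, hl⟩ := Submodule.exists_le_ker_of_notMem hrep
    set f : Cochain F M (m + 1) := fun σ =>
      (l (μ.rep p : Chain F M (m + 1)))⁻¹ * l (Finsupp.single σ 1) with hf
    have hfe : ∀ c, evalChain f c = (l (μ.rep p : Chain F M (m + 1)))⁻¹ * l c := fun c =>
      chain_ext (f := evalChain f) (g := (l (μ.rep p : Chain F M (m + 1)))⁻¹ • l)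
        (fun σ => by rw [evalChain_single]; rfl) c
    have hfK : VanishesOff f {p} := by
      intro σ hσ
      have : l (Finsupp.single σ 1) = 0 :=
        hl (chainsIn_le_relBoundaries {p} _ (single_mem_chainsIn hσ 1))
      change (l (μ.rep p : Chain F M (m + 1)))⁻¹ * l (Finsupp.single σ 1) = 0
      rw [this, mul_zero]
    have hfd : coboundary F M (m + 1) f = 0 := by
      funext σ
      have : l (boundary F M (m + 1) (Finsupp.single σ 1)) = 0 :=
        hl (boundary_mem_relBoundaries {p} _)
      rw [coboundary_apply, hfe, this, mul_zero]
      rfl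
    refine ⟨Hc.mk F M (m + 1) ⟨f, ⟨{p}, isCompact_singleton, hfK⟩, hfd⟩, ?_⟩
    rw [isPoincareDualPoint_iff]
    refine ⟨{p}, _, μ.rep p, isCompact_singleton, hfK, rfl, (μ.rep p).2, ?_, ?_⟩
    · rintro _ rfl
      rw [HomologicalOrientation.HasValue, one_smul, sub_self]
      exact Submodule.zero_mem _
    · rw [hfe, inv_mul_cancel₀ hl0]
  · intro x y hx hy
    rw [isPoincareDualPoint_iff] at hx hy
    obtain ⟨K, f, z, hK, hf, rfl, hz, hz1, hfz⟩ := hx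
    obtain ⟨L, g, w, hL, hg, rfl, hw, hw1, hgw⟩ := hy
    exact Hc.mk_eq_mk_of_evalChain μ hK hL hf hg hz hz1 hw hw1 (hfz.trans hgw.symm)

variable {μ}

/-- If `f = δg` with `g` vanishing off `L`, then on a fundamental cycle `y` of `K ∪ L` the value of
`f` is both `1` and `g(∂y) = 0`, because `∂y` avoids `L`. -/
lemma IsPoincareDualPoint.ne_zero {p : M} {x : Hc F M (m + 1)} (hx : IsPoincareDualPoint μ p x) :
    x ≠ 0 := by
  rw [isPoincareDualPoint_iff] at hx
  obtain ⟨K, f, z, hK, hf, rfl, hz, hz1, hfz⟩ := hx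
  intro h0
  obtain ⟨g, ⟨L, hL, hg⟩, hgf⟩ := Hc.mk_eq_zero_iff.1 h0
  obtain ⟨y, hy, hy1⟩ := μ.exists_fundamental (hK.union hL)
  have h1 := evalChain_eq_mul μ hK hf f.2.2 hz hz1
    (relCycles_anti F Set.subset_union_left _ hy) fun q hq => hy1 q (Or.inl hq)
  rw [← hgf, evalChain_coboundary, hgf, hfz, hg.evalChain
    (mem_relCycles_succ.1 (relCycles_anti F Set.subset_union_right _ hy))] at h1
  simp at h1

/-- The coefficient is the value of a representing cocycle of `y` on a fundamental cycle of its
support. -/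
lemma IsPoincareDualPoint.exists_smul_eq {p : M} {x : Hc F M (m + 1)}
    (hx : IsPoincareDualPoint μ p x) (y : Hc F M (m + 1)) : ∃ c : F, c • x = y := by
  rw [isPoincareDualPoint_iff] at hx
  obtain ⟨K, f, z, hK, hf, rfl, hz, hz1, hfz⟩ := hx
  obtain ⟨g, rfl⟩ := Hc.mk_surjective y
  obtain ⟨L, hL, hg⟩ := g.2.1
  obtain ⟨w, hw, hw1⟩ := μ.exists_fundamental hL
  refine ⟨evalChain g.1 w, ?_⟩
  rw [← map_smul]
  refine Hc.mk_eq_mk_of_evalChain μ hK hL (fun σ hσ => ?_) hg hz hz1 hw hw1 ?_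
  · change _ * f.1 σ = 0
    rw [hf σ hσ, mul_zero]
  · change evalChain (_ • f.1) z = _
    rw [evalChain_smul, hfz, mul_one]

end Manifold

/-! ### The cap product with the functional dual to a top class -/

namespace BigradedLieAlgebra

open scoped TensorProduct

variable {F : Type v} [Field F] {g : BigradedLieAlgebra.{u, v} F}

lemma hom_ext_monomial {N : Type*} [AddCommGroup N] [Module F N] {φ ψ : g.Sym →ₗ[F] N}
    (h : ∀ i k a, g.IsMonomial i k a → φ a = ψ a) : φ = ψ := by
  have key : ∀ a : g.Sym, a ∈ Submodule.span F {a | ∃ i k, g.IsMonomial i k a} := by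
    intro a
    induction a using sym_induction with
    | one => exact Submodule.subset_span ⟨_, _, .one⟩
    | add a b ha hb => exact Submodule.add_mem _ ha hb
    | smul c a ha => exact Submodule.smul_mem _ c ha
    | mul i u x a ha =>
      induction ha using Submodule.span_induction with
      | mem a ha =>
        obtain ⟨j, v, ha⟩ := ha
        exact Submodule.subset_span ⟨_, _, .mul rfl rfl x ha⟩
      | zero => rw [mul_zero]; exact Submodule.zero_mem _
      | add a b _ _ ha hb => rw [mul_add]; exact Submodule.add_mem _ ha hb
      | smul c a _ ha => rw [mul_smul_comm]; exact Submodule.smul_mem _ c ha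
  refine LinearMap.ext fun a => ?_
  have := key a
  induction this using Submodule.span_induction with
  | mem a ha =>
    obtain ⟨i, k, ha⟩ := ha
    exact h i k a ha
  | zero => rw [map_zero, map_zero]
  | add a b _ _ ha hb => rw [map_add, map_add, ha, hb]
  | smul c a _ ha => rw [map_smul, map_smul, ha]

lemma IsMonomial.twist {i : ℤ} {k : ℕ} {a : g.Sym} (ha : g.IsMonomial i k a) (s : ℤ) :
    g.twist s a = sgn F (s * i) • a := by
  induction ha with
  | one => rw [map_one, mul_zero, sgn_zero, one_smul]
  | mul h e x _ ih =>
    rw [map_mul, twist_gen, ih, smul_mul_smul_comm, ← sgn_add, ← mul_add, h]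

variable (g) in
/-- The counit of `Sym(g[1])`. -/
def counit : g.Sym →ₐ[F] F := g.lift (fun _ _ => 0) fun x y => by simp

lemma counit_gen (i : ℤ) (u : ℕ) (y : g.obj i u) : g.counit (g.gen i u y) = 0 := by
  exact g.lift_gen (fun _ _ => 0) (fun x y => by simp) i u y

lemma counit_twist (s : ℤ) (a : g.Sym) : g.counit (g.twist s a) = g.counit a := by
  induction a using sym_induction with
  | one => simp
  | add a b ha hb => simp [ha, hb]
  | smul c a ha => simp [ha]
  | mul i u x a ha => simp [twist_gen, counit_gen]

lemma primMul_tmul {i : ℤ} {u : ℕ} (y : g.obj i u) (a b : g.Sym) :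
    g.primMul i u y (a ⊗ₜ b)
      = (g.gen i u y * a) ⊗ₜ[F] b + g.twist (i + 1) a ⊗ₜ[F] (g.gen i u y * b) := by
  simp [primMul]

/-- This half of the counit axiom evaluates the terms of the cap product in which the functional has
absorbed a generator. -/
lemma counit_comul (a : g.Sym) :
    TensorProduct.lid F g.Sym (TensorProduct.map g.counit.toLinearMap LinearMap.id (g.comul a))
      = a := by
  induction a using sym_induction with
  | one => simp [comul_one]
  | add a b ha hb => simp only [map_add, ha, hb]
  | smul c a ha => simp only [map_smul, ha]
  | mul i u y a ha =>
    rw [comul_gen_mul]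
    conv_rhs => rw [← ha]
    generalize g.comul a = t
    induction t using TensorProduct.induction_on with
    | zero => simp
    | add s t hs ht => simp only [map_add, hs, ht, mul_add]
    | tmul b c =>
      simp [primMul_tmul, counit_gen, counit_twist]

variable (g) in
/-- `x` spans the part of degree zero and weight one of `g[1]`, all other elements of `g[1]` have
degree at least their weight, and there are no elements of weight zero. -/
structure IsTopClass (x : g.obj (-1) 1) : Prop where
  ne_zero : x ≠ 0
  exists_smul_eq : ∀ y : g.obj (-1) 1, ∃ c : F, c • x = y
  weight_pos : ∀ (i : ℤ) (y : g.obj i 0), y = 0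
  weight_le : ∀ (i : ℤ) (u : ℕ) (y : g.obj i u), (i, u) ≠ (-1, 1) → i + 1 < u → y = 0

section DualFunctional

variable {x : g.obj (-1) 1} (hx : g.IsTopClass x) {l : g.Sym →ₗ[F] F}
  (hl : g.IsDualFunctional x l)

lemma IsTopClass.gen_eq_zero (hx : g.IsTopClass x) {i : ℤ} {u : ℕ} (hu : u = 0) (y : g.obj i u) :
    g.gen i u y = 0 := by
  subst hu
  rw [hx.weight_pos i y, map_zero]

lemma IsDualFunctional.apply_gen (hl : g.IsDualFunctional x l) {i : ℤ} {u : ℕ}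
    (h : (i, u) ≠ (-1, 1)) (y : g.obj i u) : l (g.gen i u y) = 0 := by
  refine hl.2 (i + 1) u (fun h' => h ?_) _ ?_
  · rw [Prod.mk.injEq] at h' ⊢
    exact ⟨by omega, h'.2⟩
  · rw [← mul_one (g.gen i u y)]
    exact isMonomial_mem (.mul (by ring) (add_zero u) y .one)

/-- The functional lives in degree zero, so Koszul signs in front of its values disappear. -/
lemma IsDualFunctional.sgn_mul (hl : g.IsDualFunctional x l) (s : ℤ) {i : ℤ} {u : ℕ}
    (y : g.obj i u) : sgn F (s * (i + 1)) * l (g.gen i u y) = l (g.gen i u y) := by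
  by_cases h : (i, u) = (-1, 1)
  · rw [Prod.mk.injEq] at h
    obtain ⟨rfl, rfl⟩ := h
    rw [neg_add_cancel, mul_zero, sgn_zero, one_mul]
  · rw [hl.apply_gen h, mul_zero]

lemma IsDualFunctional.apply_one (hl : g.IsDualFunctional x l) : l 1 = 0 :=
  hl.2 0 0 (by simp) 1 (isMonomial_mem .one)

lemma IsDualFunctional.apply_twist (hl : g.IsDualFunctional x l) (s : ℤ) (a : g.Sym) :
    l (g.twist s a) = l a := by
  refine LinearMap.congr_fun (f := l ∘ₗ (g.twist s).toLinearMap) (g := l)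
    (hom_ext_monomial fun i k a ha => ?_) a
  rw [LinearMap.comp_apply, AlgHom.toLinearMap_apply, ha.twist, map_smul]
  by_cases h : (i, k) = (0, 1)
  · rw [Prod.mk.injEq] at h
    rw [h.1, mul_zero, sgn_zero, one_smul]
  · rw [hl.2 i k h a (isMonomial_mem ha), smul_zero]

include hx hl

/-- Generators have positive weight, so a product of two or more of them has weight at least two and
is killed by `l`; only the constant term of `a` contributes. -/
lemma IsTopClass.apply_gen_mul {i : ℤ} {u : ℕ} (y : g.obj i u) (a : g.Sym) :
    l (g.gen i u y * a) = l (g.gen i u y) * g.counit a := by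
  refine LinearMap.congr_fun (f := l ∘ₗ LinearMap.mulLeft F (g.gen i u y))
    (g := l (g.gen i u y) • g.counit.toLinearMap) (hom_ext_monomial fun j k a ha => ?_) a
  change l (g.gen i u y * a) = l (g.gen i u y) * g.counit a
  cases ha with
  | one => rw [mul_one, map_one, mul_one]
  | @mul i' j' _ u' v' _ h e z b hb =>
    rw [map_mul g.counit, counit_gen, zero_mul, mul_zero]
    rcases Nat.eq_zero_or_pos u with hu | hu
    · rw [hx.gen_eq_zero hu, zero_mul, map_zero]
    rcases Nat.eq_zero_or_pos u' with hu' | hu'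
    · rw [hx.gen_eq_zero hu', zero_mul, mul_zero, map_zero]
    refine hl.2 _ (u + k) (fun h => ?_) _ (isMonomial_mem (.mul rfl rfl y (.mul h e z hb)))
    rw [Prod.mk.injEq] at h
    omega

/-- In the coproduct of `y a` the primitive `y` goes either to the left, where `l` leaves only the
counit of the other left factor, or to the right, where it passes `l` without a sign. -/
lemma IsTopClass.cap_gen_mul {i : ℤ} {u : ℕ} (y : g.obj i u) (a : g.Sym) :
    g.cap l (g.gen i u y * a) = l (g.gen i u y) • a + g.gen i u y * g.cap l a := by
  have key : ∀ t, TensorProduct.lid F g.Sym (TensorProduct.map l LinearMap.id (g.primMul i u y t))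
      = l (g.gen i u y) • TensorProduct.lid F g.Sym
          (TensorProduct.map g.counit.toLinearMap LinearMap.id t)
        + g.gen i u y * TensorProduct.lid F g.Sym (TensorProduct.map l LinearMap.id t) := by
    intro t
    induction t using TensorProduct.induction_on with
    | zero => simp
    | add s t hs ht =>
      simp only [map_add, hs, ht, mul_add, smul_add]
      abel
    | tmul b c =>
      simp [primMul_tmul, hx.apply_gen_mul hl, hl.apply_twist, smul_smul]
  have := key (g.comul a)
  rw [counit_comul, ← comul_gen_mul] at this
  exact this

omit hx in
lemma IsDualFunctional.cap_one : g.cap l 1 = 0 := by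
  simp [cap, comul_one, hl.apply_one]

lemma IsTopClass.cap_gen {i : ℤ} {u : ℕ} (y : g.obj i u) :
    g.cap l (g.gen i u y) = l (g.gen i u y) • 1 := by
  rw [← mul_one (g.gen i u y), hx.cap_gen_mul hl, hl.cap_one, mul_zero, add_zero, mul_one]

lemma IsTopClass.cap_mul (a b : g.Sym) : g.cap l (a * b) = g.cap l a * b + a * g.cap l b := by
  induction a using sym_induction with
  | one => rw [hl.cap_one, zero_mul, zero_add, one_mul, one_mul]
  | add a a' ha ha' => simp only [add_mul, map_add, ha, ha']; abel
  | smul c a ha => simp only [smul_mul_assoc, map_smul, ha, smul_add]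
  | mul i u y a ha =>
    rw [mul_assoc, hx.cap_gen_mul hl, hx.cap_gen_mul hl, ha, mul_add, add_mul, smul_mul_assoc]
    simp only [mul_assoc, add_assoc]

lemma IsTopClass.cap_eq_zero {a : g.Sym} (ha : a ∈ g.restAlgebra) : g.cap l a = 0 := by
  induction ha using Algebra.adjoin_induction with
  | mem a ha =>
    obtain ⟨i, u, y, h, rfl⟩ := ha
    rw [hx.cap_gen hl, hl.apply_gen h, zero_smul]
  | algebraMap r => rw [Algebra.algebraMap_eq_smul_one, map_smul, hl.cap_one, smul_zero]
  | add a b _ _ ha hb => rw [map_add, ha, hb, add_zero]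
  | mul a b _ _ ha hb => rw [hx.cap_mul hl, ha, hb, zero_mul, mul_zero, add_zero]

lemma IsTopClass.cap_pow_mul (r : ℕ) {a : g.Sym} (ha : a ∈ g.restAlgebra) :
    g.cap l (g.gen (-1) 1 x ^ r * a) = (r : F) • (g.gen (-1) 1 x ^ (r - 1) * a) := by
  induction r with
  | zero => rw [pow_zero, one_mul, hx.cap_eq_zero hl ha, Nat.cast_zero, zero_smul]
  | succ r ih =>
    rw [pow_succ', mul_assoc, hx.cap_gen_mul hl, ih, hl.1, one_smul, Nat.add_sub_cancel,
      mul_smul_comm, ← mul_assoc, ← pow_succ', Nat.cast_succ, add_smul, one_smul, add_comm]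
    rcases r with _ | r
    · simp
    · rfl

/-- A bracket of elements of positive weight has weight at least two. This is why the cap product
commutes with the differential. -/
lemma IsTopClass.cap_symBracket {i j : ℤ} {u v : ℕ} (y : g.obj i u) (z : g.obj j v) :
    g.cap l (g.symBracket y z) = 0 := by
  rw [symBracket, map_smul, hx.cap_gen hl]
  by_cases h : u + v = 1
  · rcases Nat.eq_zero_or_pos u with rfl | hu
    · rw [hx.weight_pos i y, map_zero, LinearMap.zero_apply, map_zero, map_zero, zero_smul,
        smul_zero]
    · obtain rfl : v = 0 := by omega
      rw [hx.weight_pos j z, map_zero, map_zero, map_zero, zero_smul, smul_zero]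
  · rw [hl.apply_gen (fun h' => h (Prod.mk.inj h').2), zero_smul, smul_zero]

lemma IsTopClass.cap_ad {i : ℤ} {u : ℕ} (y : g.obj i u) (a : g.Sym) :
    g.cap l (g.ad y a) = g.ad y (g.cap l a) := by
  induction a using sym_induction with
  | one => rw [ad_one, hl.cap_one, map_zero, map_zero]
  | add a b ha hb => simp only [map_add, ha, hb]
  | smul c a ha => simp only [map_smul, ha]
  | mul j v z a ha =>
    rw [ad_gen_mul, map_add, map_smul, hx.cap_gen_mul hl, hx.cap_gen_mul hl, hx.cap_mul hl,
      hx.cap_symBracket hl, ha, map_add, map_smul, ad_gen_mul, smul_add, smul_smul, hl.sgn_mul,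
      zero_mul, zero_add]
    abel

/-- Induction along the recursion for `d`: the cap product commutes with every `D_y`, and the sign
`(-1)^|y|` is trivial wherever `l` is nonzero on `y`. -/
lemma IsTopClass.cap_d (a : g.Sym) : g.cap l (g.d a) = g.d (g.cap l a) := by
  induction a using sym_induction with
  | one => rw [d_one, hl.cap_one, map_zero, map_zero]
  | add a b ha hb => simp only [map_add, ha, hb]
  | smul c a ha => simp only [map_smul, ha]
  | mul i u y a ha =>
    have := hl.sgn_mul 1 y
    rw [one_mul] at this
    rw [d_gen_mul, map_add, map_smul, hx.cap_gen_mul hl, hx.cap_gen_mul hl, hx.cap_ad hl, ha,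
      map_add, map_smul, d_gen_mul, smul_add, smul_smul, this]
    abel

/-- Weight zero is a separate clause because there is no weight `-1`; the induction meets it when
the remaining factor has weight zero. -/
lemma IsTopClass.cap_monomial {i : ℤ} {k : ℕ} {a : g.Sym} (ha : g.IsMonomial i k a) :
    (k = 0 → g.cap l a = 0) ∧ ∀ k', k = k' + 1 → g.cap l a ∈ g.piece i k' := by
  induction ha with
  | one => exact ⟨fun _ => hl.cap_one, fun k' h => by omega⟩
  | @mul i j _ u v _ h e y a ha ih =>
    subst h e
    refine ⟨fun h => ?_, fun k' h => ?_⟩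
    · rw [hx.gen_eq_zero (by omega), zero_mul, map_zero]
    · rw [hx.cap_gen_mul hl]
      refine Submodule.add_mem _ ?_ ?_
      · by_cases hy : (i, u) = (-1, 1)
        · rw [Prod.mk.injEq] at hy
          obtain ⟨rfl, rfl⟩ := hy
          obtain rfl : v = k' := by omega
          rw [neg_add_cancel, zero_add]
          exact Submodule.smul_mem _ _ (isMonomial_mem ha)
        · rw [hl.apply_gen hy, zero_smul]
          exact Submodule.zero_mem _
      · rcases v with _ | v
        · rw [ih.1 rfl, mul_zero]
          exact Submodule.zero_mem _
        · exact gen_mul_mem_piece rfl (by omega) y (ih.2 v rfl)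

lemma IsTopClass.cap_mem_piece {i : ℤ} {k : ℕ} {a : g.Sym} (ha : a ∈ g.piece i (k + 1)) :
    g.cap l a ∈ g.piece i k := by
  induction ha using Submodule.span_induction with
  | mem a ha => exact (hx.cap_monomial hl ha).2 k rfl
  | zero => rw [map_zero]; exact Submodule.zero_mem _
  | add a b _ _ ha hb => rw [map_add]; exact Submodule.add_mem _ ha hb
  | smul c a _ ha => rw [map_smul]; exact Submodule.smul_mem _ c ha

lemma IsTopClass.cap_eq_zero_of_weight_zero {i : ℤ} {a : g.Sym} (ha : a ∈ g.piece i 0) :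
    g.cap l a = 0 := by
  induction ha using Submodule.span_induction with
  | mem a ha => exact (hx.cap_monomial hl ha).1 rfl
  | zero => rw [map_zero]
  | add a b _ _ ha hb => rw [map_add, ha, hb, add_zero]
  | smul c a _ ha => rw [map_smul, ha, smul_zero]

end DualFunctional

/-! #### Monomials in the generators other than the top class -/

variable (g) in
/-- Products of homogeneous elements of `g[1]` which are not of degree zero and weight one. -/
inductive IsRestMonomial : ℤ → ℕ → g.Sym → Prop
  | one : IsRestMonomial 0 0 1
  | mul {i j k : ℤ} {u v w : ℕ} (h : i + 1 + j = k) (e : u + v = w) (hi : (i, u) ≠ (-1, 1))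
      (y : g.obj i u) {a : g.Sym} (ha : IsRestMonomial j v a) : IsRestMonomial k w (g.gen i u y * a)

lemma IsRestMonomial.isMonomial {i : ℤ} {k : ℕ} {a : g.Sym} (ha : g.IsRestMonomial i k a) :
    g.IsMonomial i k a := by
  induction ha with
  | one => exact .one
  | mul h e _ y _ ih => exact .mul h e y ih

lemma IsRestMonomial.mem_restAlgebra {i : ℤ} {k : ℕ} {a : g.Sym} (ha : g.IsRestMonomial i k a) :
    a ∈ g.restAlgebra := by
  induction ha with
  | one => exact Subalgebra.one_mem _
  | mul h e hi y _ ih => exact Subalgebra.mul_mem _ (Algebra.subset_adjoin ⟨_, _, y, hi, rfl⟩) ih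

lemma gen_mul_gen_top (x : g.obj (-1) 1) {i : ℤ} {u : ℕ} (y : g.obj i u) :
    g.gen i u y * g.gen (-1) 1 x = g.gen (-1) 1 x * g.gen i u y := by
  rw [gen_mul_gen, neg_add_cancel, mul_zero, sgn_zero, one_smul]

lemma gen_pow_mul_mem_piece (x : g.obj (-1) 1) (r : ℕ) {i : ℤ} {k : ℕ} {a : g.Sym}
    (ha : a ∈ g.piece i k) : g.gen (-1) 1 x ^ r * a ∈ g.piece i (r + k) := by
  induction r with
  | zero => rwa [pow_zero, one_mul, zero_add]
  | succ r ih =>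
    rw [pow_succ', mul_assoc]
    exact gen_mul_mem_piece (by ring) (by ring) x ih

variable {x : g.obj (-1) 1} (hx : g.IsTopClass x)

include hx

/-- If the degree of a product is less than its weight, the same holds for one of the factors, which
is then zero. -/
lemma IsTopClass.restMonomial_eq_zero {i : ℤ} {k : ℕ} {a : g.Sym} (ha : g.IsRestMonomial i k a)
    (h : i < k) : a = 0 := by
  induction ha with
  | one => exact absurd h (by simp)
  | @mul i j _ u v _ h₁ e hi y a _ ih =>
    subst h₁ e
    by_cases h' : i + 1 < u
    · rw [hx.weight_le i u y hi h', map_zero, zero_mul]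
    · rw [ih (by push_cast at h; omega), mul_zero]

/-- Each element is a linear combination of products of a power of the top class with a monomial
in other generators. -/
lemma IsTopClass.piece_le (i : ℤ) (k : ℕ) : g.piece i k ≤ Submodule.span F
    {a | ∃ (r k' : ℕ) (b : g.Sym), r + k' = k ∧ g.IsRestMonomial i k' b ∧
      a = g.gen (-1) 1 x ^ r * b} := by
  refine Submodule.span_le.2 fun a ha => ?_
  change g.IsMonomial i k a at ha
  induction ha with
  | one => exact Submodule.subset_span ⟨0, 0, 1, rfl, .one, by simp⟩
  | @mul i j _ u v _ h₁ e y a h ih =>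
    subst h₁ e
    rw [SetLike.mem_coe] at ih ⊢
    clear h
    induction ih using Submodule.span_induction with
    | mem a ha =>
      obtain ⟨r, k', b, rfl, hb, rfl⟩ := ha
      by_cases hy : (i, u) = (-1, 1)
      · rw [Prod.mk.injEq] at hy
        obtain ⟨rfl, rfl⟩ := hy
        obtain ⟨c, rfl⟩ := hx.exists_smul_eq y
        rw [map_smul, smul_mul_assoc, ← mul_assoc, ← pow_succ', neg_add_cancel, zero_add]
        exact Submodule.smul_mem _ _ (Submodule.subset_span ⟨r + 1, k', b, by ring, hb, rfl⟩)
      · refine Submodule.subset_span ⟨r, u + k', g.gen i u y * b, by ring, .mul rfl rfl hy y hb, ?_⟩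
        have : Commute (g.gen i u y) (g.gen (-1) 1 x) := gen_mul_gen_top x y
        rw [← mul_assoc, (this.pow_right r).eq, mul_assoc]
    | zero => rw [mul_zero]; exact Submodule.zero_mem _
    | add a b _ _ ha hb => rw [mul_add]; exact Submodule.add_mem _ ha hb
    | smul c a _ ha => rw [mul_smul_comm]; exact Submodule.smul_mem _ c ha

/-- The degree is less than the weight `k + 1`, so the terms without a factor `x` vanish. This is
the source of the stable range. -/
lemma IsTopClass.exists_eq_gen_mul {i : ℤ} {k : ℕ} (h : i ≤ k) {a : g.Sym}
    (ha : a ∈ g.piece i (k + 1)) : ∃ b ∈ g.piece i k, a = g.gen (-1) 1 x * b := by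
  replace ha := hx.piece_le i (k + 1) ha
  induction ha using Submodule.span_induction with
  | mem a ha =>
    obtain ⟨r, k', b, hr, hb, rfl⟩ := ha
    rcases r with _ | r
    · rw [hx.restMonomial_eq_zero hb (by omega)]
      exact ⟨0, Submodule.zero_mem _, by simp⟩
    · obtain rfl : r + k' = k := by omega
      exact ⟨_, gen_pow_mul_mem_piece x r (isMonomial_mem hb.isMonomial), by
        rw [pow_succ', mul_assoc]⟩
  | zero => exact ⟨0, Submodule.zero_mem _, by simp⟩
  | add a b _ _ ha hb =>
    obtain ⟨a', ha', rfl⟩ := ha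
    obtain ⟨b', hb', rfl⟩ := hb
    exact ⟨a' + b', Submodule.add_mem _ ha' hb', by rw [mul_add]⟩
  | smul c a _ ha =>
    obtain ⟨a', ha', rfl⟩ := ha
    exact ⟨c • a', Submodule.smul_mem _ _ ha', by rw [mul_smul_comm]⟩

variable {l : g.Sym →ₗ[F] F} (hl : g.IsDualFunctional x l)

include hl

/-- An antiderivative of `x ^ r * b` is `x ^ (r + 1) * b` divided by `r + 1`. -/
lemma IsTopClass.exists_cap_eq [CharZero F] {i : ℤ} {k : ℕ} {a : g.Sym} (ha : a ∈ g.piece i k) :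
    ∃ b ∈ g.piece i (k + 1), g.cap l b = a := by
  replace ha := hx.piece_le i k ha
  induction ha using Submodule.span_induction with
  | mem a ha =>
    obtain ⟨r, k', b, rfl, hb, rfl⟩ := ha
    refine ⟨((r + 1 : ℕ) : F)⁻¹ • (g.gen (-1) 1 x ^ (r + 1) * b), Submodule.smul_mem _ _ ?_, ?_⟩
    · rw [show r + k' + 1 = r + 1 + k' by ring]
      exact gen_pow_mul_mem_piece x _ (isMonomial_mem hb.isMonomial)
    · rw [map_smul, hx.cap_pow_mul hl _ hb.mem_restAlgebra, smul_smul,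
        inv_mul_cancel₀ (Nat.cast_ne_zero.2 r.succ_ne_zero), one_smul, Nat.add_sub_cancel]
  | zero => exact ⟨0, Submodule.zero_mem _, map_zero _⟩
  | add a b _ _ ha hb =>
    obtain ⟨a', ha', rfl⟩ := ha
    obtain ⟨b', hb', rfl⟩ := hb
    exact ⟨a' + b', Submodule.add_mem _ ha' hb', map_add _ _ _⟩
  | smul c a _ ha =>
    obtain ⟨a', ha', rfl⟩ := ha
    exact ⟨c • a', Submodule.smul_mem _ _ ha', map_smul _ _ _⟩

/-- Differentiating `(m + 1) b + x b' = 0` gives `(m + 2) b' + x b'' = 0`, the same equation for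
`b'` in lower weight; derivatives vanish in weight zero. The integer `m` is kept general for this
induction, and the case `m = 0` says that `x b` has zero derivative. -/
lemma IsTopClass.eq_zero_of_smul_add [CharZero F] {i : ℤ} {k : ℕ} {b : g.Sym}
    (hb : b ∈ g.piece i k) (m : ℕ) (h : ((m + 1 : ℕ) : F) • b + g.gen (-1) 1 x * g.cap l b = 0) :
    b = 0 := by
  have key : g.cap l b = 0 := by
    induction k generalizing b m with
    | zero => exact hx.cap_eq_zero_of_weight_zero hl hb
    | succ k ih =>
      have hm : ((m + 1 + 1 : ℕ) : F) • g.cap l b + g.gen (-1) 1 x * g.cap l (g.cap l b) = 0 := by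
        have := congrArg (g.cap l) h
        rw [map_add, map_smul, hx.cap_gen_mul hl, hl.1, one_smul, map_zero, ← add_assoc] at this
        rw [Nat.cast_succ (m + 1), add_smul, one_smul, this]
      have h0 := ih (hx.cap_mem_piece hl hb) (m + 1) hm
      rw [h0, mul_zero, add_zero] at hm
      exact (smul_eq_zero.1 hm).resolve_left (Nat.cast_ne_zero.2 (m + 1).succ_ne_zero)
  rw [key, mul_zero, add_zero] at h
  exact (smul_eq_zero.1 h).resolve_left (Nat.cast_ne_zero.2 m.succ_ne_zero)

lemma IsTopClass.eq_zero_of_cap_eq_zero [CharZero F] {i : ℤ} {k : ℕ} (h : i ≤ k) {a : g.Sym}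
    (ha : a ∈ g.piece i (k + 1)) (h0 : g.cap l a = 0) : a = 0 := by
  obtain ⟨b, hb, rfl⟩ := hx.exists_eq_gen_mul h ha
  rw [hx.cap_gen_mul hl, hl.1] at h0
  rw [hx.eq_zero_of_smul_add hl hb 0 (by simpa using h0), mul_zero]

omit hl

/-- The functional dual to a top class exists and is unique. -/
theorem IsTopClass.existsUnique_isDualFunctional : ∃! l, g.IsDualFunctional x l := by
  refine existsUnique_of_exists_of_unique ?_ fun l l' hl hl' => hom_ext_monomial fun i k a ha => ?_
  · obtain ⟨ξ, hξ⟩ : ∃ ξ : Module.Dual F (g.obj (-1) 1), ξ x = 1 :=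
      Module.Projective.exists_dual_eq_one F hx.ne_zero
    let φ (i : ℤ) (u : ℕ) : g.obj i u →ₗ[F] F := ξ ∘ₗ
      DirectSum.component F (ℤ × ℕ) (fun iu => g.obj iu.1 iu.2) (-1, 1) ∘ₗ
      DirectSum.lof F (ℤ × ℕ) (fun iu => g.obj iu.1 iu.2) (i, u)
    have hφ1 : φ (-1) 1 x = 1 := by
      simp only [φ, LinearMap.comp_apply, DirectSum.component.lof_self]
      exact hξ
    have hφ0 : ∀ i u (y : g.obj i u), (i, u) ≠ (-1, 1) → φ i u y = 0 := by
      intro i u y h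
      simp only [φ, LinearMap.comp_apply]
      rw [DirectSum.component.of, dif_neg h, map_zero]
    -- Generators go to multiples of `ε`, so products of two of them vanish. The coefficient of `ε`
    -- thus extends `φ` by zero to all other products.
    let Φ : g.Sym →ₐ[F] DualNumber F := g.lift (fun i u => TrivSqZeroExt.inrHom F F ∘ₗ φ i u)
      (fun y z => by simp)
    have hΦ : ∀ i u (y : g.obj i u), Φ (g.gen i u y) = TrivSqZeroExt.inr (φ i u y) :=
      fun i u y => g.lift_gen _ _ i u y
    refine ⟨TrivSqZeroExt.sndHom F F ∘ₗ Φ.toLinearMap, ?_, fun i k h a ha => ?_⟩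
    · simp [hΦ, hφ1]
    · induction ha using Submodule.span_induction with
      | mem a ha =>
        cases ha with
        | one => simp
        | @mul i j _ u v _ h₁ e y b hb =>
          subst h₁ e
          cases hb with
          | one =>
            rw [LinearMap.comp_apply, AlgHom.toLinearMap_apply, mul_one, hΦ, hφ0 i u y]
            · simp
            · rintro h'
              rw [Prod.mk.injEq] at h'
              apply h
              rw [h'.1, h'.2]
              rfl
          | mul _ _ z _ => simp [hΦ, ← mul_assoc]
      | zero => rw [map_zero]
      | add a b _ _ ha hb => rw [map_add, ha, hb, add_zero]
      | smul c a _ ha => rw [map_smul, ha, smul_zero]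
  · by_cases h : (i, k) = (0, 1)
    · rw [Prod.mk.injEq] at h
      obtain ⟨rfl, rfl⟩ := h
      -- In bidegree `(0, 1)` every element is `x b` with `b` of weight zero, where both functionals
      -- give the counit of `b`.
      obtain ⟨b, hb, rfl⟩ := hx.exists_eq_gen_mul (k := 0) le_rfl (isMonomial_mem ha)
      rw [hx.apply_gen_mul hl, hx.apply_gen_mul hl', hl.1, hl'.1]
    · rw [hl.2 i k h a (isMonomial_mem ha), hl'.2 i k h a (isMonomial_mem ha)]

/-! #### The chain map -/

variable (g) in
/-- The cap product with the dual functional, as a chain map which lowers the weight by one. -/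
theorem IsTopClass.exists_chainMap [CharZero F] (hl : g.IsDualFunctional x l) (k : ℕ) :
    ∃ φ : g.CE (k + 1) ⟶ g.CE k,
      (∀ (i : ℤ) (a : (g.CE (k + 1)).X i),
        CE.incl g k i (φ.f i a) = g.cap l (CE.incl g (k + 1) i a)) ∧
      (∀ i : ℤ, Function.Surjective (φ.f i)) ∧
      (∀ i : ℤ, i ≤ k → Function.Bijective (φ.f i)) ∧
      ∀ i : ℤ, i ≤ k → CategoryTheory.IsIso (HomologicalComplex.homologyMap φ i) := by
  let f (i : ℤ) : g.piece i (k + 1) →ₗ[F] g.piece i k :=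
    (g.cap l).restrict fun _ ha => hx.cap_mem_piece hl ha
  have hsurj : ∀ i, Function.Surjective (f i) := fun i a => by
    obtain ⟨b, hb, h⟩ := hx.exists_cap_eq hl a.2
    exact ⟨⟨b, hb⟩, Subtype.ext h⟩
  have hinj : ∀ i : ℤ, i ≤ k → Function.Injective (f i) := fun i hi => by
    rw [injective_iff_map_eq_zero]
    exact fun a ha => Subtype.ext (hx.eq_zero_of_cap_eq_zero hl hi a.2 (congrArg Subtype.val ha))
  let φ : g.CE (k + 1) ⟶ g.CE k := ChainComplex.ofHom (fun i => ModuleCat.ofHom (f i)) fun i => by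
    have hd : ∀ k, (g.CE k).d (i + 1) i = ModuleCat.ofHom (g.dPiece k i) := fun k =>
      dif_pos rfl
    rw [hd, hd]
    refine ModuleCat.hom_ext (LinearMap.ext fun a => Subtype.ext ?_)
    exact (hx.cap_d hl a.1).symm
  have hepi : ∀ i, CategoryTheory.Epi (φ.f i) := fun i =>
    (ModuleCat.epi_iff_surjective _).2 (hsurj i)
  have hmono : ∀ i : ℤ, i ≤ k → CategoryTheory.Mono (φ.f i) := fun i hi =>
    (ModuleCat.mono_iff_injective _).2 (hinj i hi)
  refine ⟨φ, fun i a => rfl, hsurj, fun i hi => ⟨hinj i hi, hsurj i⟩, fun i hi => ?_⟩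
  -- The differential into degree `i` starts in degree `i + 1`, which may lie outside the stable
  -- range; there surjectivity suffices.
  refine CategoryTheory.ShortComplex.isIso_homologyMap_of_epi_of_isIso_of_mono' _ (hepi _) ?_ ?_
  · have := hepi i
    have := hmono i hi
    exact CategoryTheory.isIso_of_mono_of_epi (φ.f i)
  · refine hmono _ ?_
    rw [ComplexShape.next_eq' (ComplexShape.down ℤ) (show (ComplexShape.down ℤ).Rel i (i - 1) by simp)]
    omega

end BigradedLieAlgebra

/-! ### The top class of a manifold -/

section TopClass

variable {F : Type v} [Field F] {X : Type u} [TopologicalSpace X] {n : ℕ}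

lemma isIndex_top (n : ℕ) : IsIndex n (-1) 1 n := ⟨by push_cast; ring, Or.inl rfl⟩

lemma comp_topClass (x : Hc F X n) : LieObj.comp F X n (isIndex_top n) (topClass F X n x) = x :=
  rfl

/-- An element of the Lie algebra of a space is zero if its components are. -/
lemma manifoldLieAlgebra_ext {i : ℤ} {u : ℕ} {y z : (manifoldLieAlgebra F X n).obj i u}
    (h : ∀ (t : ℕ) (ht : IsIndex n i u t), LieObj.comp F X t ht y = LieObj.comp F X t ht z) :
    y = z :=
  LieObj.ext h

/-- Any component violating the degree bound lies in `H_c^t` with `t > n`. In weight one this is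
immediate; in weight two the violation means `t > 2n - 3`, and `2n - 3 ≥ n` because `n > 2`. -/
lemma isTopClass_topClass (hn : 2 < n) (hdim : ∀ t, n < t → ∀ y : Hc F X t, y = 0) {x : Hc F X n}
    (hx : x ≠ 0) (hspan : ∀ y : Hc F X n, ∃ c : F, c • x = y) :
    (manifoldLieAlgebra F X n).IsTopClass (topClass F X n x) where
  ne_zero h := hx (by
    rw [← comp_topClass x, h]
    exact map_zero (LieObj.comp F X n (isIndex_top n)))
  exists_smul_eq y := by
    obtain ⟨c, hc⟩ := hspan (LieObj.comp F X n (isIndex_top n) y)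
    refine ⟨c, manifoldLieAlgebra_ext fun t ht => ?_⟩
    obtain rfl : t = n := by
      have := ht.1
      push_cast at this
      omega
    rw [← hc]
    exact (map_smul (LieObj.comp F X t ht) c _).trans (congrArg (c • ·) (comp_topClass x))
  weight_pos i y := manifoldLieAlgebra_ext fun t ht => absurd ht.2 (by simp)
  weight_le i u y h hlt := manifoldLieAlgebra_ext fun t ht => by
    have key : n < t := by
      obtain ⟨h1, rfl | ⟨rfl, -⟩⟩ := ht
      · have : i ≠ -1 := fun h' => h (by rw [h'])
        push_cast at h1 hlt
        omega
      · push_cast at h1 hlt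
        omega
    exact (hdim t key _).trans (hdim t key _).symm

end TopClass

end ConfLie

end

/-! ### The main theorem. -/

theorem mainTheorem12 {F : Type*} [Field F] [CharZero F] {n : ℕ} (hn : 2 < n)
    {M : Type*} [TopologicalSpace M] [T2Space M] [ConnectedSpace M]
    [ChartedSpace (EuclideanSpace ℝ (Fin n)) M]
    (μ : HomologicalOrientation F M n) (p : M) :
    -- the Poincaré dual `x` of the class of a point exists and is unique
    (∃! x : Hc F M n, IsPoincareDualPoint μ p x) ∧
    ∀ x : Hc F M n, IsPoincareDualPoint μ p x →
      -- the dual functional of `x` exists and is unique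
      (∃! l : (manifoldLieAlgebra F M n).Sym →ₗ[F] F,
        (manifoldLieAlgebra F M n).IsDualFunctional (topClass F M n x) l) ∧
      ∀ l : (manifoldLieAlgebra F M n).Sym →ₗ[F] F,
        (manifoldLieAlgebra F M n).IsDualFunctional (topClass F M n x) l →
        -- cap product with the dual functional acts as `d/dx`
        (∀ (r : ℕ), ∀ y ∈ (manifoldLieAlgebra F M n).restAlgebra,
          (manifoldLieAlgebra F M n).cap l
              ((manifoldLieAlgebra F M n).gen (-1) 1 (topClass F M n x) ^ r * y)
            = (r : F) •
              ((manifoldLieAlgebra F M n).gen (-1) 1 (topClass F M n x) ^ (r - 1) * y)) ∧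
        ∀ k : ℕ, ∃ φ : (manifoldLieAlgebra F M n).CE (k + 1) ⟶ (manifoldLieAlgebra F M n).CE k,
          -- cap product with the dual functional restricts to a chain map `φ`
          (∀ (i : ℤ) (a : ((manifoldLieAlgebra F M n).CE (k + 1)).X i),
            BigradedLieAlgebra.CE.incl (manifoldLieAlgebra F M n) k i (φ.f i a)
              = (manifoldLieAlgebra F M n).cap l
                (BigradedLieAlgebra.CE.incl (manifoldLieAlgebra F M n) (k + 1) i a)) ∧
          (∀ i : ℤ, Function.Surjective (φ.f i)) ∧
          (∀ i : ℤ, i ≤ k → Function.Bijective (φ.f i)) ∧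
          ∀ i : ℤ, i ≤ k → CategoryTheory.IsIso (HomologicalComplex.homologyMap φ i) := by
  -- In positive degree relative cycles are given by a condition on their boundary, so the dimension
  -- is written as a successor.
  obtain ⟨m, rfl⟩ : ∃ m, n = m + 1 := ⟨n - 1, by omega⟩
  refine ⟨existsUnique_isPoincareDualPoint μ p, fun x hx => ?_⟩
  have htop := isTopClass_topClass hn (fun t ht y => Hc.eq_zero_of_dim_lt F m M ht y) hx.ne_zero
    hx.exists_smul_eq
  exact ⟨htop.existsUnique_isDualFunctional, fun l hl =>
    ⟨fun r y hy => htop.cap_pow_mul hl r hy, fun k => htop.exists_chainMap _ hl k⟩⟩
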